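/- **Setting.** Let $\hat g$ be one of the affine Lie algebras $a_n^{(1)}$ ($n\ge2$), $d_n^{(1)}$ ($n\ge4$), $e_6^{(1)},e_7^{(1)},e_8^{(1)}$, $b_n^{(1)}$ ($n\ge3$), $c_n^{(1)}$ ($n\ge2$), $a_{2n}^{(2)}$ ($n\ge2$), $a_{2n-1}^{(2)}$ ($n\ge3$), $d_{n+1}^{(2)}$ ($n\ge2$), $e_6^{(2)}$, $f_4^{(1)}$, $g_2^{(1)}$, $d_4^{(3)}$, $a_2^{(2)}$, with extended Cartan matrix $(a_{ij})_{0\le i,j\le n}$ and coprime positive integers $d_i$ such that $d_ia_{ij}=d_ja_{ji}$. Let $q\in\mathbb C^*$ not be a root of unity, fix a square root $q^{1/2}$, and put $q_i=q^{d_i}$, $q_i^{1/2}=(q^{1/2})^{d_i}$, $[a]_q=\frac{q^a-q^{-a}}{q-q^{-1}}$, with the associated $q$-factorials and $q$-binomials. For $\hat g=g_2^{(1)},d_4^{(3)}$ assume $q^4+2q^2+4+2q^{-2}+q^{-4}\ne0$, and for $\hat g=a_2^{(2)}$ assume $q^4+q^{-4}+3\neq0$. $U_q(\hat g)$ is the unital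 associative $\mathbb C$-algebra generated by $e_i,f_i,q_i^{\pm h_i/2}$ with relations (for all $i,j$) $q_i^{\pm h_i/2}q_i^{\mp h_i/2}=1$, $q_i^{h_i/2}q_j^{h_j/2}=q_j^{h_j/2}q_i^{h_i/2}$, $q_i^{h_i/2}e_jq_i^{-h_i/2}=q_i^{a_{ij}/2}e_j$, $q_i^{h_i/2}f_jq_i^{-h_i/2}=q_i^{-a_{ij}/2}f_j$, $[e_i,f_j]=\delta_{ij}\frac{q_i^{h_i}-q_i^{-h_i}}{q_i-q_i^{-1}}$, and, for $i\ne j$, $$\sum_{r=0}^{1-a_{ij}}(-1)^r\begin{bmatrix}1-a_{ij}\\r\end{bmatrix}_{q_i}x_i^{1-a_{ij}-r}x_jx_i^r=0\qquad\text{for } x=e\text{ and } x=f.$$ For scalars $\rho=(\rho^k_{ij})$, $i\neq j$, $0\le k<\lceil -a_{ij}/2\rceil$, the generalized $q$-Onsager algebra $O_q(\hat g)=O_q(\hat g;\rho)$ is the unital associative $\mathbb C$-algebra generated by $A_0,\dots,A_n$ with relations, for $i\ne j$, $$\sum_{r=0}^{1-a_{ij}}(-1)^r\begin{bmatrix}1-a_{ij}\\r\end{bmatrix}_{q_i}A_i^{1-a_{ij}-r}A_jA_i^r=\sum_{k=0}^{\lceil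 -a_{ij}/2\rceil-1}\rho^k_{ij}\sum_{l=0}^{-a_{ij}-1-2k}(-1)^l\gamma^{kl}_{ij}A_i^{-a_{ij}-1-2k-l}A_jA_i^l,$$ where $\gamma^{kl}_{ij}=1$, except that $\gamma^{01}_{ij}=\frac{(q+q^{-1})(q^2+q^{-2})(q^2+3+q^{-2})}{q^4+2q^2+4+2q^{-2}+q^{-4}}$ if $a_{ij}=-3$, and $\gamma^{01}_{ij}=\gamma^{02}_{ij}=\frac{[3]_q[5]_q}{q^4+q^{-4}+3}$ if $a_{ij}=-4$. Let $c_i,\bar c_i,w_i\in\mathbb C$ ($0\le i\le n$). Call $\rho$ *admissible* if there is an algebra homomorphism $O_q(\hat g;\rho)\to U_q(\hat g)$ with $$A_i\mapsto c_i\,e_iq_i^{h_i/2}+\bar c_i\,f_iq_i^{h_i/2}+w_iq_i^{h_i}\qquad\text{for all } i .$$ Put $P_i=w_i^2+\frac{c_i\bar c_i}{q_i+q_i^{-1}-2}$ and $T_i=w_i^2+\frac{c_i\bar c_i(q_i+q_i^{-1}-1)^2}{q_i+q_i^{-1}-2}$. The *constraints* are: * if $i,j$ are simply linked ($a_{ij}=a_{ji}=-1$):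 $w_iP_j=0$ and $w_jP_i=0$; * if $i,j$ are doubly linked with $i$ the longer root ($a_{ij}=-1,a_{ji}=-2$): $w_jP_i=0$; * if $i,j$ are triply linked with $i$ the longer root ($a_{ij}=-1,a_{ji}=-3$): $w_jP_i=0$ and $w_iP_jT_j=0$; * for $a_2^{(2)}$ with $i$ the longer root ($a_{ij}=-1,a_{ji}=-4$): $w_jP_i=0$. Let $\bar\rho$ be given by * $\bar\rho^0_{ij}=c_i\bar c_i$ if $a_{ij}=-1$; * $\bar\rho^0_{ij}=c_i\bar c_i(q_i+q_i^{-1})^2$ if $a_{ij}=-2$; * $\bar\rho^0_{ij}=c_i\bar c_i(q^4+2q^2+4+2q^{-2}+q^{-4})$ and $\bar\rho^1_{ij}=-c_i^2\bar c_i^2(q^2+1+q^{-2})^2$ if $a_{ij}=-3$; * $\bar\rho^0_{ij}=c_i\bar c_i(q+q^{-1})^2(q^4+3+q^{-4})$ and $\bar\rho^1_{ij}=-c_i^2\bar c_i^2(q+q^{-1})^4(q^2+q^{-2})^2$ if $a_{ij}=-4$. **Proposition.** 1. Some $\rho$ is admissible if and only if the constraints hold. 2. $\bar\rho$ is admissible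 if and only if the constraints hold. 3. If all $w_i\neq0$, then a given $\rho$ is admissible if and only if the constraints hold and $\rho=\bar\rho$. -/

import Mathlib

open Finset

/-- The affine Lie algebras under consideration, each with its rank `n` (its Dynkin diagram has
the nodes `0, 1, …, n`).  All untwisted and twisted affine types occur, except `a_1^{(1)}`. -/
inductive AffineType : Type
  /-- `a_n^{(1)}`, `n ≥ 2` -/
  | a1 (n : ℕ) (hn : 2 ≤ n)
  /-- `d_n^{(1)}`, `n ≥ 4` -/
  | d1 (n : ℕ) (hn : 4 ≤ n)
  /-- `e_6^{(1)}` -/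
  | e61
  /-- `e_7^{(1)}` -/
  | e71
  /-- `e_8^{(1)}` -/
  | e81
  /-- `b_n^{(1)}`, `n ≥ 3` -/
  | b1 (n : ℕ) (hn : 3 ≤ n)
  /-- `c_n^{(1)}`, `n ≥ 2` -/
  | c1 (n : ℕ) (hn : 2 ≤ n)
  /-- `a_{2n}^{(2)}`, `n ≥ 2` -/
  | a2even (n : ℕ) (hn : 2 ≤ n)
  /-- `a_{2n-1}^{(2)}`, `n ≥ 3` -/
  | a2odd (n : ℕ) (hn : 3 ≤ n)
  /-- `d_{n+1}^{(2)}`, `n ≥ 2` -/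
  | d2 (n : ℕ) (hn : 2 ≤ n)
  /-- `e_6^{(2)}` -/
  | e62
  /-- `f_4^{(1)}` -/
  | f41
  /-- `g_2^{(1)}` -/
  | g21
  /-- `d_4^{(3)}` -/
  | d43
  /-- `a_2^{(2)}` -/
  | a22

namespace AffineType

/-- The rank: the nodes are `0, …, X.rank`. -/
def rank : AffineType → ℕ
  | a1 n _ => n
  | d1 n _ => n
  | e61 => 6
  | e71 => 7
  | e81 => 8
  | b1 n _ => n
  | c1 n _ => n
  | a2even n _ => n
  | a2odd n _ => n
  | d2 n _ => n
  | e62 => 4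
  | f41 => 4
  | g21 => 2
  | d43 => 2
  | a22 => 1

/-- The set of nodes of the Dynkin diagram. -/
abbrev Node (X : AffineType) : Type := Fin (X.rank + 1)

/-- The edges of the Dynkin diagram (multiplicities disregarded), each listed in at least one of its
two orientations. -/
def edge : AffineType → ℕ → ℕ → Bool
  -- the cycle `0, 1, …, n`
  | a1 n _, i, j => decide (i + 1 = j ∨ (i = 0 ∧ j = n))
  -- the chain `1, …, n - 1`, with `0` attached to `2` and `n` attached to `n - 2`
  | d1 n _, i, j =>
      decide ((i = 0 ∧ j = 2) ∨ (1 ≤ i ∧ i + 1 = j ∧ j + 1 ≤ n) ∨ (i + 2 = n ∧ j = n))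
  | e61, i, j => decide ((i, j) ∈ [(1, 2), (2, 3), (3, 4), (4, 5), (3, 6), (6, 0)])
  | e71, i, j => decide ((i, j) ∈ [(0, 1), (1, 2), (2, 3), (3, 4), (4, 5), (5, 6), (3, 7)])
  | e81, i, j =>
      decide ((i, j) ∈ [(1, 2), (2, 3), (3, 4), (4, 5), (5, 6), (6, 7), (7, 0), (3, 8)])
  -- the chain `1, …, n`, with `0` attached to `2`
  | b1 _ _, i, j => decide ((i = 0 ∧ j = 2) ∨ (1 ≤ i ∧ i + 1 = j))
  | a2odd _ _, i, j => decide ((i = 0 ∧ j = 2) ∨ (1 ≤ i ∧ i + 1 = j))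
  -- the remaining diagrams are the chain `0, 1, …, n`
  | _, i, j => decide (i + 1 = j)

/-- The coprime positive integers `d_i` with `d_i a_{ij} = d_j a_{ji}` (proportional to the squared
lengths of the simple roots). -/
def dNat : AffineType → ℕ → ℕ
  | b1 n _, i => if i = n then 1 else 2
  | c1 n _, i => if i = 0 ∨ i = n then 2 else 1
  | a2even n _, i => if i = 0 then 1 else if i = n then 4 else 2
  | a2odd n _, i => if i = n then 2 else 1
  | d2 n _, i => if i = 0 ∨ i = n then 1 else 2
  | e62, i => if 3 ≤ i then 2 else 1
  | f41, i => if 3 ≤ i then 1 else 2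
  | g21, i => if i = 2 then 1 else 3
  | d43, i => if i = 2 then 3 else 1
  | a22, i => if i = 0 then 4 else 1
  | _, _ => 1

/-- The integer `d_i` of a node. -/
def d (X : AffineType) (i : X.Node) : ℕ := X.dNat i

/-- The extended Cartan matrix: `a_{ii} = 2`; `a_{ij} = 0` if `i ≠ j` are not linked; if `i`, `j` are
linked, then `a_{ij} = -1` when `d_i ≥ d_j`, and `a_{ij} = -d_j / d_i` (an integer) when
`d_i ≤ d_j`. -/
def cartan (X : AffineType) (i j : X.Node) : ℤ :=
  if i = j then 2
  else if X.edge i j || X.edge j i then -((max (X.d i) (X.d j) / X.d i : ℕ) : ℤ)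
  else 0

/-- `-a_{ij}` as a natural number, for `i ≠ j`. -/
def mult (X : AffineType) (i j : X.Node) : ℕ := (-X.cartan i j).toNat

/-- `q_i = q ^ {d_i}`. -/
def qi (X : AffineType) (q : ℂ) (i : X.Node) : ℂ := q ^ X.d i

end AffineType

/-- `[a]_q = (q^a - q^{-a}) / (q - q^{-1})`. -/
noncomputable def qInt (q : ℂ) (a : ℕ) : ℂ := (q ^ a - q⁻¹ ^ a) / (q - q⁻¹)

/-- `[a]_q! = [a]_q [a-1]_q ⋯ [1]_q`. -/
noncomputable def qFact (q : ℂ) (a : ℕ) : ℂ := ∏ b ∈ range a, qInt q (b + 1)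

/-- The `q`-binomial coefficient (used for `b ≤ a` only). -/
noncomputable def qBinom (q : ℂ) (a b : ℕ) : ℂ := qFact q a / (qFact q b * qFact q (a - b))

/-- The `q`-Serre expression with `m = -a_{ij}`:
`∑_{r=0}^{1+m} (-1)^r [1+m choose r]_q x^{1+m-r} y x^r`. -/
noncomputable def qSerre {R : Type*} [Ring R] [Algebra ℂ R] (q : ℂ) (m : ℕ) (x y : R) : R :=
  ∑ r ∈ range (m + 2), ((-1) ^ r * qBinom q (m + 1) r) • (x ^ (m + 1 - r) * y * x ^ r)

/-- Generators of `U_q(ĝ)`: `e i`, `f i`, `k i = q_i^{h_i/2}` and `kinv i = q_i^{-h_i/2}`. -/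
inductive UGen (ι : Type) : Type
  | e (i : ι)
  | f (i : ι)
  | k (i : ι)
  | kinv (i : ι)

namespace Uq

variable (X : AffineType)

/-- The generators as elements of the free algebra. -/
abbrev gen (g : UGen X.Node) : FreeAlgebra ℂ (UGen X.Node) := FreeAlgebra.ι ℂ g

/-- The defining relations of `U_q(ĝ)`; `s` is the chosen square root of `q`, so that
`q_i^{a_{ij}/2} = s ^ {d_i a_{ij}}`.  The commutation of `e_i`, `e_j` (and of `f_i`, `f_j`) for
nodes which are not linked is the case `a_{ij} = 0` of the Serre relations. -/
inductive Rel (q s : ℂ) :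
    FreeAlgebra ℂ (UGen X.Node) → FreeAlgebra ℂ (UGen X.Node) → Prop
  | k_kinv (i : X.Node) : Rel q s (gen X (.k i) * gen X (.kinv i)) 1
  | kinv_k (i : X.Node) : Rel q s (gen X (.kinv i) * gen X (.k i)) 1
  | k_comm (i j : X.Node) :
      Rel q s (gen X (.k i) * gen X (.k j)) (gen X (.k j) * gen X (.k i))
  | k_e (i j : X.Node) :
      Rel q s (gen X (.k i) * gen X (.e j) * gen X (.kinv i))
        (s ^ ((X.d i : ℤ) * X.cartan i j) • gen X (.e j))
  | k_f (i j : X.Node) :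
      Rel q s (gen X (.k i) * gen X (.f j) * gen X (.kinv i))
        (s ^ (-((X.d i : ℤ) * X.cartan i j)) • gen X (.f j))
  | e_f_same (i : X.Node) :
      Rel q s (gen X (.e i) * gen X (.f i) - gen X (.f i) * gen X (.e i))
        ((X.qi q i - (X.qi q i)⁻¹)⁻¹ • (gen X (.k i) ^ 2 - gen X (.kinv i) ^ 2))
  | e_f_ne (i j : X.Node) (hij : i ≠ j) :
      Rel q s (gen X (.e i) * gen X (.f j) - gen X (.f j) * gen X (.e i)) 0
  | serre_e (i j : X.Node) (hij : i ≠ j) :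
      Rel q s (qSerre (X.qi q i) (X.mult i j) (gen X (.e i)) (gen X (.e j))) 0
  | serre_f (i j : X.Node) (hij : i ≠ j) :
      Rel q s (qSerre (X.qi q i) (X.mult i j) (gen X (.f i)) (gen X (.f j))) 0

end Uq

/-- The quantum affine algebra `U_q(ĝ)`. -/
abbrev Uq (X : AffineType) (q s : ℂ) : Type := RingQuot (Uq.Rel X q s)

namespace Uq

variable (X : AffineType) (q s : ℂ)

/-- The canonical map from the free algebra. -/
noncomputable abbrev proj : FreeAlgebra ℂ (UGen X.Node) →ₐ[ℂ] Uq X q s :=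
  RingQuot.mkAlgHom ℂ (Rel X q s)

/-- `e_i` in `U_q(ĝ)`. -/
noncomputable def e (i : X.Node) : Uq X q s := proj X q s (gen X (.e i))

/-- `f_i` in `U_q(ĝ)`. -/
noncomputable def f (i : X.Node) : Uq X q s := proj X q s (gen X (.f i))

/-- `q_i^{h_i/2}` in `U_q(ĝ)`. -/
noncomputable def k (i : X.Node) : Uq X q s := proj X q s (gen X (.k i))

/-- `c_i e_i q_i^{h_i/2} + c̄_i f_i q_i^{h_i/2} + w_i q_i^{h_i}`. -/
noncomputable def realization (c c' w : X.Node → ℂ) (i : X.Node) : Uq X q s :=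
  c i • (e X q s i * k X q s i) + c' i • (f X q s i * k X q s i) + w i • k X q s i ^ 2

end Uq

/-- The constants `γ^{kl}_{ij}`, as a function of `m = -a_{ij}`, `k` and `l`. -/
noncomputable def onsagerGamma (q : ℂ) : ℕ → ℕ → ℕ → ℂ
  | 3, 0, 1 => (q + q⁻¹) * (q ^ 2 + q⁻¹ ^ 2) * (q ^ 2 + 3 + q⁻¹ ^ 2) /
      (q ^ 4 + 2 * q ^ 2 + 4 + 2 * q⁻¹ ^ 2 + q⁻¹ ^ 4)
  | 4, 0, 1 => qInt q 3 * qInt q 5 / (q ^ 4 + q⁻¹ ^ 4 + 3)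
  | 4, 0, 2 => qInt q 3 * qInt q 5 / (q ^ 4 + q⁻¹ ^ 4 + 3)
  | _, _, _ => 1

namespace Oq

variable (X : AffineType)

/-- The index `k` of `ρ^k_{ij}` runs over `0 ≤ k < ⌈m / 2⌉`, where `m = -a_{ij}`. -/
def numRho (i j : X.Node) : ℕ := (X.mult i j + 1) / 2

/-- The defining relations of the generalized `q`-Onsager algebra with structure constants
`ρ i j k = ρ^k_{ij}`. With `m = -a_{ij}`, for all `i ≠ j`:
`∑_{r=0}^{1+m} (-1)^r [1+m choose r]_{q_i} A_i^{1+m-r} A_j A_i^r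
  = ∑_{k=0}^{⌈m/2⌉-1} ρ^k_{ij} ∑_{l=0}^{m-1-2k} (-1)^l γ^{kl}_{ij} A_i^{m-1-2k-l} A_j A_i^l`. -/
inductive Rel (q : ℂ) (ρ : X.Node → X.Node → ℕ → ℂ) :
    FreeAlgebra ℂ X.Node → FreeAlgebra ℂ X.Node → Prop
  | onsager (i j : X.Node) (hij : i ≠ j) :
      Rel q ρ
        (qSerre (X.qi q i) (X.mult i j) (FreeAlgebra.ι ℂ i) (FreeAlgebra.ι ℂ j))
        (∑ k ∈ range (numRho X i j), ρ i j k •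
          ∑ l ∈ range (X.mult i j - 2 * k),
            ((-1) ^ l * onsagerGamma q (X.mult i j) k l) •
              (FreeAlgebra.ι ℂ i ^ (X.mult i j - 2 * k - 1 - l) * FreeAlgebra.ι ℂ j *
                FreeAlgebra.ι ℂ i ^ l))

end Oq

/-- The generalized `q`-Onsager algebra `O_q(ĝ)` with structure constants `ρ`. -/
abbrev Oq (X : AffineType) (q : ℂ) (ρ : X.Node → X.Node → ℕ → ℂ) : Type :=
  RingQuot (Oq.Rel X q ρ)

/-- The generator `A_i` of `O_q(ĝ)`. -/
noncomputable def Oq.A (X : AffineType) (q : ℂ) (ρ : X.Node → X.Node → ℕ → ℂ) (i : X.Node) :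
    Oq X q ρ :=
  RingQuot.mkAlgHom ℂ (Oq.Rel X q ρ) (FreeAlgebra.ι ℂ i)

/-- There is an algebra homomorphism `O_q(ĝ) → U_q(ĝ)`, where `O_q(ĝ)` has the structure constants
`ρ`, with `A_i ↦ c_i e_i q_i^{h_i/2} + c̄_i f_i q_i^{h_i/2} + w_i q_i^{h_i}` for all `i`. -/
def Realizable (X : AffineType) (q s : ℂ) (c c' w : X.Node → ℂ)
    (ρ : X.Node → X.Node → ℕ → ℂ) : Prop :=
  ∃ φ : Oq X q ρ →ₐ[ℂ] Uq X q s, ∀ i, φ (Oq.A X q ρ i) = Uq.realization X q s c c' w i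

/-- `w^2 + c c̄ / (q_i + q_i^{-1} - 2)` at the node `i`. -/
noncomputable def baseFactor (X : AffineType) (q : ℂ) (c c' w : X.Node → ℂ) (i : X.Node) : ℂ :=
  w i ^ 2 + c i * c' i / (X.qi q i + (X.qi q i)⁻¹ - 2)

/-- `w^2 + c c̄ (q_i + q_i^{-1} - 1)^2 / (q_i + q_i^{-1} - 2)` at the node `i`. -/
noncomputable def tripleFactor (X : AffineType) (q : ℂ) (c c' w : X.Node → ℂ) (i : X.Node) : ℂ :=
  w i ^ 2 + c i * c' i * (X.qi q i + (X.qi q i)⁻¹ - 1) ^ 2 / (X.qi q i + (X.qi q i)⁻¹ - 2)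

/-- The constraints on the parameters `w_i`, link by link. In the second, third and fourth clause `i`
is the longer root of the pair. -/
def Constraints (X : AffineType) (q : ℂ) (c c' w : X.Node → ℂ) : Prop :=
  ∀ i j : X.Node,
    (X.cartan i j = -1 ∧ X.cartan j i = -1 →
      w i * baseFactor X q c c' w j = 0 ∧ w j * baseFactor X q c c' w i = 0) ∧
    (X.cartan i j = -1 ∧ X.cartan j i = -2 → w j * baseFactor X q c c' w i = 0) ∧
    (X.cartan i j = -1 ∧ X.cartan j i = -3 →
      w j * baseFactor X q c c' w i = 0 ∧
        w i * baseFactor X q c c' w j * tripleFactor X q c c' w j = 0) ∧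
    (X.cartan i j = -1 ∧ X.cartan j i = -4 → w j * baseFactor X q c c' w i = 0)

/-- The values of the structure constants `ρ^k_{ij}`, as determined by `m = -a_{ij}` and `k`. -/
noncomputable def rhoValue (X : AffineType) (q : ℂ) (c c' : X.Node → ℂ) (i j : X.Node) (k : ℕ) : ℂ :=
  match X.mult i j, k with
  | 1, 0 => c i * c' i
  | 2, 0 => c i * c' i * (X.qi q i + (X.qi q i)⁻¹) ^ 2
  | 3, 0 => c i * c' i * (q ^ 4 + 2 * q ^ 2 + 4 + 2 * q⁻¹ ^ 2 + q⁻¹ ^ 4)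
  | 3, 1 => -((c i * c' i) ^ 2 * (q ^ 2 + 1 + q⁻¹ ^ 2) ^ 2)
  | 4, 0 => c i * c' i * (q + q⁻¹) ^ 2 * (q ^ 4 + 3 + q⁻¹ ^ 4)
  | 4, 1 => -((c i * c' i) ^ 2 * (q + q⁻¹) ^ 4 * (q ^ 2 + q⁻¹ ^ 2) ^ 2)
  | _, _ => 0

/-! For fixed `i ≠ j` the defining relation is linear in `A_j`; `onsagerDefect` is the difference of
its sides. Write `m = -a_{ij}`, `p = q_i`, `A_i = E + F + wK` with `K = k_i²`. It is enough to
evaluate the defect on the three constituents `e_j k_j`, `f_j k_j`, `k_j²` of `A_j`.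

With the constants `ρ̄`, the relation factors in terms of left and right multiplication by `x =
A_i`: it is a product of operators `quadDefect`, of the form `L² - (p^r + p^{-r}) L R + R² - const`
with `r = m, m-2, …` positive, times `L - R` when `m` is even. This product annihilates `e_j k_j`:
the iterated `q`-commutators `y_s` of `E` with `e_j k_j` (`adjChain`) stop at `y_{m+1} = 0` by the
Serre relation, and `A_i` acts on the `y_s` by a tridiagonal rule (`QTriple.mul_adjChain`).
Exchanging `E` and `F`, with `p` inverted, handles `f_j k_j`. On `k_j²` a direct computation
(`QTriple.onsagerDefect_group`) gives zero for even `m`, a multiple of `P_i` for `m = 1` and of `P_i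
T_i` for `m = 3`. Since `k_j²` carries the coefficient `w_j`, the constraints suffice
(`realizable_of_constraints`).

Conversely, rescaling `e_j` and `f_j` inversely splits a relation by its degree in `α_j`
(`Uq.onsagerDefect_split`), so the `f_j` and `k_j²` contributions vanish separately. Replacing `ρ`
by `ρ̄` changes the defect by an explicit term of lower degree in `A_i`. To see that the remaining
expressions are nonzero in `U_q`, Verma modules are built from words in the `f_i` modulo the Serre
elements. The coefficient of a power of one `f_a` descends to this quotient (`Verma.coef_serreSub`),
which yields enough matrix coefficients without a basis theorem. Varying the highest weight gives
the constraints; if no `w_i` vanishes, these and leading coefficients also give `ρ = ρ̄`. -/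

section QuantumPlane

/-! ### Rank one relations and the adjoint action of `E`. -/

variable {R : Type*} [Ring R] [Algebra ℂ R]

/-- `x² y - τ x y x + y x² - ρ y`. -/
def quadDefect (τ ρ : ℂ) (x y : R) : R :=
  x * (x * y) - τ • (x * (y * x)) + y * (x * x) - ρ • y

/-- The relations of the elements `E = c e k`, `F = c' f k`, `K = k²` of `U_p(sl₂)`,
with `κ = c c'`. -/
structure QTriple (p κ : ℂ) (E F K : R) : Prop where
  ne : p ≠ 0
  sq : p ^ 2 ≠ 1
  KE : K * E = p ^ 2 • (E * K)
  KF : K * F = (p⁻¹) ^ 2 • (F * K)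
  FE : F * E = p ^ 2 • (E * F) - (κ * p / (p - p⁻¹)) • (K * K - 1)

theorem sub_inv_ne {p : ℂ} (h0 : p ≠ 0) (h1 : p ^ 2 ≠ 1) : p - p⁻¹ ≠ 0 := by
  intro h
  apply h1
  field_simp at h
  linear_combination h

/-- Reordering the relation between `E` and `F` only inverts `p`. Hence each result on strings
generated by `E` also gives one for `F`. -/
theorem QTriple.swap {p κ : ℂ} {E F K : R} (h : QTriple p κ E F K) : QTriple p⁻¹ κ F E K := by
  have h0 := h.ne
  have h1 := sub_inv_ne h.ne h.sq
  have h2 : p ^ 2 - 1 ≠ 0 := sub_ne_zero.mpr h.sq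
  refine ⟨inv_ne_zero h0, ?_, h.KF, by simpa using h.KE, ?_⟩
  · rw [inv_pow]; simpa using h.sq
  · rw [h.FE]
    have h3 : p⁻¹ - p ≠ 0 := by rw [← neg_sub]; exact neg_ne_zero.mpr h1
    rw [inv_inv]
    match_scalars
    · field_simp
    · have h4 : 1 - p ^ 2 ≠ 0 := by rw [← neg_sub]; exact neg_ne_zero.mpr h2
      field_simp
      ring
    · have h4 : 1 - p ^ 2 ≠ 0 := by rw [← neg_sub]; exact neg_ne_zero.mpr h2
      field_simp
      ring

/-- One step of the adjoint action of `E` on a weight vector `y`, where `z` is the preceding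
vector and `lam`, `bet` describe the action of `K` and `F`. -/
theorem QTriple.adjoint_step {p κ : ℂ} {E F K y z : R} (h : QTriple p κ E F K) {lam bet : ℂ}
    (hK : K * y = lam • (y * K)) (hF : F * y = lam • (y * F) + bet • z)
    (hz : bet • (E * z) = bet • ((lam * (p⁻¹) ^ 2) • (z * E) + y)) :
    K * (E * y - lam • (y * E)) = (lam * p ^ 2) • ((E * y - lam • (y * E)) * K) ∧
    F * (E * y - lam • (y * E)) = (lam * p ^ 2) • ((E * y - lam • (y * E)) * F) +
      (p ^ 2 * bet + κ * p / (p - p⁻¹) * (1 - lam ^ 2)) • y := by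
  have h0 := h.ne
  have hKa : ∀ u, K * (E * u) = p ^ 2 • (E * (K * u)) := fun u => by
    rw [← mul_assoc, h.KE, smul_mul_assoc, mul_assoc]
  have hKy : ∀ u, K * (y * u) = lam • (y * (K * u)) := fun u => by
    rw [← mul_assoc, hK, smul_mul_assoc, mul_assoc]
  have hFa : ∀ u, F * (E * u) = p ^ 2 • (E * (F * u)) -
      (κ * p / (p - p⁻¹)) • (K * (K * u) - u) := fun u => by
    rw [← mul_assoc, h.FE, sub_mul, smul_mul_assoc, smul_mul_assoc, sub_mul, one_mul]
    simp only [mul_assoc]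
  have hFy : ∀ u, F * (y * u) = lam • (y * (F * u)) + bet • (z * u) := fun u => by
    rw [← mul_assoc, hF, add_mul, smul_mul_assoc, smul_mul_assoc, mul_assoc]
  constructor
  · simp only [mul_sub, sub_mul, mul_smul_comm, smul_mul_assoc, mul_assoc, hKa, hKy, hK, h.KE,
      smul_sub, smul_smul]
    match_scalars <;> ring
  · simp only [mul_sub, sub_mul, mul_add, mul_smul_comm, smul_mul_assoc, mul_assoc, hFa, hFy, hF,
      hKy, hK, h.FE, hz, smul_sub, smul_add, smul_smul, mul_one]
    match_scalars <;> field_simp <;> ring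

end QuantumPlane

/-! ### Strings generated from a weight vector, and their annihilating polynomials. -/

section QuantumPlane

variable {R : Type*} [Ring R] [Algebra ℂ R]

/-- `∏_{s=0}^{m} (L_E - p^{2s-m} R_E)` applied to `y`. -/
noncomputable def adjChain (p : ℂ) (m : ℕ) (E y : R) : ℕ → R
  | 0 => y
  | s + 1 => E * adjChain p m E y s -
      ((p⁻¹) ^ m * p ^ (2 * s)) • (adjChain p m E y s * E)

/-- The coefficients describing the action of `F` on `adjChain`. -/
noncomputable def adjCoeff (p κ : ℂ) (m : ℕ) : ℕ → ℂ
  | 0 => 0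
  | s + 1 => p ^ 2 * adjCoeff p κ m s +
      κ * p / (p - p⁻¹) * (1 - ((p⁻¹) ^ m * p ^ (2 * s)) ^ 2)

/-- Induction by `adjoint_step`. The placeholder `0` for the vector before the first one is
harmless, because its coefficient `adjCoeff p κ m 0` is zero. -/
theorem QTriple.adjChain_spec {p κ : ℂ} {E F K y : R} (h : QTriple p κ E F K) {m : ℕ}
    (hK : K * y = (p⁻¹) ^ m • (y * K)) (hF : F * y = (p⁻¹) ^ m • (y * F)) (s : ℕ) :
    K * adjChain p m E y s = ((p⁻¹) ^ m * p ^ (2 * s)) • (adjChain p m E y s * K) ∧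
    F * adjChain p m E y s = ((p⁻¹) ^ m * p ^ (2 * s)) • (adjChain p m E y s * F) +
      adjCoeff p κ m s • (if s = 0 then 0 else adjChain p m E y (s - 1)) := by
  have h0 := h.ne
  induction s with
  | zero => simp [adjChain, adjCoeff, hK, hF]
  | succ s ih =>
    obtain ⟨ih1, ih2⟩ := ih
    have hs : (p⁻¹) ^ m * p ^ (2 * (s + 1)) = (p⁻¹) ^ m * p ^ (2 * s) * p ^ 2 := by ring
    rw [hs, adjChain, adjCoeff, if_neg (Nat.succ_ne_zero s), Nat.add_sub_cancel]
    refine h.adjoint_step ih1 ih2 ?_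
    cases s with
    | zero => simp [adjCoeff]
    | succ s =>
      rw [if_neg (Nat.succ_ne_zero s), Nat.add_sub_cancel, adjChain]
      congr 1
      have : (p⁻¹) ^ m * p ^ (2 * (s + 1)) * (p⁻¹) ^ 2 = (p⁻¹) ^ m * p ^ (2 * s) := by
        field_simp
        ring
      rw [this]
      abel

/-- `E` raises the string by the definition of `adjChain`, `F` lowers it, and `K` preserves it. All
three share the twist `p^{2s-m}`, so `A = E + F + wK` can be moved to the right at the cost of the
two neighbouring vectors. -/
theorem QTriple.mul_adjChain {p κ : ℂ} {E F K y : R} (h : QTriple p κ E F K) {m : ℕ}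
    (hK : K * y = (p⁻¹) ^ m • (y * K)) (hF : F * y = (p⁻¹) ^ m • (y * F)) (w : ℂ) (s : ℕ) :
    (E + F + w • K) * adjChain p m E y (s + 1) =
      ((p⁻¹) ^ m * p ^ (2 * (s + 1))) • (adjChain p m E y (s + 1) * (E + F + w • K)) +
      adjChain p m E y (s + 2) + adjCoeff p κ m (s + 1) • adjChain p m E y s := by
  obtain ⟨h1, h2⟩ := h.adjChain_spec hK hF (s + 1)
  rw [add_mul, add_mul, smul_mul_assoc, h1, h2]
  rw [adjChain.eq_2 p m E y (s + 1)]
  simp only [mul_add, mul_smul_comm]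
  simp
  module

theorem mul_adjChain_zero (p : ℂ) {E F K y : R} {m : ℕ}
    (hK : K * y = (p⁻¹) ^ m • (y * K)) (hF : F * y = (p⁻¹) ^ m • (y * F)) (w : ℂ) :
    (E + F + w • K) * adjChain p m E y 0 =
      (p⁻¹) ^ m • (adjChain p m E y 0 * (E + F + w • K)) + adjChain p m E y 1 := by
  simp only [adjChain]
  rw [add_mul, add_mul, smul_mul_assoc, hK, hF]
  simp only [mul_add, mul_smul_comm, mul_zero, pow_zero, mul_one]
  module

theorem mul_assoc_of_eq {A y y' y'' : R} {a b : ℂ} (h : A * y = a • (y * A) + y' + b • y'') (u : R) :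
    A * (y * u) = a • (y * (A * u)) + y' * u + b • (y'' * u) := by
  rw [← mul_assoc, h, add_mul, add_mul, smul_mul_assoc, smul_mul_assoc, mul_assoc]

theorem mul_assoc_of_eq' {A y y' : R} {a : ℂ} (h : A * y = a • (y * A) + y') (u : R) :
    A * (y * u) = a • (y * (A * u)) + y' * u := by
  rw [← mul_assoc, h, add_mul, smul_mul_assoc, mul_assoc]

section Weight

variable {p κ : ℂ} {E F K y : R}

/-- This and the next three lemmas share one mechanism. Once the string stops, the tridiagonal rule
rewrites every word in `A` and `y` as a combination of the products `y_s A^r`. The constants in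
`quadDefect` make all coefficients cancel, whatever `w` is. -/
theorem QTriple.weight_one (h : QTriple p κ E F K) (hK : K * y = (p⁻¹) ^ 1 • (y * K))
    (hF : F * y = (p⁻¹) ^ 1 • (y * F)) (hS : adjChain p 1 E y 2 = 0) (w : ℂ) :
    quadDefect (p + p⁻¹) κ (E + F + w • K) y = 0 := by
  have h0 := h.ne
  have h1 : p ^ 2 - 1 ≠ 0 := sub_ne_zero.mpr h.sq
  have e0 := mul_adjChain_zero p (E := E) hK hF w
  have e1 := h.mul_adjChain hK hF w 0
  change quadDefect _ _ _ (adjChain p 1 E y 0) = 0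
  rw [hS] at e1
  set A := E + F + w • K
  have f0 := mul_assoc_of_eq' e0
  simp only [quadDefect, e0, e1, f0, mul_add, add_mul, mul_smul_comm, smul_add, smul_smul, adjCoeff]
  match_scalars <;> field_simp <;> ring

theorem QTriple.weight_two (h : QTriple p κ E F K) (hK : K * y = (p⁻¹) ^ 2 • (y * K))
    (hF : F * y = (p⁻¹) ^ 2 • (y * F)) (hS : adjChain p 2 E y 3 = 0) (w : ℂ) :
    let A := E + F + w • K
    let z := quadDefect (p ^ 2 + (p⁻¹) ^ 2) (κ * (p + p⁻¹) ^ 2) A y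
    A * z - z * A = 0 := by
  have h0 := h.ne
  have h1 : p ^ 2 - 1 ≠ 0 := sub_ne_zero.mpr h.sq
  have e0 := mul_adjChain_zero p (E := E) hK hF w
  have e1 := h.mul_adjChain hK hF w 0
  have e2 := h.mul_adjChain hK hF w 1
  change ((E + F + w • K) * quadDefect _ _ _ (adjChain p 2 E y 0)) -
    quadDefect _ _ _ (adjChain p 2 E y 0) * (E + F + w • K) = 0
  rw [hS] at e2
  set A := E + F + w • K
  have f0 := mul_assoc_of_eq' e0
  have f1 := mul_assoc_of_eq e1
  simp only [quadDefect, e0, e1, e2, f0, f1, mul_add, add_mul, mul_sub, sub_mul, mul_smul_comm,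
    smul_mul_assoc, mul_assoc, smul_add, smul_smul, adjCoeff]
  match_scalars <;> field_simp <;> ring

theorem QTriple.weight_three (h : QTriple p κ E F K) (hK : K * y = (p⁻¹) ^ 3 • (y * K))
    (hF : F * y = (p⁻¹) ^ 3 • (y * F)) (hS : adjChain p 3 E y 4 = 0) (w : ℂ) :
    let A := E + F + w • K
    quadDefect (p + p⁻¹) κ A
      (quadDefect (p ^ 3 + (p⁻¹) ^ 3) (κ * (p ^ 2 + 1 + (p⁻¹) ^ 2) ^ 2) A y) = 0 := by
  have h0 := h.ne
  have h1 : p ^ 2 - 1 ≠ 0 := sub_ne_zero.mpr h.sq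
  have e0 := mul_adjChain_zero p (E := E) hK hF w
  have e1 := h.mul_adjChain hK hF w 0
  have e2 := h.mul_adjChain hK hF w 1
  have e3 := h.mul_adjChain hK hF w 2
  change quadDefect _ _ (E + F + w • K) (quadDefect _ _ _ (adjChain p 3 E y 0)) = 0
  rw [hS] at e3
  set A := E + F + w • K
  have f0 := mul_assoc_of_eq' e0
  have f1 := mul_assoc_of_eq e1
  have f2 := mul_assoc_of_eq e2
  simp only [quadDefect, e0, e1, e2, e3, f0, f1, f2, mul_add, add_mul, mul_sub, sub_mul,
    mul_smul_comm, smul_mul_assoc, mul_assoc, smul_add, smul_sub, smul_smul, adjCoeff]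
  match_scalars <;> field_simp <;> ring

set_option maxHeartbeats 1000000 in
theorem QTriple.weight_four (h : QTriple p κ E F K) (hK : K * y = (p⁻¹) ^ 4 • (y * K))
    (hF : F * y = (p⁻¹) ^ 4 • (y * F)) (hS : adjChain p 4 E y 5 = 0) (w : ℂ) :
    let A := E + F + w • K
    let z := quadDefect (p ^ 2 + (p⁻¹) ^ 2) (κ * (p + p⁻¹) ^ 2) A
      (quadDefect (p ^ 4 + (p⁻¹) ^ 4) (κ * ((p + p⁻¹) * (p ^ 2 + (p⁻¹) ^ 2)) ^ 2) A y)
    A * z - z * A = 0 := by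
  have h0 := h.ne
  have h1 : p ^ 2 - 1 ≠ 0 := sub_ne_zero.mpr h.sq
  have e0 := mul_adjChain_zero p (E := E) hK hF w
  have e1 := h.mul_adjChain hK hF w 0
  have e2 := h.mul_adjChain hK hF w 1
  have e3 := h.mul_adjChain hK hF w 2
  have e4 := h.mul_adjChain hK hF w 3
  change (E + F + w • K) * quadDefect _ _ _ (quadDefect _ _ _ (adjChain p 4 E y 0)) -
    quadDefect _ _ _ (quadDefect _ _ _ (adjChain p 4 E y 0)) * (E + F + w • K) = 0
  rw [hS] at e4
  set A := E + F + w • K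
  have f0 := mul_assoc_of_eq' e0
  have f1 := mul_assoc_of_eq e1
  have f2 := mul_assoc_of_eq e2
  have f3 := mul_assoc_of_eq e3
  simp only [quadDefect, e0, e1, e2, e3, e4, f0, f1, f2, f3, mul_add, add_mul, mul_sub, sub_mul,
    mul_smul_comm, smul_mul_assoc, mul_assoc, smul_add, smul_sub, smul_smul, adjCoeff]
  match_scalars <;> field_simp <;> ring

end Weight

end QuantumPlane

/-! ### The defect on a group-like element `G`, later `k_j²`. -/

section QuantumPlane

variable {R : Type*} [Ring R] [Algebra ℂ R] {p κ : ℂ} {E F K G : R}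

theorem QTriple.KE_assoc (h : QTriple p κ E F K) (u : R) : K * (E * u) = p ^ 2 • (E * (K * u)) := by
  rw [← mul_assoc, h.KE, smul_mul_assoc, mul_assoc]

theorem QTriple.KF_assoc (h : QTriple p κ E F K) (u : R) :
    K * (F * u) = (p⁻¹) ^ 2 • (F * (K * u)) := by
  rw [← mul_assoc, h.KF, smul_mul_assoc, mul_assoc]

theorem QTriple.FE_assoc (h : QTriple p κ E F K) (u : R) :
    F * (E * u) = p ^ 2 • (E * (F * u)) - (κ * p / (p - p⁻¹)) • (K * (K * u) - u) := by
  rw [← mul_assoc, h.FE, sub_mul, smul_mul_assoc, smul_mul_assoc, sub_mul, one_mul]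
  simp only [mul_assoc]

theorem smul_assoc_of_eq {x y : R} {a : ℂ} (h : x * y = a • (y * x)) (u : R) :
    x * (y * u) = a • (y * (x * u)) := by
  rw [← mul_assoc, h, smul_mul_assoc, mul_assoc]

theorem comm_assoc_of_eq {x y : R} (h : x * y = y * x) (u : R) :
    x * (y * u) = y * (x * u) := by
  rw [← mul_assoc, h, mul_assoc]

/-- The choice `μ + μ⁻¹` of the middle coefficient removes the terms `G E²` and `G F²`, as `μ` and
`μ⁻¹` are the roots of `x² - (μ + μ⁻¹)x + 1`. For `μ = p^m` this evaluates the factor of the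
relation with `r = m`. -/
theorem QTriple.quadDefect_group {μ : ℂ} (hμ : μ ≠ 0) (h : QTriple p κ E F K)
    (hE : E * G = μ • (G * E)) (hF : F * G = μ⁻¹ • (G * F)) (hK : K * G = G * K) (w ρ : ℂ) :
    quadDefect (μ + μ⁻¹) ρ (E + F + w • K) G =
      (w * (μ - 1) * (p ^ 2 - μ ^ 2) / μ) • (G * (E * K)) +
      (w * (μ⁻¹ - 1) * ((p⁻¹) ^ 2 - (μ⁻¹) ^ 2) * μ) • (G * (F * K)) +
      ((1 - μ ^ 2) * (1 - p ^ 2 / μ ^ 2)) • (G * (E * F)) -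
      (w ^ 2 * (μ + μ⁻¹ - 2) + κ * p / (p - p⁻¹) * (1 - (μ⁻¹) ^ 2)) • (G * (K * K)) +
      (κ * p / (p - p⁻¹) * (1 - (μ⁻¹) ^ 2) - ρ) • G := by
  have h0 := h.ne
  have h1 : p ^ 2 - 1 ≠ 0 := sub_ne_zero.mpr h.sq
  simp only [quadDefect, mul_add, add_mul, mul_sub, sub_mul, mul_smul_comm, smul_mul_assoc,
    mul_assoc, smul_add, smul_sub, smul_smul, hE, hF, hK, smul_assoc_of_eq hE, smul_assoc_of_eq hF,
    comm_assoc_of_eq hK, h.KE, h.KF, h.FE, h.KE_assoc, h.KF_assoc, h.FE_assoc, mul_one]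
  match_scalars <;> field_simp <;> ring

/-- At `μ = p` the factors `p² - μ²` and `1 - p²/μ²` in `quadDefect_group` vanish and the constant
`κ` removes the multiple of `G`, so only `G K²` survives. This is the source of the factor `P_i`. -/
theorem QTriple.group_one (h : QTriple p κ E F K) (hE : E * G = p ^ 1 • (G * E))
    (hF : F * G = (p⁻¹) ^ 1 • (G * F)) (hK : K * G = G * K) (w : ℂ) :
    quadDefect (p + p⁻¹) κ (E + F + w • K) G =
      -((p + p⁻¹ - 2) * w ^ 2 + κ) • (G * (K * K)) := by
  have h0 := h.ne
  have h1 : p ^ 2 - 1 ≠ 0 := sub_ne_zero.mpr h.sq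
  simp only [quadDefect, mul_add, add_mul, mul_sub, sub_mul, mul_smul_comm, smul_mul_assoc,
    mul_assoc, smul_add, smul_sub, smul_smul, hE, hF, hK, smul_assoc_of_eq hE, smul_assoc_of_eq hF,
    comm_assoc_of_eq hK, h.KE, h.KF, h.FE, h.KE_assoc, h.KF_assoc, h.FE_assoc, mul_one]
  match_scalars <;> field_simp <;> ring

theorem QTriple.group_two (h : QTriple p κ E F K) (hE : E * G = p ^ 2 • (G * E))
    (hF : F * G = (p⁻¹) ^ 2 • (G * F)) (hK : K * G = G * K) (w : ℂ) :
    let A := E + F + w • K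
    let z := quadDefect (p ^ 2 + (p⁻¹) ^ 2) (κ * (p + p⁻¹) ^ 2) A G
    A * z - z * A = 0 := by
  have h0 := h.ne
  have h1 : p ^ 2 - 1 ≠ 0 := sub_ne_zero.mpr h.sq
  intro A z
  have hz := h.quadDefect_group (pow_ne_zero 2 h0) hE (by rw [hF, inv_pow]) hK w (κ * (p + p⁻¹) ^ 2)
  rw [← inv_pow] at hz
  simp only [z]
  rw [hz]
  simp only [A]
  simp only [quadDefect, mul_add, add_mul, mul_sub, sub_mul, mul_smul_comm, smul_mul_assoc,
    mul_assoc, smul_add, smul_sub, smul_smul, hE, hF, hK, smul_assoc_of_eq hE, smul_assoc_of_eq hF,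
    comm_assoc_of_eq hK, h.KE, h.KF, h.FE, h.KE_assoc, h.KF_assoc, h.FE_assoc, mul_one]
  match_scalars <;> field_simp <;> ring

set_option maxHeartbeats 2000000 in
-- The second quadratic factor clears everything except `G K⁴`, whose coefficient splits into two
-- factors linear in `w²`. These become `P_i` and `T_i`.
theorem QTriple.group_three (h : QTriple p κ E F K) (hE : E * G = p ^ 3 • (G * E))
    (hF : F * G = (p⁻¹) ^ 3 • (G * F)) (hK : K * G = G * K) (w : ℂ) :
    let A := E + F + w • K
    quadDefect (p + p⁻¹) κ A
        (quadDefect (p ^ 3 + (p⁻¹) ^ 3) (κ * (p ^ 2 + 1 + (p⁻¹) ^ 2) ^ 2) A G) =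
      ((p + p⁻¹ + 1) ^ 2 * ((p + p⁻¹ - 2) * w ^ 2 + κ) *
        ((p + p⁻¹ - 2) * w ^ 2 + κ * (p + p⁻¹ - 1) ^ 2)) • (G * (K * (K * (K * K)))) := by
  have h0 := h.ne
  have h1 : p ^ 2 - 1 ≠ 0 := sub_ne_zero.mpr h.sq
  intro A
  have hz := h.quadDefect_group (pow_ne_zero 3 h0) hE (by rw [hF, inv_pow]) hK w
    (κ * (p ^ 2 + 1 + (p⁻¹) ^ 2) ^ 2)
  rw [← inv_pow] at hz
  rw [hz]
  simp only [A]
  simp only [quadDefect, mul_add, add_mul, mul_sub, sub_mul, mul_smul_comm, smul_mul_assoc,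
    mul_assoc, smul_add, smul_sub, smul_smul, hE, hF, hK, smul_assoc_of_eq hE, smul_assoc_of_eq hF,
    comm_assoc_of_eq hK, h.KE, h.KF, h.FE, h.KE_assoc, h.KF_assoc, h.FE_assoc, mul_one]
  match_scalars <;> field_simp <;> ring

end QuantumPlane

section QuantumPlane

variable {R : Type*} [Ring R] [Algebra ℂ R] {p κ : ℂ} {E F K G : R}

/-- Both operators are polynomials in left and right multiplication by `x`, which commute. The
factors of the relation may therefore be applied in any convenient order. -/
theorem quadDefect_comm (a b c d : ℂ) (x y : R) :
    quadDefect a b x (quadDefect c d x y) = quadDefect c d x (quadDefect a b x y) := by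
  simp only [quadDefect, mul_add, add_mul, mul_sub, sub_mul, mul_smul_comm, smul_mul_assoc,
    mul_assoc, smul_add, smul_sub, smul_smul]
  module

theorem quadDefect_commutator (a b : ℂ) (x y : R) :
    x * quadDefect a b x y - quadDefect a b x y * x = quadDefect a b x (x * y - y * x) := by
  simp only [quadDefect, mul_add, add_mul, mul_sub, sub_mul, mul_smul_comm, smul_mul_assoc,
    mul_assoc, smul_add, smul_sub, smul_smul]
  module

theorem quadDefect_smul (a b c : ℂ) (x y : R) :
    quadDefect a b x (c • y) = c • quadDefect a b x y := by
  simp only [quadDefect, mul_smul_comm, smul_mul_assoc]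
  module

set_option maxHeartbeats 4000000 in
-- `G * Z` is, up to a scalar, the result of the two cheaper factors, see `group_four_quad_two`;
-- this lemma applies the last factor to it.
theorem group_four_quad_four {t : ℂ} (h0 : p ≠ 0) (KE : K * E = p ^ 2 • (E * K))
    (KF : K * F = (p⁻¹) ^ 2 • (F * K))
    (FE : F * E = p ^ 2 • (E * F) - (t * (1 - p ^ 2)) • (K * K - 1))
    (hE : E * G = p ^ 4 • (G * E))
    (hF : F * G = (p⁻¹) ^ 4 • (G * F)) (hK : K * G = G * K) (w : ℂ) :
    let A := E + F + w • K
    let Z := E * (E * E) + w • (E * (E * K)) - (p⁻¹) ^ 2 • (E * (E * F)) +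
      (p⁻¹) ^ 6 • (E * (F * F)) - (p⁻¹) ^ 12 • (F * (F * F)) - (w * (p⁻¹) ^ 12) • (F * (F * K)) +
      (t * ((p⁻¹) ^ 2 + (p⁻¹) ^ 4)) • (E * (K * K)) - (t * ((p⁻¹) ^ 4 + (p⁻¹) ^ 6)) • E -
      (t * ((p⁻¹) ^ 10 + (p⁻¹) ^ 12)) • (F * (K * K)) + (t * ((p⁻¹) ^ 8 + (p⁻¹) ^ 10)) • F
    quadDefect (p ^ 4 + (p⁻¹) ^ 4)
      (t * (2 - p ^ 2 - (p⁻¹) ^ 2) * ((p + p⁻¹) * (p ^ 2 + (p⁻¹) ^ 2)) ^ 2) A (G * Z) = 0 := by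
  intro A Z
  have KEa := smul_assoc_of_eq KE
  have KFa := smul_assoc_of_eq KF
  have FEa : ∀ u, F * (E * u) = p ^ 2 • (E * (F * u)) -
      (t * (1 - p ^ 2)) • (K * (K * u) - u) := fun u => by
    rw [← mul_assoc, FE, sub_mul, smul_mul_assoc, smul_mul_assoc, sub_mul, one_mul]
    simp only [mul_assoc]
  simp only [A, Z]
  simp only [quadDefect, mul_add, add_mul, mul_sub, sub_mul, mul_smul_comm, smul_mul_assoc,
    mul_assoc, smul_add, smul_sub, smul_smul, hE, hF, hK, smul_assoc_of_eq hE, smul_assoc_of_eq hF,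
    comm_assoc_of_eq hK, KE, KF, FE, KEa, KFa, FEa, mul_one]
  match_scalars <;> field_simp <;> ring

set_option maxHeartbeats 1000000 in
theorem group_four_quad_two {t : ℂ} (h0 : p ≠ 0) (KE : K * E = p ^ 2 • (E * K))
    (KF : K * F = (p⁻¹) ^ 2 • (F * K))
    (FE : F * E = p ^ 2 • (E * F) - (t * (1 - p ^ 2)) • (K * K - 1))
    (hE : E * G = p ^ 4 • (G * E))
    (hF : F * G = (p⁻¹) ^ 4 • (G * F)) (hK : K * G = G * K) (w : ℂ) :
    let A := E + F + w • K
    let Z := E * (E * E) + w • (E * (E * K)) - (p⁻¹) ^ 2 • (E * (E * F)) +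
      (p⁻¹) ^ 6 • (E * (F * F)) - (p⁻¹) ^ 12 • (F * (F * F)) - (w * (p⁻¹) ^ 12) • (F * (F * K)) +
      (t * ((p⁻¹) ^ 2 + (p⁻¹) ^ 4)) • (E * (K * K)) - (t * ((p⁻¹) ^ 4 + (p⁻¹) ^ 6)) • E -
      (t * ((p⁻¹) ^ 10 + (p⁻¹) ^ 12)) • (F * (K * K)) + (t * ((p⁻¹) ^ 8 + (p⁻¹) ^ 10)) • F
    quadDefect (p ^ 2 + (p⁻¹) ^ 2) (t * (2 - p ^ 2 - (p⁻¹) ^ 2) * (p + p⁻¹) ^ 2) A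
      (A * G - G * A) = (-((1 - p ^ 2) * (1 - p ^ 4) * (1 - p ^ 6))) • (G * Z) := by
  intro A Z
  have KEa := smul_assoc_of_eq KE
  have KFa := smul_assoc_of_eq KF
  have FEa : ∀ u, F * (E * u) = p ^ 2 • (E * (F * u)) -
      (t * (1 - p ^ 2)) • (K * (K * u) - u) := fun u => by
    rw [← mul_assoc, FE, sub_mul, smul_mul_assoc, smul_mul_assoc, sub_mul, one_mul]
    simp only [mul_assoc]
  have hAG : A * G - G * A = (p ^ 4 - 1) • (G * E) + ((p⁻¹) ^ 4 - 1) • (G * F) := by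
    simp only [A, mul_add, add_mul, mul_smul_comm, smul_mul_assoc, hE, hF, hK]
    module
  rw [hAG]
  simp only [A, Z]
  simp only [quadDefect, mul_add, add_mul, mul_sub, sub_mul, mul_smul_comm, smul_mul_assoc,
    mul_assoc, smul_add, smul_sub, smul_smul, hE, hF, hK, smul_assoc_of_eq hE, smul_assoc_of_eq hF,
    comm_assoc_of_eq hK, KE, KF, FE, KEa, KFa, FEa, mul_one]
  match_scalars <;> field_simp <;> ring

theorem QTriple.group_four (h : QTriple p κ E F K) (hE : E * G = p ^ 4 • (G * E))
    (hF : F * G = (p⁻¹) ^ 4 • (G * F)) (hK : K * G = G * K) (w : ℂ) :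
    let A := E + F + w • K
    let z := quadDefect (p ^ 2 + (p⁻¹) ^ 2) (κ * (p + p⁻¹) ^ 2) A
      (quadDefect (p ^ 4 + (p⁻¹) ^ 4) (κ * ((p + p⁻¹) * (p ^ 2 + (p⁻¹) ^ 2)) ^ 2) A G)
    A * z - z * A = 0 := by
  have h0 := h.ne
  have h1 : p ^ 2 - 1 ≠ 0 := sub_ne_zero.mpr h.sq
  have h2 : 1 - p ^ 2 ≠ 0 := by rw [← neg_sub]; exact neg_ne_zero.mpr h1
  -- As `2 - p² - p⁻² = -(p - p⁻¹)²`, writing `κ` in terms of `t` turns the coefficient `κp/(p -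
  -- p⁻¹)` into `t(1 - p²)` and leaves only powers of `p` in denominators.
  obtain ⟨t, ht⟩ : ∃ t, t * (2 - p ^ 2 - (p⁻¹) ^ 2) = κ := by
    refine ⟨κ / (2 - p ^ 2 - (p⁻¹) ^ 2), div_mul_cancel₀ _ ?_⟩
    have : 2 - p ^ 2 - (p⁻¹) ^ 2 = -((p ^ 2 - 1) / p) ^ 2 := by field_simp; ring
    rw [this]
    exact neg_ne_zero.mpr (pow_ne_zero 2 (div_ne_zero h1 h0))
  have FE : F * E = p ^ 2 • (E * F) - (t * (1 - p ^ 2)) • (K * K - 1) := by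
    rw [h.FE, ← ht]
    congr 2
    field_simp
    ring
  intro A z
  simp only [z]
  -- The commutator is applied first: it kills the group-like part `wK` of `A` and leaves only
  -- multiples of `G E` and `G F`, which keeps the expansions short.
  rw [quadDefect_comm, quadDefect_commutator, quadDefect_commutator, ← ht, group_four_quad_two h0 h.KE h.KF FE hE hF hK w, quadDefect_smul,
    group_four_quad_four h0 h.KE h.KF FE hE hF hK w, smul_zero]

end QuantumPlane

/-! ### The defining relations for `m ≤ 4` written out, and their factorizations. -/

section Onsager

/-- The difference of the two sides of a defining relation of the generalized `q`-Onsager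
algebra. -/
noncomputable def onsagerDefect {R : Type*} [Ring R] [Algebra ℂ R] (q Q : ℂ) (m : ℕ) (ρ : ℕ → ℂ)
    (x y : R) : R :=
  qSerre Q m x y - ∑ k ∈ range ((m + 1) / 2), ρ k • ∑ l ∈ range (m - 2 * k),
    ((-1) ^ l * onsagerGamma q m k l) • (x ^ (m - 2 * k - 1 - l) * y * x ^ l)

theorem sq_sub_one_ne {q : ℂ} (hr : ∀ n : ℕ, 1 ≤ n → q ^ n ≠ 1) (n : ℕ) (hn : 1 ≤ n) :
    q ^ n - 1 ≠ 0 := sub_ne_zero.mpr (hr n hn)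

theorem qInt_one {q : ℂ} (h0 : q ≠ 0) (h1 : q ^ 2 ≠ 1) : qInt q 1 = 1 := by
  have := sub_inv_ne h0 h1
  simp [qInt, this]

theorem qInt_two {q : ℂ} (h0 : q ≠ 0) (h1 : q ^ 2 ≠ 1) : qInt q 2 = q + q⁻¹ := by
  have := sub_inv_ne h0 h1
  rw [qInt, div_eq_iff this]; ring

theorem qInt_three {q : ℂ} (h0 : q ≠ 0) (h1 : q ^ 2 ≠ 1) : qInt q 3 = q ^ 2 + 1 + q⁻¹ ^ 2 := by
  have := sub_inv_ne h0 h1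
  rw [qInt, div_eq_iff this]; field_simp; ring

theorem qInt_four {q : ℂ} (h0 : q ≠ 0) (h1 : q ^ 2 ≠ 1) :
    qInt q 4 = (q + q⁻¹) * (q ^ 2 + q⁻¹ ^ 2) := by
  have := sub_inv_ne h0 h1
  rw [qInt, div_eq_iff this]; field_simp; ring

theorem qInt_five {q : ℂ} (h0 : q ≠ 0) (h1 : q ^ 2 ≠ 1) :
    qInt q 5 = q ^ 4 + q ^ 2 + 1 + q⁻¹ ^ 2 + q⁻¹ ^ 4 := by
  have := sub_inv_ne h0 h1
  rw [qInt, div_eq_iff this]; field_simp; ring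

theorem qInt_ne_zero {q : ℂ} (h0 : q ≠ 0) (hr : ∀ n : ℕ, 1 ≤ n → q ^ n ≠ 1) {n : ℕ} (hn : 1 ≤ n) :
    qInt q n ≠ 0 := by
  refine div_ne_zero ?_ (sub_inv_ne h0 (hr 2 (by norm_num)))
  intro h
  apply hr (2 * n) (by omega)
  have : q ^ n = q⁻¹ ^ n := sub_eq_zero.mp h
  rw [two_mul, pow_add]
  nth_rewrite 1 [this]
  rw [← mul_pow, inv_mul_cancel₀ h0, one_pow]

variable {R : Type*} [Ring R] [Algebra ℂ R] {q Q : ℂ}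

theorem onsagerDefect_zero (h0 : Q ≠ 0) (hr : ∀ n : ℕ, 1 ≤ n → Q ^ n ≠ 1) (ρ : ℕ → ℂ) (x y : R) :
    onsagerDefect q Q 0 ρ x y = x * y - y * x := by
  have h1 := qInt_one h0 (hr 2 (by norm_num))
  simp [onsagerDefect, qSerre, sum_range_succ, qBinom, qFact, prod_range_succ, h1]
  module

theorem qSerre_one (h0 : Q ≠ 0) (hr : ∀ n : ℕ, 1 ≤ n → Q ^ n ≠ 1) (x y : R) :
    qSerre Q 1 x y = x * (x * y) - (Q + Q⁻¹) • (x * (y * x)) + y * (x * x) := by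
  have h2 := hr 2 (by norm_num)
  have n2 := qInt_ne_zero h0 hr (n := 2) (by norm_num)
  rw [qInt_two h0 h2] at n2
  simp [qSerre, sum_range_succ, qBinom, qFact, prod_range_succ, qInt_one h0 h2, qInt_two h0 h2,
    div_self n2, pow_succ, mul_assoc]
  match_scalars
  all_goals field_simp
  ring

theorem qSerre_two (h0 : Q ≠ 0) (hr : ∀ n : ℕ, 1 ≤ n → Q ^ n ≠ 1) (x y : R) :
    qSerre Q 2 x y = x * (x * (x * y)) - (Q ^ 2 + 1 + Q⁻¹ ^ 2) • (x * (x * (y * x)))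
      + (Q ^ 2 + 1 + Q⁻¹ ^ 2) • (x * (y * (x * x))) - y * (x * (x * x)) := by
  have h2 := hr 2 (by norm_num)
  have n2 := qInt_ne_zero h0 hr (n := 2) (by norm_num)
  have n3 := qInt_ne_zero h0 hr (n := 3) (by norm_num)
  have e1 := qInt_one h0 h2
  rw [← qInt_three h0 h2]
  simp only [qSerre, sum_range_succ, qBinom, qFact, prod_range_succ, e1, prod_range_zero,
    sum_range_zero, pow_succ, mul_assoc, pow_zero, one_mul, mul_one, zero_add, Nat.reduceAdd,
    Nat.reduceSub]
  match_scalars <;> field_simp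

theorem qSerre_three (h0 : Q ≠ 0) (hr : ∀ n : ℕ, 1 ≤ n → Q ^ n ≠ 1) (x y : R) :
    qSerre Q 3 x y = x * (x * (x * (x * y)))
      - ((Q + Q⁻¹) * (Q ^ 2 + Q⁻¹ ^ 2)) • (x * (x * (x * (y * x))))
      + ((Q ^ 2 + 1 + Q⁻¹ ^ 2) * (Q ^ 2 + Q⁻¹ ^ 2)) • (x * (x * (y * (x * x))))
      - ((Q + Q⁻¹) * (Q ^ 2 + Q⁻¹ ^ 2)) • (x * (y * (x * (x * x))))
      + y * (x * (x * (x * x))) := by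
  have h2 := hr 2 (by norm_num)
  have n2 := qInt_ne_zero h0 hr (n := 2) (by norm_num)
  have n3 := qInt_ne_zero h0 hr (n := 3) (by norm_num)
  have n4 := qInt_ne_zero h0 hr (n := 4) (by norm_num)
  have e1 := qInt_one h0 h2
  have e4 : qInt Q 4 = qInt Q 2 * (Q ^ 2 + Q⁻¹ ^ 2) := by rw [qInt_four h0 h2, qInt_two h0 h2]
  rw [← qInt_three h0 h2, ← qInt_two h0 h2]
  rw [e4] at n4
  have n4' := right_ne_zero_of_mul n4
  -- Treating `[4]/[2]` as an atom lets the `q`-binomials simplify without expanding powers of `Q`.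
  generalize Q ^ 2 + Q⁻¹ ^ 2 = u at *
  simp only [qSerre, sum_range_succ, qBinom, qFact, prod_range_succ, e1, e4, prod_range_zero,
    sum_range_zero, pow_succ, mul_assoc, pow_zero, one_mul, mul_one, zero_add, Nat.reduceAdd,
    Nat.reduceSub]
  match_scalars <;> field_simp

theorem qSerre_four (h0 : Q ≠ 0) (hr : ∀ n : ℕ, 1 ≤ n → Q ^ n ≠ 1) (x y : R) :
    qSerre Q 4 x y = x * (x * (x * (x * (x * y))))
      - (Q ^ 4 + Q ^ 2 + 1 + Q⁻¹ ^ 2 + Q⁻¹ ^ 4) • (x * (x * (x * (x * (y * x)))))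
      + ((Q ^ 4 + Q ^ 2 + 1 + Q⁻¹ ^ 2 + Q⁻¹ ^ 4) * (Q ^ 2 + Q⁻¹ ^ 2)) •
        (x * (x * (x * (y * (x * x)))))
      - ((Q ^ 4 + Q ^ 2 + 1 + Q⁻¹ ^ 2 + Q⁻¹ ^ 4) * (Q ^ 2 + Q⁻¹ ^ 2)) •
        (x * (x * (y * (x * (x * x)))))
      + (Q ^ 4 + Q ^ 2 + 1 + Q⁻¹ ^ 2 + Q⁻¹ ^ 4) • (x * (y * (x * (x * (x * x)))))
      - y * (x * (x * (x * (x * x)))) := by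
  have h2 := hr 2 (by norm_num)
  have n2 := qInt_ne_zero h0 hr (n := 2) (by norm_num)
  have n3 := qInt_ne_zero h0 hr (n := 3) (by norm_num)
  have n4 := qInt_ne_zero h0 hr (n := 4) (by norm_num)
  have n5 := qInt_ne_zero h0 hr (n := 5) (by norm_num)
  have e1 := qInt_one h0 h2
  have e4 : qInt Q 4 = qInt Q 2 * (Q ^ 2 + Q⁻¹ ^ 2) := by rw [qInt_four h0 h2, qInt_two h0 h2]
  rw [← qInt_five h0 h2]
  rw [e4] at n4
  have n4' := right_ne_zero_of_mul n4
  generalize Q ^ 2 + Q⁻¹ ^ 2 = u at *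
  simp only [qSerre, sum_range_succ, qBinom, qFact, prod_range_succ, e1, e4, prod_range_zero,
    sum_range_zero, pow_succ, mul_assoc, pow_zero, one_mul, mul_one, zero_add, Nat.reduceAdd,
    Nat.reduceSub]
  match_scalars <;> field_simp

theorem onsagerDefect_one (h0 : Q ≠ 0) (hr : ∀ n : ℕ, 1 ≤ n → Q ^ n ≠ 1) (ρ : ℕ → ℂ) (x y : R) :
    onsagerDefect q Q 1 ρ x y = quadDefect (Q + Q⁻¹) (ρ 0) x y := by
  rw [onsagerDefect, qSerre_one h0 hr, quadDefect]
  simp [onsagerGamma]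

theorem onsagerDefect_two (h0 : Q ≠ 0) (hr : ∀ n : ℕ, 1 ≤ n → Q ^ n ≠ 1) (ρ : ℕ → ℂ) (x y : R) :
    onsagerDefect q Q 2 ρ x y =
      x * quadDefect (Q ^ 2 + Q⁻¹ ^ 2) (ρ 0) x y - quadDefect (Q ^ 2 + Q⁻¹ ^ 2) (ρ 0) x y * x := by
  rw [onsagerDefect, qSerre_two h0 hr, quadDefect]
  simp only [Nat.reduceAdd, Nat.reduceDiv, range_one, sum_singleton, mul_zero, Nat.sub_zero,
    sum_range_succ, sum_range_zero, onsagerGamma, pow_zero, pow_one, Nat.reduceSub, mul_add,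
    add_mul, mul_sub, sub_mul, mul_smul_comm, smul_mul_assoc, mul_assoc, one_mul, mul_one, zero_add]
  module

theorem onsagerDefect_three (ρ : ℕ → ℂ) (x y : R) :
    onsagerDefect q q 3 ρ x y = qSerre q 3 x y -
      ρ 0 • quadDefect (onsagerGamma q 3 0 1) 0 x y - ρ 1 • y := by
  rw [onsagerDefect, quadDefect]
  have g0 : onsagerGamma q 3 0 0 = 1 := rfl
  have g1 : onsagerGamma q 3 0 2 = 1 := rfl
  have g2 : onsagerGamma q 3 1 0 = 1 := rfl
  simp only [Nat.reduceAdd, Nat.reduceDiv, mul_zero, Nat.sub_zero, mul_one,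
    sum_range_succ, sum_range_zero, g0, g1, g2, pow_zero, pow_one, Nat.reduceSub, pow_two,
    mul_assoc, one_mul, mul_one, zero_add]
  module

/-- The cubic form `L³ - γL²R + γLR² - R³` is antisymmetric under exchanging left and right, hence
divisible by `L - R`, with quotient `L² - (γ - 1)LR + R²`. -/
theorem onsagerDefect_four (ρ : ℕ → ℂ) (x y : R) :
    onsagerDefect q q 4 ρ x y = qSerre q 4 x y -
      ρ 0 • quadDefect (onsagerGamma q 4 0 1 - 1) 0 x (x * y - y * x) - ρ 1 • (x * y - y * x) := by
  rw [onsagerDefect, quadDefect]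
  have g0 : onsagerGamma q 4 0 0 = 1 := rfl
  have g1 : onsagerGamma q 4 0 3 = 1 := rfl
  have g2 : onsagerGamma q 4 1 0 = 1 := rfl
  have g3 : onsagerGamma q 4 1 1 = 1 := rfl
  have g4 : onsagerGamma q 4 0 2 = onsagerGamma q 4 0 1 := rfl
  simp only [Nat.reduceAdd, Nat.reduceDiv, mul_zero, Nat.sub_zero, mul_one,
    sum_range_succ, sum_range_zero, g0, g1, g2, g3, g4, pow_zero, pow_one, Nat.reduceSub, pow_succ,
    mul_assoc, one_mul, mul_one, zero_add, mul_sub, sub_mul]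
  module

/-- The product of the two quadratics contributes three lower terms with only two free constants;
`γ` is the ratio forced on the middle one. Assumption `hd` lets its denominator cancel against `ρ
0`. -/
theorem onsagerDefect_three_eq (h0 : q ≠ 0) (hr : ∀ n : ℕ, 1 ≤ n → q ^ n ≠ 1)
    (hd : q ^ 4 + 2 * q ^ 2 + 4 + 2 * q⁻¹ ^ 2 + q⁻¹ ^ 4 ≠ 0) {κ : ℂ} {ρ : ℕ → ℂ}
    (hρ0 : ρ 0 = κ * (q ^ 4 + 2 * q ^ 2 + 4 + 2 * q⁻¹ ^ 2 + q⁻¹ ^ 4))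
    (hρ1 : ρ 1 = -(κ ^ 2 * (q ^ 2 + 1 + q⁻¹ ^ 2) ^ 2)) (x y : R) :
    onsagerDefect q q 3 ρ x y = quadDefect (q + q⁻¹) κ x
      (quadDefect (q ^ 3 + q⁻¹ ^ 3) (κ * (q ^ 2 + 1 + q⁻¹ ^ 2) ^ 2) x y) := by
  have hγ : ρ 0 * onsagerGamma q 3 0 1 =
      κ * ((q + q⁻¹) * (q ^ 2 + q⁻¹ ^ 2) * (q ^ 2 + 3 + q⁻¹ ^ 2)) := by
    rw [hρ0, onsagerGamma, mul_assoc, mul_div_cancel₀ _ hd]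
  rw [onsagerDefect_three, qSerre_three h0 hr]
  simp only [quadDefect, smul_sub, smul_add, smul_smul, hγ, mul_add,
    add_mul, mul_sub, sub_mul, mul_smul_comm, smul_mul_assoc, mul_assoc]
  simp only [hρ0, hρ1]
  match_scalars <;> field_simp <;> ring

/-- As for `m = 3`, with the additional factor `L - R`: `ρ 0 * γ` is the inner cubic coefficient of
the product, and its denominator cancels by `hd`. -/
theorem onsagerDefect_four_eq (h0 : q ≠ 0) (hr : ∀ n : ℕ, 1 ≤ n → q ^ n ≠ 1)
    (hd : q ^ 4 + q⁻¹ ^ 4 + 3 ≠ 0) {κ : ℂ} {ρ : ℕ → ℂ}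
    (hρ0 : ρ 0 = κ * (q + q⁻¹) ^ 2 * (q ^ 4 + 3 + q⁻¹ ^ 4))
    (hρ1 : ρ 1 = -(κ ^ 2 * (q + q⁻¹) ^ 4 * (q ^ 2 + q⁻¹ ^ 2) ^ 2)) (x y : R) :
    onsagerDefect q q 4 ρ x y =
      (let z := quadDefect (q ^ 2 + q⁻¹ ^ 2) (κ * (q + q⁻¹) ^ 2) x
        (quadDefect (q ^ 4 + q⁻¹ ^ 4) (κ * ((q + q⁻¹) * (q ^ 2 + q⁻¹ ^ 2)) ^ 2) x y)
      x * z - z * x) := by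
  have hγ : ρ 0 * onsagerGamma q 4 0 1 =
      κ * (q + q⁻¹) ^ 2 * ((q ^ 2 + 1 + q⁻¹ ^ 2) *
        (q ^ 4 + q ^ 2 + 1 + q⁻¹ ^ 2 + q⁻¹ ^ 4)) := by
    rw [hρ0, onsagerGamma, qInt_three h0 (hr 2 (by norm_num)), qInt_five h0 (hr 2 (by norm_num)),
      add_right_comm, mul_assoc, mul_div_cancel₀]
    exact hd
  rw [onsagerDefect_four, qSerre_four h0 hr]
  simp only [quadDefect, smul_sub, smul_add, smul_smul, sub_smul, mul_sub, hγ, mul_add,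
    add_mul, mul_sub, sub_mul, mul_smul_comm, smul_mul_assoc, mul_assoc]
  simp only [hρ0, hρ1]
  match_scalars <;> field_simp <;> ring

end Onsager

/-! ### Numerical facts on Cartan matrices. -/

namespace AffineType

variable (X : AffineType)

/-- The possible pairs `(d_i, d_j)`. -/
def dPairs : List (ℕ × ℕ) :=
  [(1, 1), (2, 2), (3, 3), (4, 4), (1, 2), (2, 1), (2, 4), (4, 2), (1, 3), (3, 1), (1, 4), (4, 1)]

theorem dNat_pair_mem (i j : ℕ) : (X.dNat i, X.dNat j) ∈ dPairs := by
  cases X <;> simp only [dNat] <;> (try split_ifs) <;> decide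

theorem link_cases {i j : X.Node} (hij : i ≠ j) :
    (X.cartan i j = 0 ∧ X.cartan j i = 0) ∨
      (X.cartan i j = -((max (X.d i) (X.d j) / X.d i : ℕ) : ℤ) ∧
        X.cartan j i = -((max (X.d i) (X.d j) / X.d j : ℕ) : ℤ)) := by
  unfold cartan
  rw [if_neg hij, if_neg hij.symm, Bool.or_comm (X.edge j i), max_comm (X.d j)]
  split_ifs
  · exact Or.inr ⟨rfl, rfl⟩
  · exact Or.inl ⟨rfl, rfl⟩

/-- Linked nodes have entries determined by the pair `(d_i, d_j)`, which lies in the finite list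
`dPairs`; so only twelve cases need inspection, whatever the type and rank. -/
theorem cartan_data {i j : X.Node} (hij : i ≠ j) :
    X.cartan i j = -(X.mult i j : ℤ) ∧ X.d i * X.mult i j = X.d j * X.mult j i ∧
    1 ≤ X.d i ∧ X.mult i j ≤ 4 ∧ (3 ≤ X.mult i j → X.d i = 1) ∧
    (2 ≤ X.mult i j → X.mult j i = 1) ∧
    (X.mult i j = 1 → 1 ≤ X.mult j i) := by
  have h := X.dNat_pair_mem i j
  change (X.d i, X.d j) ∈ dPairs at h
  have hl := X.link_cases hij
  unfold mult
  generalize X.d i = a at *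
  generalize X.d j = b at *
  simp only [dPairs, List.mem_cons, Prod.mk.injEq, List.not_mem_nil, or_false] at h
  rcases hl with ⟨h1, h2⟩ | ⟨h1, h2⟩
  · rw [h1, h2]
    refine ⟨by simp, by simp, by omega, by simp, by simp, by simp, by simp⟩
  · rw [h1, h2]
    rcases h with h | h | h | h | h | h | h | h | h | h | h | h <;> obtain ⟨rfl, rfl⟩ := h <;>
      simp

/-- The exponent `d_i a_{ij}` is symmetric. -/
theorem d_mul_cartan {i j : X.Node} (hij : i ≠ j) :
    (X.d i : ℤ) * X.cartan i j = -((X.d i * X.mult i j : ℕ) : ℤ) ∧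
      (X.d j : ℤ) * X.cartan j i = -((X.d i * X.mult i j : ℕ) : ℤ) := by
  obtain ⟨h1, h2, -⟩ := X.cartan_data hij
  obtain ⟨h3, -⟩ := X.cartan_data hij.symm
  refine ⟨by rw [h1]; push_cast; ring, ?_⟩
  rw [h2, h3]; push_cast; ring

theorem cartan_self (i : X.Node) : X.cartan i i = 2 := if_pos rfl

end AffineType

/-! ### Relations of `U_q`, with the Serre relations kept separate. -/

/-- The defining relations of `U_q(ĝ)` other than the Serre relations, with the conjugations
written as `q`-commutation relations. -/
structure PreRel (X : AffineType) (q s : ℂ) {R : Type*} [Ring R] [Algebra ℂ R]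
    (e f k kinv : X.Node → R) : Prop where
  k_kinv (i) : k i * kinv i = 1
  kinv_k (i) : kinv i * k i = 1
  k_comm (i j) : k i * k j = k j * k i
  k_e (i j) : k i * e j = s ^ ((X.d i : ℤ) * X.cartan i j) • (e j * k i)
  k_f (i j) : k i * f j = s ^ (-((X.d i : ℤ) * X.cartan i j)) • (f j * k i)
  ef_same (i) : e i * f i - f i * e i =
    (X.qi q i - (X.qi q i)⁻¹)⁻¹ • (k i ^ 2 - kinv i ^ 2)
  ef_ne (i j) (hij : i ≠ j) : e i * f j = f j * e i

namespace Uq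

variable (X : AffineType) (q s : ℂ)

/-- `q_i^{-h_i/2}` in `U_q(ĝ)`. -/
noncomputable def kinv (i : X.Node) : Uq X q s := proj X q s (gen X (.kinv i))

theorem proj_eq {a b : FreeAlgebra ℂ (UGen X.Node)} (h : Rel X q s a b) :
    proj X q s a = proj X q s b := RingQuot.mkAlgHom_rel ℂ h

theorem preRel : PreRel X q s (e X q s) (f X q s) (k X q s) (kinv X q s) := by
  have h1 : ∀ i, k X q s i * kinv X q s i = 1 := fun i => by
    simpa [k, kinv] using proj_eq X q s (Rel.k_kinv i)
  have h2 : ∀ i, kinv X q s i * k X q s i = 1 := fun i => by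
    simpa [k, kinv] using proj_eq X q s (Rel.kinv_k i)
  refine ⟨h1, h2, fun i j => by simpa [k] using proj_eq X q s (Rel.k_comm i j), fun i j => ?_,
    fun i j => ?_, fun i => ?_, fun i j hij => ?_⟩
  · have := congrArg (· * k X q s i) (proj_eq X q s (Rel.k_e i j))
    simp only [map_mul, map_smul] at this
    change k X q s i * e X q s j * kinv X q s i * k X q s i =
      (s ^ ((X.d i : ℤ) * X.cartan i j) • e X q s j) * k X q s i at this
    rwa [mul_assoc, h2, mul_one, smul_mul_assoc] at this
  · have := congrArg (· * k X q s i) (proj_eq X q s (Rel.k_f i j))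
    simp only [map_mul, map_smul] at this
    change k X q s i * f X q s j * kinv X q s i * k X q s i =
      (s ^ (-((X.d i : ℤ) * X.cartan i j)) • f X q s j) * k X q s i at this
    rwa [mul_assoc, h2, mul_one, smul_mul_assoc] at this
  · simpa [e, f, k, kinv] using proj_eq X q s (Rel.e_f_same i)
  · have := proj_eq X q s (Rel.e_f_ne i j hij)
    simp only [map_mul, map_sub, map_zero] at this
    exact sub_eq_zero.mp this

theorem map_qSerre {A B : Type*} [Ring A] [Ring B] [Algebra ℂ A] [Algebra ℂ B] (φ : A →ₐ[ℂ] B)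
    (Q : ℂ) (m : ℕ) (x y : A) : φ (qSerre Q m x y) = qSerre Q m (φ x) (φ y) := by
  simp [qSerre]

theorem serre_e {i j : X.Node} (hij : i ≠ j) :
    qSerre (X.qi q i) (X.mult i j) (e X q s i) (e X q s j) = 0 := by
  have := proj_eq X q s (Rel.serre_e i j hij)
  rwa [map_qSerre, map_zero] at this

theorem serre_f {i j : X.Node} (hij : i ≠ j) :
    qSerre (X.qi q i) (X.mult i j) (f X q s i) (f X q s j) = 0 := by
  have := proj_eq X q s (Rel.serre_f i j hij)
  rwa [map_qSerre, map_zero] at this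

end Uq

/-! ### Serre polynomials as iterated `q`-commutators. -/

section Serre

variable {R : Type*} [Ring R] [Algebra ℂ R] {p : ℂ}

theorem inv_not_root (hr : ∀ n : ℕ, 1 ≤ n → p ^ n ≠ 1) : ∀ n : ℕ, 1 ≤ n → p⁻¹ ^ n ≠ 1 := by
  intro n hn
  rw [inv_pow]
  simpa using hr n hn

theorem qSerre_zero (h0 : p ≠ 0) (hr : ∀ n : ℕ, 1 ≤ n → p ^ n ≠ 1) (x y : R) :
    qSerre p 0 x y = x * y - y * x := by
  simpa [onsagerDefect] using onsagerDefect_zero (q := p) h0 hr (fun _ => 0) x y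

/-- This is the `q`-binomial theorem for the commuting operators of left and right multiplication:
the product of the `L - p^{2s-m}R` over `0 ≤ s ≤ m` has the signed `q`-binomials as coefficients. -/
theorem adjChain_last (h0 : p ≠ 0) (hr : ∀ n : ℕ, 1 ≤ n → p ^ n ≠ 1) {m : ℕ} (hm : m ≤ 4)
    (x y : R) : adjChain p m x y (m + 1) = qSerre p m x y := by
  interval_cases m
  · rw [qSerre_zero h0 hr]
    simp [adjChain]
  · rw [qSerre_one h0 hr]
    simp only [adjChain, mul_sub, sub_mul, mul_smul_comm, smul_mul_assoc, mul_assoc, smul_sub,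
      smul_smul]
    match_scalars
    all_goals field_simp
    all_goals ring
  · rw [qSerre_two h0 hr]
    simp only [adjChain, mul_sub, sub_mul, mul_smul_comm, smul_mul_assoc, mul_assoc, smul_sub,
      smul_smul]
    match_scalars <;> field_simp <;> ring
  · rw [qSerre_three h0 hr]
    simp only [adjChain, mul_sub, sub_mul, mul_smul_comm, smul_mul_assoc, mul_assoc, smul_sub,
      smul_smul]
    match_scalars <;> field_simp <;> ring
  · rw [qSerre_four h0 hr]
    simp only [adjChain, mul_sub, sub_mul, mul_smul_comm, smul_mul_assoc, mul_assoc, smul_sub,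
      smul_smul]
    match_scalars <;> field_simp <;> ring

theorem qInt_inv (a : ℕ) : qInt p⁻¹ a = qInt p a := by
  rw [qInt, qInt, inv_inv, ← neg_sub (p ^ a), ← neg_sub p, neg_div_neg_eq]

theorem qSerre_inv (m : ℕ) (x y : R) : qSerre p⁻¹ m x y = qSerre p m x y := by
  simp only [qSerre, qBinom, qFact, qInt_inv]

/-- Twisting by group-like elements multiplies the iterated `q`-commutators by scalars. -/
theorem exists_adjChain_twist {x y k l : R} {ν c : ℂ} (m : ℕ) (hkx : k * x = p • (x * k))
    (hky : k * y = ν • (y * k)) (hlx : l * x = ν • (x * l)) (hkl : k * l = l * k) (t : ℕ) :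
    ∃ a : ℂ, adjChain p m (c • (x * k)) (y * l) t = a • (adjChain p m x y t * (k ^ t * l)) ∧
      k * adjChain p m x y t = (ν * p ^ t) • (adjChain p m x y t * k) := by
  induction t with
  | zero => exact ⟨1, by simp [adjChain], by simpa [adjChain] using hky⟩
  | succ t ih =>
    obtain ⟨a, h1, h2⟩ := ih
    simp only [adjChain]
    rw [h1]
    set z := adjChain p m x y t
    have hkt : ∀ n : ℕ, k ^ n * x = p ^ n • (x * k ^ n) := by
      intro n
      induction n with
      | zero => simp
      | succ n ih =>
        rw [pow_succ, mul_assoc, hkx, mul_smul_comm, ← mul_assoc, ih, smul_mul_assoc, smul_smul,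
          mul_assoc, pow_succ' p]
    have hlk : ∀ u, l * (k * u) = k * (l * u) := comm_assoc_of_eq hkl.symm
    refine ⟨a * c * (ν * p ^ t), ?_, ?_⟩
    -- Moving `k` past `z` on one side, and `k^t l` past `x` on the other, costs the same scalar
    -- `νp^t`. Hence the `q`-commutator keeps its shape.
    · have e1 : x * k * (z * (k ^ t * l)) = (ν * p ^ t) • (x * z * (k ^ (t + 1) * l)) := by
        rw [mul_assoc, ← mul_assoc k, h2, smul_mul_assoc, mul_smul_comm, pow_succ']
        simp only [mul_assoc]
      have e2 : z * (k ^ t * l) * (x * k) = (ν * p ^ t) • (z * x * (k ^ (t + 1) * l)) := by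
        rw [mul_assoc, mul_assoc (k ^ t), ← mul_assoc l, hlx, smul_mul_assoc, mul_smul_comm,
          mul_assoc x, ← mul_assoc (k ^ t), hkt, ← hkl, smul_mul_assoc, mul_smul_comm,
          mul_smul_comm, smul_smul, pow_succ]
        simp only [mul_assoc]
      simp only [smul_mul_assoc, mul_smul_comm, e1, e2, sub_mul]
      module
    · rw [mul_sub, ← mul_assoc, hkx, smul_mul_assoc, mul_assoc, h2, mul_smul_comm, mul_smul_comm,
        ← mul_assoc k, h2, smul_mul_assoc, mul_assoc z, hkx]
      simp only [mul_smul_comm, sub_mul, smul_mul_assoc, mul_assoc, pow_succ]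
      module

end Serre

/-! ### Uniform vanishing statements with the constants `ρ̄`. -/

section

variable {R : Type*} [Ring R] [Algebra ℂ R] {q p κ : ℂ}

theorem onsagerGamma_inv (m k l : ℕ) : onsagerGamma q⁻¹ m k l = onsagerGamma q m k l := by
  unfold onsagerGamma
  split
  · rw [inv_inv]; congr 1 <;> ring
  · rw [qInt_inv, qInt_inv, inv_inv]; congr 1; ring
  · rw [qInt_inv, qInt_inv, inv_inv]; congr 1; ring
  · rfl

/-- `q`-integers and the `γ` are invariant under inverting `q`. This matches the inversion of `p` in
`QTriple.swap`. -/
theorem onsagerDefect_inv (m : ℕ) (ρ : ℕ → ℂ) (x y : R) :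
    onsagerDefect q⁻¹ p⁻¹ m ρ x y = onsagerDefect q p m ρ x y := by
  simp only [onsagerDefect, qSerre_inv, onsagerGamma_inv]

/-- The structure constants for which the realization of the generalized `q`-Onsager algebra
holds, together with the accompanying conditions on `q`. -/
structure RhoSpec (q p κ : ℂ) (m : ℕ) (ρ : ℕ → ℂ) : Prop where
  le : m ≤ 4
  one : m = 1 → ρ 0 = κ
  two : m = 2 → ρ 0 = κ * (p + p⁻¹) ^ 2
  three : m = 3 → p = q ∧ q ^ 4 + 2 * q ^ 2 + 4 + 2 * q⁻¹ ^ 2 + q⁻¹ ^ 4 ≠ 0 ∧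
    ρ 0 = κ * (q ^ 4 + 2 * q ^ 2 + 4 + 2 * q⁻¹ ^ 2 + q⁻¹ ^ 4) ∧
    ρ 1 = -(κ ^ 2 * (q ^ 2 + 1 + q⁻¹ ^ 2) ^ 2)
  four : m = 4 → p = q ∧ q ^ 4 + q⁻¹ ^ 4 + 3 ≠ 0 ∧
    ρ 0 = κ * (q + q⁻¹) ^ 2 * (q ^ 4 + 3 + q⁻¹ ^ 4) ∧
    ρ 1 = -(κ ^ 2 * (q + q⁻¹) ^ 4 * (q ^ 2 + q⁻¹ ^ 2) ^ 2)

theorem RhoSpec.inv {m : ℕ} {ρ : ℕ → ℂ} (h : RhoSpec q p κ m ρ) : RhoSpec q⁻¹ p⁻¹ κ m ρ := by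
  refine ⟨h.le, h.one, fun hm => ?_, fun hm => ?_, fun hm => ?_⟩
  · rw [h.two hm, inv_inv, add_comm]
  · obtain ⟨h1, h2, h3, h4⟩ := h.three hm
    have e : q⁻¹ ^ 4 + 2 * q⁻¹ ^ 2 + 4 + 2 * q⁻¹⁻¹ ^ 2 + q⁻¹⁻¹ ^ 4 =
      q ^ 4 + 2 * q ^ 2 + 4 + 2 * q⁻¹ ^ 2 + q⁻¹ ^ 4 := by rw [inv_inv]; ring
    rw [e]
    refine ⟨by rw [h1], h2, h3, ?_⟩
    rw [h4, inv_inv]; ring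
  · obtain ⟨h1, h2, h3, h4⟩ := h.four hm
    have e : q⁻¹ ^ 4 + q⁻¹⁻¹ ^ 4 + 3 = q ^ 4 + q⁻¹ ^ 4 + 3 := by rw [inv_inv]; ring
    rw [e]
    refine ⟨by rw [h1], h2, ?_, ?_⟩
    · rw [h3, inv_inv]; ring
    · rw [h4, inv_inv]; ring

variable {E F K y G : R}

theorem QTriple.onsagerDefect_weight (h : QTriple p κ E F K) (hr : ∀ n : ℕ, 1 ≤ n → p ^ n ≠ 1)
    {m : ℕ} {ρ : ℕ → ℂ} (hρ : RhoSpec q p κ m ρ) (hK : K * y = (p⁻¹) ^ m • (y * K))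
    (hF : F * y = (p⁻¹) ^ m • (y * F)) (hS : adjChain p m E y (m + 1) = 0) (w : ℂ) :
    onsagerDefect q p m ρ (E + F + w • K) y = 0 := by
  have h0 := h.ne
  have hm := hρ.le
  interval_cases m
  · rw [onsagerDefect_zero h0 hr]
    simp only [adjChain, pow_zero, mul_zero, mul_one, one_smul, zero_add] at hK hF hS
    rw [add_mul, add_mul, mul_add, mul_add, sub_eq_zero.mp hS, hF, smul_mul_assoc, hK,
      mul_smul_comm, sub_self]
  · rw [onsagerDefect_one h0 hr, hρ.one rfl]
    exact h.weight_one hK hF hS w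
  · rw [onsagerDefect_two h0 hr, hρ.two rfl]
    exact h.weight_two hK hF hS w
  · obtain ⟨rfl, h2, h3, h4⟩ := hρ.three rfl
    rw [onsagerDefect_three_eq h0 hr h2 h3 h4]
    exact h.weight_three hK hF hS w
  · obtain ⟨rfl, h2, h3, h4⟩ := hρ.four rfl
    rw [onsagerDefect_four_eq h0 hr h2 h3 h4]
    exact h.weight_four hK hF hS w

theorem QTriple.onsagerDefect_group (h : QTriple p κ E F K) (hr : ∀ n : ℕ, 1 ≤ n → p ^ n ≠ 1)
    {m : ℕ} {ρ : ℕ → ℂ} (hρ : RhoSpec q p κ m ρ) (hE : E * G = p ^ m • (G * E))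
    (hF : F * G = (p⁻¹) ^ m • (G * F)) (hK : K * G = G * K) (w : ℂ) :
    onsagerDefect q p m ρ (E + F + w • K) G =
      if m = 1 then -((p + p⁻¹ - 2) * w ^ 2 + κ) • (G * (K * K))
      else if m = 3 then
        ((p + p⁻¹ + 1) ^ 2 * ((p + p⁻¹ - 2) * w ^ 2 + κ) *
          ((p + p⁻¹ - 2) * w ^ 2 + κ * (p + p⁻¹ - 1) ^ 2)) • (G * (K * (K * (K * K))))
      else 0 := by
  have h0 := h.ne
  have hm := hρ.le
  interval_cases m
  · simp only [pow_zero, one_smul] at hE hF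
    rw [onsagerDefect_zero h0 hr]
    rw [add_mul, add_mul, mul_add, mul_add, hE, hF, smul_mul_assoc, hK,
      mul_smul_comm, sub_self]
    rfl
  · rw [onsagerDefect_one h0 hr, hρ.one rfl]
    exact h.group_one hE hF hK w
  · rw [onsagerDefect_two h0 hr, hρ.two rfl]
    exact h.group_two hE hF hK w
  · obtain ⟨rfl, h2, h3, h4⟩ := hρ.three rfl
    rw [onsagerDefect_three_eq h0 hr h2 h3 h4]
    exact h.group_three hE hF hK w
  · obtain ⟨rfl, h2, h3, h4⟩ := hρ.four rfl
    rw [onsagerDefect_four_eq h0 hr h2 h3 h4]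
    exact h.group_four hE hF hK w

theorem onsagerDefect_add (q Q : ℂ) (m : ℕ) (ρ : ℕ → ℂ) (x y z : R) :
    onsagerDefect q Q m ρ x (y + z) = onsagerDefect q Q m ρ x y + onsagerDefect q Q m ρ x z := by
  simp only [onsagerDefect, qSerre, mul_add, add_mul, smul_add, sum_add_distrib]
  abel

theorem onsagerDefect_smul (q Q : ℂ) (m : ℕ) (ρ : ℕ → ℂ) (a : ℂ) (x y : R) :
    onsagerDefect q Q m ρ x (a • y) = a • onsagerDefect q Q m ρ x y := by
  simp only [onsagerDefect, qSerre, mul_smul_comm, smul_mul_assoc, smul_sub, smul_sum,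
    smul_comm _ a]

theorem map_onsagerDefect {S : Type*} [Ring S] [Algebra ℂ S] (φ : R →ₐ[ℂ] S) (q Q : ℂ) (m : ℕ)
    (ρ : ℕ → ℂ) (x y : R) :
    φ (onsagerDefect q Q m ρ x y) = onsagerDefect q Q m ρ (φ x) (φ y) := by
  simp [onsagerDefect, qSerre]

end

/-! ### The elements of `U_q` as rank one data. -/

namespace AffineType

variable (X : AffineType) {q s : ℂ}

theorem qi_ne_zero (hq : q ≠ 0) (i : X.Node) : X.qi q i ≠ 0 := pow_ne_zero _ hq

theorem one_le_d (i : X.Node) : 1 ≤ X.d i := by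
  have h := X.dNat_pair_mem i i
  change (X.d i, X.d i) ∈ dPairs at h
  simp only [dPairs, List.mem_cons, Prod.mk.injEq, List.not_mem_nil, or_false] at h
  omega

theorem qi_not_root (hr : ∀ n : ℕ, 1 ≤ n → q ^ n ≠ 1) (i : X.Node) (n : ℕ) (hn : 1 ≤ n) :
    X.qi q i ^ n ≠ 1 := by
  rw [qi, ← pow_mul]
  exact hr _ (Nat.mul_pos (X.one_le_d i) hn)

/-- `s^{d_i a_{ij}}` for `i ≠ j`. -/
noncomputable def nu (s : ℂ) (i j : X.Node) : ℂ := s⁻¹ ^ (X.d i * X.mult i j)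

theorem nu_sq (hs : s ^ 2 = q) (i j : X.Node) : X.nu s i j * X.nu s i j = (X.qi q i)⁻¹ ^ X.mult i j := by
  rw [nu, ← mul_pow, ← sq, inv_pow, hs, qi, inv_pow, inv_pow, ← pow_mul]

theorem zpow_cartan {i j : X.Node} (hij : i ≠ j) :
    s ^ ((X.d i : ℤ) * X.cartan i j) = X.nu s i j ∧
    s ^ ((X.d j : ℤ) * X.cartan j i) = X.nu s i j ∧
    s ^ (-((X.d i : ℤ) * X.cartan i j)) = (X.nu s i j)⁻¹ ∧
    s ^ (-((X.d j : ℤ) * X.cartan j i)) = (X.nu s i j)⁻¹ := by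
  obtain ⟨h1, h2⟩ := X.d_mul_cartan hij
  rw [h1, h2]
  have : s ^ (-((X.d i * X.mult i j : ℕ) : ℤ)) = X.nu s i j := by
    rw [nu, zpow_neg, zpow_natCast, inv_pow]
  refine ⟨this, this, ?_, ?_⟩ <;> rw [zpow_neg, this]

theorem zpow_cartan_self (hs : s ^ 2 = q) (i : X.Node) :
    s ^ ((X.d i : ℤ) * X.cartan i i) = X.qi q i ∧
    s ^ (-((X.d i : ℤ) * X.cartan i i)) = (X.qi q i)⁻¹ := by
  have : s ^ ((X.d i : ℤ) * X.cartan i i) = X.qi q i := by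
    rw [X.cartan_self, qi, ← hs, ← pow_mul, mul_comm 2, ← zpow_natCast]
    push_cast; rfl
  exact ⟨this, by rw [zpow_neg, this]⟩

end AffineType

namespace PreRel

variable {X : AffineType} {q s : ℂ} {R : Type*} [Ring R] [Algebra ℂ R]
  {e f k kinv : X.Node → R}

/-- Multiplying `e_i` and `f_i` by `k_i` absorbs the inverse Cartan element: `[e_i, f_i]`
contributes `k_i⁻²`, and the two extra factors `k_i` turn it into the scalar `1`. -/
theorem qTriple (H : PreRel X q s e f k kinv) (hq : q ≠ 0) (hr : ∀ n : ℕ, 1 ≤ n → q ^ n ≠ 1)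
    (hs : s ^ 2 = q) (i : X.Node) (c c' : ℂ) :
    QTriple (X.qi q i) (c * c') (c • (e i * k i)) (c' • (f i * k i)) (k i ^ 2) := by
  have hke := H.k_e i i
  have hkf := H.k_f i i
  rw [(X.zpow_cartan_self hs i).1] at hke
  rw [(X.zpow_cartan_self hs i).2] at hkf
  have h0 := X.qi_ne_zero hq i
  have h2 := X.qi_not_root hr i 2 (by norm_num)
  have hsub := sub_inv_ne h0 h2
  set p := X.qi q i
  have ke := smul_assoc_of_eq hke
  have kf := smul_assoc_of_eq hkf
  have hef : ∀ u, f i * (e i * u) = e i * (f i * u) -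
      (p - p⁻¹)⁻¹ • (k i * (k i * u) - kinv i * (kinv i * u)) := fun u => by
    have := congrArg (· * u) (H.ef_same i)
    simp only [sub_mul, smul_mul_assoc, pow_two, mul_assoc] at this
    rw [← this]; abel
  have hkk : ∀ u, kinv i * (k i * u) = u := fun u => by rw [← mul_assoc, H.kinv_k, one_mul]
  refine ⟨h0, h2, ?_, ?_, ?_⟩
  · simp only [pow_two, mul_smul_comm, smul_mul_assoc, mul_assoc, ke, smul_smul]
    module
  · simp only [pow_two, mul_smul_comm, smul_mul_assoc, mul_assoc, kf, smul_smul]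
    module
  · simp only [pow_two, mul_smul_comm, smul_mul_assoc, mul_assoc, ke, kf, smul_smul, hef, hkk,
      H.kinv_k]
    match_scalars <;> field_simp

end PreRel

namespace PreRel

variable {X : AffineType} {q s : ℂ} {R : Type*} [Ring R] [Algebra ℂ R]
  {e f k kinv : X.Node → R}

theorem pair (H : PreRel X q s e f k kinv) {i j : X.Node} (hij : i ≠ j) :
    k i * e j = X.nu s i j • (e j * k i) ∧ k j * e i = X.nu s i j • (e i * k j) ∧
    k i * f j = (X.nu s i j)⁻¹ • (f j * k i) ∧ k j * f i = (X.nu s i j)⁻¹ • (f i * k j) := by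
  obtain ⟨h1, h2, h3, h4⟩ := X.zpow_cartan (s := s) hij
  have a1 := H.k_e i j
  have a2 := H.k_e j i
  have a3 := H.k_f i j
  have a4 := H.k_f j i
  rw [h1] at a1; rw [h2] at a2; rw [h3] at a3; rw [h4] at a4
  exact ⟨a1, a2, a3, a4⟩

/-- Since `[e_j, f_i] = 0`, only the Cartan factors fail to commute. Thus `F` and `K` move past `e_j
k_j` with the same scalar, as a starting vector of a string requires. -/
theorem smul_mul_weight_e (H : PreRel X q s e f k kinv) (hs : s ^ 2 = q) (hs0 : s ≠ 0) {i j : X.Node}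
    (hij : i ≠ j)
    (c' : ℂ) :
    k i ^ 2 * (e j * k j) = (X.qi q i)⁻¹ ^ X.mult i j • (e j * k j * k i ^ 2) ∧
    (c' • (f i * k i)) * (e j * k j) =
      (X.qi q i)⁻¹ ^ X.mult i j • (e j * k j * (c' • (f i * k i))) := by
  obtain ⟨h1, h2, h3, h4⟩ := H.pair hij
  have hν : X.nu s i j ≠ 0 := pow_ne_zero _ (inv_ne_zero hs0)
  rw [← X.nu_sq hs]
  have hc := H.k_comm i j
  have hf := H.ef_ne j i hij.symm
  set ν := X.nu s i j
  constructor
  · simp only [pow_two, mul_smul_comm, smul_mul_assoc, mul_assoc, smul_assoc_of_eq h1, smul_smul,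
      comm_assoc_of_eq hc, hc]
  · simp only [mul_smul_comm, smul_mul_assoc, mul_assoc, smul_assoc_of_eq h1, smul_assoc_of_eq h4,
      smul_smul, hc, comm_assoc_of_eq hf]
    congr 1
    field_simp

theorem smul_mul_weight_f (H : PreRel X q s e f k kinv) (hs : s ^ 2 = q) (hs0 : s ≠ 0) {i j : X.Node}
    (hij : i ≠ j)
    (c : ℂ) :
    k i ^ 2 * (f j * k j) = (X.qi q i)⁻¹⁻¹ ^ X.mult i j • (f j * k j * k i ^ 2) ∧
    (c • (e i * k i)) * (f j * k j) =
      (X.qi q i)⁻¹⁻¹ ^ X.mult i j • (f j * k j * (c • (e i * k i))) := by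
  obtain ⟨h1, h2, h3, h4⟩ := H.pair hij
  have hν : X.nu s i j ≠ 0 := pow_ne_zero _ (inv_ne_zero hs0)
  rw [inv_pow, ← X.nu_sq hs]
  have hc := H.k_comm i j
  have hf := H.ef_ne i j hij
  set ν := X.nu s i j
  constructor
  · simp only [pow_two, mul_smul_comm, smul_mul_assoc, mul_assoc, smul_assoc_of_eq h3, smul_smul,
      comm_assoc_of_eq hc, hc, mul_inv]
  · simp only [mul_smul_comm, smul_mul_assoc, mul_assoc, smul_assoc_of_eq h3, smul_assoc_of_eq h2,
      smul_smul, hc, comm_assoc_of_eq hf]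
    congr 1
    field_simp

theorem smul_mul_group (H : PreRel X q s e f k kinv) (hs : s ^ 2 = q) (hs0 : s ≠ 0) {i j : X.Node}
    (hij : i ≠ j)
    (c c' : ℂ) :
    (c • (e i * k i)) * k j ^ 2 = X.qi q i ^ X.mult i j • (k j ^ 2 * (c • (e i * k i))) ∧
    (c' • (f i * k i)) * k j ^ 2 =
      (X.qi q i)⁻¹ ^ X.mult i j • (k j ^ 2 * (c' • (f i * k i))) ∧
    k i ^ 2 * k j ^ 2 = k j ^ 2 * k i ^ 2 := by
  obtain ⟨h1, h2, h3, h4⟩ := H.pair hij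
  have hν : X.nu s i j ≠ 0 := pow_ne_zero _ (inv_ne_zero hs0)
  have hc := H.k_comm i j
  have e1 : X.qi q i ^ X.mult i j = (X.nu s i j * X.nu s i j)⁻¹ := by
    rw [X.nu_sq hs, inv_pow, inv_inv]
  rw [e1, ← X.nu_sq hs]
  set ν := X.nu s i j
  refine ⟨?_, ?_, ?_⟩
  · simp only [pow_two, mul_smul_comm, smul_mul_assoc, mul_assoc, smul_assoc_of_eq h2,
      smul_smul, hc, comm_assoc_of_eq hc]
    congr 1
    field_simp
  · simp only [pow_two, mul_smul_comm, smul_mul_assoc, mul_assoc, smul_assoc_of_eq h4,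
      smul_smul, hc, comm_assoc_of_eq hc]
    congr 1
    field_simp
  · exact ((show Commute (k i) (k j) from hc).pow_pow 2 2).eq

theorem adjChain_e (H : PreRel X q s e f k kinv) (hq : q ≠ 0)
    (hr : ∀ n : ℕ, 1 ≤ n → q ^ n ≠ 1) (hs : s ^ 2 = q) {i j : X.Node} (hij : i ≠ j)
    (hS : qSerre (X.qi q i) (X.mult i j) (e i) (e j) = 0) (c : ℂ) :
    adjChain (X.qi q i) (X.mult i j) (c • (e i * k i)) (e j * k j) (X.mult i j + 1) = 0 := by
  obtain ⟨h1, h2, h3, h4⟩ := H.pair hij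
  have h0 := H.k_e i i
  rw [(X.zpow_cartan_self hs i).1] at h0
  obtain ⟨a, ha, -⟩ := exists_adjChain_twist (c := c) (X.mult i j) h0 h1 h2 (H.k_comm i j)
    (X.mult i j + 1)
  rw [ha, adjChain_last (X.qi_ne_zero hq i) (X.qi_not_root hr i)
    (X.cartan_data hij).2.2.2.1, hS, zero_mul, smul_zero]

theorem adjChain_f (H : PreRel X q s e f k kinv) (hq : q ≠ 0)
    (hr : ∀ n : ℕ, 1 ≤ n → q ^ n ≠ 1) (hs : s ^ 2 = q) {i j : X.Node} (hij : i ≠ j)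
    (hS : qSerre (X.qi q i) (X.mult i j) (f i) (f j) = 0) (c : ℂ) :
    adjChain (X.qi q i)⁻¹ (X.mult i j) (c • (f i * k i)) (f j * k j) (X.mult i j + 1) = 0 := by
  obtain ⟨h1, h2, h3, h4⟩ := H.pair hij
  have h0 := H.k_f i i
  rw [(X.zpow_cartan_self hs i).2] at h0
  obtain ⟨a, ha, -⟩ := exists_adjChain_twist (c := c) (X.mult i j) h0 h3 h4 (H.k_comm i j)
    (X.mult i j + 1)
  rw [ha, adjChain_last (inv_ne_zero (X.qi_ne_zero hq i)) (inv_not_root (X.qi_not_root hr i))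
    (X.cartan_data hij).2.2.2.1, qSerre_inv, hS, zero_mul, smul_zero]

end PreRel

namespace Uq

variable {X : AffineType} {q s : ℂ}

theorem onsagerDefect_e (hq : q ≠ 0) (hr : ∀ n : ℕ, 1 ≤ n → q ^ n ≠ 1) (hs : s ^ 2 = q)
    {i j : X.Node} (hij : i ≠ j) (c c' w : X.Node → ℂ) {ρ : ℕ → ℂ}
    (hρ : RhoSpec q (X.qi q i) (c i * c' i) (X.mult i j) ρ) :
    onsagerDefect q (X.qi q i) (X.mult i j) ρ (realization X q s c c' w i)
      (e X q s j * k X q s j) = 0 := by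
  have H := preRel X q s
  have hs0 : s ≠ 0 := by rintro rfl; exact hq (by simp [← hs])
  obtain ⟨h1, h2⟩ := H.smul_mul_weight_e hs hs0 hij (c' i)
  exact (H.qTriple hq hr hs i (c i) (c' i)).onsagerDefect_weight (X.qi_not_root hr i) hρ h1 h2
    (H.adjChain_e hq hr hs hij (serre_e X q s hij) (c i)) (w i)

theorem onsagerDefect_f (hq : q ≠ 0) (hr : ∀ n : ℕ, 1 ≤ n → q ^ n ≠ 1) (hs : s ^ 2 = q)
    {i j : X.Node} (hij : i ≠ j) (c c' w : X.Node → ℂ) {ρ : ℕ → ℂ}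
    (hρ : RhoSpec q (X.qi q i) (c i * c' i) (X.mult i j) ρ) :
    onsagerDefect q (X.qi q i) (X.mult i j) ρ (realization X q s c c' w i)
      (f X q s j * k X q s j) = 0 := by
  have H := preRel X q s
  have hs0 : s ≠ 0 := by rintro rfl; exact hq (by simp [← hs])
  obtain ⟨h1, h2⟩ := H.smul_mul_weight_f hs hs0 hij (c i)
  -- For `f_j` the string is generated by `F`, so the triple is swapped and both `q` and `p` are
  -- inverted; `onsagerDefect_inv` undoes the inversion in the relation.
  have := (H.qTriple hq hr hs i (c i) (c' i)).swap.onsagerDefect_weight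
    (inv_not_root (X.qi_not_root hr i)) hρ.inv h1 h2
    (H.adjChain_f hq hr hs hij (serre_f X q s hij) (c' i)) (w i)
  rw [onsagerDefect_inv, add_comm (c' i • _)] at this
  exact this

theorem onsagerDefect_k (hq : q ≠ 0) (hr : ∀ n : ℕ, 1 ≤ n → q ^ n ≠ 1) (hs : s ^ 2 = q)
    {i j : X.Node} (hij : i ≠ j) (c c' w : X.Node → ℂ) {ρ : ℕ → ℂ}
    (hρ : RhoSpec q (X.qi q i) (c i * c' i) (X.mult i j) ρ) :
    onsagerDefect q (X.qi q i) (X.mult i j) ρ (realization X q s c c' w i) (k X q s j ^ 2) =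
      let p := X.qi q i
      let K := k X q s i ^ 2
      if X.mult i j = 1 then
        -((p + p⁻¹ - 2) * w i ^ 2 + c i * c' i) • (k X q s j ^ 2 * (K * K))
      else if X.mult i j = 3 then
        ((p + p⁻¹ + 1) ^ 2 * ((p + p⁻¹ - 2) * w i ^ 2 + c i * c' i) *
          ((p + p⁻¹ - 2) * w i ^ 2 + c i * c' i * (p + p⁻¹ - 1) ^ 2)) •
            (k X q s j ^ 2 * (K * (K * (K * K))))
      else 0 := by
  have H := preRel X q s
  have hs0 : s ≠ 0 := by rintro rfl; exact hq (by simp [← hs])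
  obtain ⟨h1, h2, h3⟩ := H.smul_mul_group hs hs0 hij (c i) (c' i)
  exact (H.qTriple hq hr hs i (c i) (c' i)).onsagerDefect_group (X.qi_not_root hr i) hρ h1 h2 h3
    (w i)

end Uq

/-! ### Reduction to pairs of nodes, and sufficiency of the constraints. -/

theorem realizable_iff (X : AffineType) (q s : ℂ) (c c' w : X.Node → ℂ)
    (ρ : X.Node → X.Node → ℕ → ℂ) :
    Realizable X q s c c' w ρ ↔ ∀ i j : X.Node, i ≠ j →
      onsagerDefect q (X.qi q i) (X.mult i j) (ρ i j) (Uq.realization X q s c c' w i)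
        (Uq.realization X q s c c' w j) = 0 := by
  constructor
  · rintro ⟨φ, hφ⟩ i j hij
    have h : onsagerDefect q (X.qi q i) (X.mult i j) (ρ i j) (Oq.A X q ρ i) (Oq.A X q ρ j) = 0 := by
      have := RingQuot.mkAlgHom_rel ℂ (Oq.Rel.onsager (X := X) (q := q) (ρ := ρ) i j hij)
      rw [← sub_eq_zero, ← map_sub] at this
      rw [← this]
      exact (map_onsagerDefect (RingQuot.mkAlgHom ℂ (Oq.Rel X q ρ)) q (X.qi q i) (X.mult i j)
        (ρ i j) (FreeAlgebra.ι ℂ i) (FreeAlgebra.ι ℂ j)).symm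
    have h2 := congrArg φ h
    rwa [map_onsagerDefect, hφ, hφ, map_zero] at h2
  · intro h
    refine ⟨RingQuot.liftAlgHom ℂ ⟨FreeAlgebra.lift ℂ (Uq.realization X q s c c' w), ?_⟩, ?_⟩
    · rintro _ _ ⟨i, j, hij⟩
      rw [← sub_eq_zero, ← map_sub]
      refine (map_onsagerDefect (FreeAlgebra.lift ℂ (Uq.realization X q s c c' w)) q (X.qi q i)
        (X.mult i j) (ρ i j) (FreeAlgebra.ι ℂ i) (FreeAlgebra.ι ℂ j)).trans ?_
      rw [FreeAlgebra.lift_ι_apply, FreeAlgebra.lift_ι_apply]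
      exact h i j hij
    · intro i
      rw [Oq.A, RingQuot.liftAlgHom_mkAlgHom_apply, FreeAlgebra.lift_ι_apply]

/-- Links become ordered pairs: by the computation on `k_j²` only odd `m` can obstruct. Any link
type has a `-1` entry in at least one direction, giving `w_j P_i = 0`, and triple links add the
other condition. -/
theorem constraints_iff (X : AffineType) (q : ℂ) (c c' w : X.Node → ℂ) :
    Constraints X q c c' w ↔ ∀ i j : X.Node, i ≠ j →
      (X.mult i j = 1 → w j * baseFactor X q c c' w i = 0) ∧
      (X.mult i j = 3 → w j * baseFactor X q c c' w i * tripleFactor X q c c' w i = 0) := by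
  constructor
  · intro h i j hij
    obtain ⟨h1, -, -, h4, h5, h6, h7⟩ := X.cartan_data hij
    obtain ⟨k1, -, -, k4, k5, k6, k7⟩ := X.cartan_data hij.symm
    obtain ⟨a1, a2, a3, a4⟩ := h i j
    obtain ⟨-, -, b3, -⟩ := h j i
    refine ⟨fun hm => ?_, fun hm => ?_⟩
    · have := h7 hm
      have hc : X.cartan i j = -1 := by omega
      have hj : X.mult j i = 1 ∨ X.mult j i = 2 ∨ X.mult j i = 3 ∨ X.mult j i = 4 := by omega
      rcases hj with hj | hj | hj | hj
      · exact (a1 ⟨hc, by omega⟩).2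
      · exact a2 ⟨hc, by omega⟩
      · exact (a3 ⟨hc, by omega⟩).1
      · exact a4 ⟨hc, by omega⟩
    · have := h6 (by omega)
      exact (b3 ⟨by omega, by omega⟩).2
  · intro h i j
    by_cases hij : i = j
    · subst hij
      rw [X.cartan_self]
      norm_num
    obtain ⟨h1, -⟩ := X.cartan_data hij
    obtain ⟨k1, -⟩ := X.cartan_data (Ne.symm hij)
    obtain ⟨a1, a2⟩ := h i j hij
    obtain ⟨b1, b2⟩ := h j i (Ne.symm hij)
    refine ⟨fun ⟨u, v⟩ => ⟨b1 (by omega), a1 (by omega)⟩, fun ⟨u, v⟩ => a1 (by omega),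
      fun ⟨u, v⟩ => ⟨a1 (by omega), b2 (by omega)⟩, fun ⟨u, v⟩ => a1 (by omega)⟩

section

variable {X : AffineType} {q s : ℂ}

theorem rhoSpec_rhoValue
    (hden3 : ∀ i j : X.Node, X.cartan i j = -3 →
      q ^ 4 + 2 * q ^ 2 + 4 + 2 * q⁻¹ ^ 2 + q⁻¹ ^ 4 ≠ 0)
    (hden4 : ∀ i j : X.Node, X.cartan i j = -4 → q ^ 4 + q⁻¹ ^ 4 + 3 ≠ 0)
    (c c' : X.Node → ℂ) {i j : X.Node} (hij : i ≠ j) :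
    RhoSpec q (X.qi q i) (c i * c' i) (X.mult i j) (rhoValue X q c c' i j) := by
  obtain ⟨h1, -, -, h4, h5, -⟩ := X.cartan_data hij
  have hq : 3 ≤ X.mult i j → X.qi q i = q := fun h => by
    rw [AffineType.qi, h5 h, pow_one]
  refine ⟨h4, fun h => ?_, fun h => ?_, fun h => ⟨hq (by omega), hden3 i j (by omega), ?_, ?_⟩,
    fun h => ⟨hq (by omega), hden4 i j (by omega), ?_, ?_⟩⟩ <;> simp only [rhoValue, h]

theorem qi_add_inv_sub_two_ne (hq : q ≠ 0) (hr : ∀ n : ℕ, 1 ≤ n → q ^ n ≠ 1) (i : X.Node) :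
    X.qi q i + (X.qi q i)⁻¹ - 2 ≠ 0 := by
  have h0 := X.qi_ne_zero hq i
  have h1 := X.qi_not_root hr i 1 le_rfl
  rw [pow_one] at h1
  have : X.qi q i + (X.qi q i)⁻¹ - 2 = (X.qi q i - 1) ^ 2 / X.qi q i := by field_simp; ring
  rw [this]
  exact div_ne_zero (pow_ne_zero _ (sub_ne_zero.mpr h1)) h0

theorem mul_baseFactor (hq : q ≠ 0) (hr : ∀ n : ℕ, 1 ≤ n → q ^ n ≠ 1) (c c' w : X.Node → ℂ)
    (i : X.Node) :
    (X.qi q i + (X.qi q i)⁻¹ - 2) * w i ^ 2 + c i * c' i =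
      (X.qi q i + (X.qi q i)⁻¹ - 2) * baseFactor X q c c' w i := by
  have := qi_add_inv_sub_two_ne hq hr i
  rw [baseFactor, mul_add, mul_div_cancel₀ _ this]

theorem mul_tripleFactor (hq : q ≠ 0) (hr : ∀ n : ℕ, 1 ≤ n → q ^ n ≠ 1) (c c' w : X.Node → ℂ)
    (i : X.Node) :
    (X.qi q i + (X.qi q i)⁻¹ - 2) * w i ^ 2 + c i * c' i * (X.qi q i + (X.qi q i)⁻¹ - 1) ^ 2 =
      (X.qi q i + (X.qi q i)⁻¹ - 2) * tripleFactor X q c c' w i := by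
  have := qi_add_inv_sub_two_ne hq hr i
  rw [tripleFactor, mul_add, mul_div_cancel₀ _ this]

theorem onsagerDefect_realization (q Q : ℂ) (m : ℕ) (ρ : ℕ → ℂ) (x : Uq X q s)
    (c c' w : X.Node → ℂ) (j : X.Node) :
    onsagerDefect q Q m ρ x (Uq.realization X q s c c' w j) =
      c j • onsagerDefect q Q m ρ x (Uq.e X q s j * Uq.k X q s j) +
      c' j • onsagerDefect q Q m ρ x (Uq.f X q s j * Uq.k X q s j) +
      w j • onsagerDefect q Q m ρ x (Uq.k X q s j ^ 2) := by
  rw [Uq.realization, onsagerDefect_add, onsagerDefect_add, onsagerDefect_smul, onsagerDefect_smul,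
    onsagerDefect_smul]

theorem realizable_of_constraints (hq : q ≠ 0) (hr : ∀ n : ℕ, 1 ≤ n → q ^ n ≠ 1) (hs : s ^ 2 = q)
    {c c' w : X.Node → ℂ} {ρ : X.Node → X.Node → ℕ → ℂ}
    (hρ : ∀ i j, i ≠ j → RhoSpec q (X.qi q i) (c i * c' i) (X.mult i j) (ρ i j))
    (hC : Constraints X q c c' w) : Realizable X q s c c' w ρ := by
  rw [constraints_iff] at hC
  rw [realizable_iff]
  intro i j hij
  obtain ⟨h1, h3⟩ := hC i j hij
  rw [onsagerDefect_realization, Uq.onsagerDefect_e hq hr hs hij c c' w (hρ i j hij),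
    Uq.onsagerDefect_f hq hr hs hij c c' w (hρ i j hij),
    Uq.onsagerDefect_k hq hr hs hij c c' w (hρ i j hij), smul_zero, smul_zero, add_zero, zero_add]
  simp only
  rw [mul_baseFactor hq hr, mul_tripleFactor hq hr]
  split_ifs with hm hm
  · rw [smul_smul]
    have : w j * -((X.qi q i + (X.qi q i)⁻¹ - 2) * baseFactor X q c c' w i) = 0 := by
      linear_combination (-(X.qi q i + (X.qi q i)⁻¹ - 2)) * h1 hm
    rw [this, zero_smul]
  · rw [smul_smul]
    have : w j * ((X.qi q i + (X.qi q i)⁻¹ + 1) ^ 2 * ((X.qi q i + (X.qi q i)⁻¹ - 2) *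
        baseFactor X q c c' w i) * ((X.qi q i + (X.qi q i)⁻¹ - 2) *
        tripleFactor X q c c' w i)) = 0 := by
      linear_combination ((X.qi q i + (X.qi q i)⁻¹ + 1) ^ 2 *
        (X.qi q i + (X.qi q i)⁻¹ - 2) ^ 2) * h3 hm
    rw [this, zero_smul]
  · exact smul_zero _

end

/-! ### Commutation of the `f_l` with the Serre elements in the `e_i`. -/

section

variable {R : Type*} [Ring R] [Algebra ℂ R] {p : ℂ}

theorem adjChain_commutator {g x : R} (h : g * x = x * g) (m : ℕ) (y : R) (t : ℕ) :
    g * adjChain p m x y t - adjChain p m x y t * g = adjChain p m x (g * y - y * g) t := by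
  induction t with
  | zero => rfl
  | succ t ih =>
    simp only [adjChain]
    rw [← ih]
    simp only [mul_sub, sub_mul, mul_smul_comm, smul_mul_assoc, mul_assoc, h, comm_assoc_of_eq h]
    module

theorem adjChain_sub (m : ℕ) (x y z : R) (t : ℕ) :
    adjChain p m x (y - z) t = adjChain p m x y t - adjChain p m x z t := by
  induction t with
  | zero => rfl
  | succ t ih =>
    simp only [adjChain, ih, mul_sub, sub_mul]
    module

theorem adjChain_smul (m : ℕ) (a : ℂ) (x y : R) (t : ℕ) :
    adjChain p m x (a • y) t = a • adjChain p m x y t := by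
  induction t with
  | zero => rfl
  | succ t ih =>
    simp only [adjChain, ih, mul_smul_comm, smul_mul_assoc]
    module

theorem adjChain_of_smul_comm {L x : R} {μ : ℂ} (h : L * x = μ • (x * L)) (m t : ℕ) :
    adjChain p m x L t = (∏ u ∈ range t, (1 - p⁻¹ ^ m * p ^ (2 * u) * μ)) • (x ^ t * L) := by
  induction t with
  | zero => simp [adjChain]
  | succ t ih =>
    simp only [adjChain, ih, prod_range_succ, mul_smul_comm, smul_mul_assoc, mul_assoc, h,
      pow_succ]
    rw [← mul_assoc x (x ^ t), ← pow_succ', pow_succ, mul_assoc]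
    module

/-- The commutator with `g` of the iterated `q`-commutators of `x` with `y`, if `[g, x]` is a
multiple of `K - K'`. -/
theorem commutator_adjChain {g x y K K' : R} {b : ℂ} {m : ℕ} (h0 : p ≠ 0)
    (hgx : g * x - x * g = b • (K - K')) (hgy : g * y = y * g)
    (hKx : K * x = p ^ 2 • (x * K)) (hKx' : K' * x = p⁻¹ ^ 2 • (x * K'))
    (hKy : K * y = p⁻¹ ^ m • (y * K)) (hKy' : K' * y = p ^ m • (y * K')) (t : ℕ) :
    g * adjChain p m x y (t + 1) - adjChain p m x y (t + 1) * g =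
      (b * ∑ u ∈ range (t + 1), (p⁻¹ ^ m * p ^ (2 * u) - p ^ m * p⁻¹ ^ (2 * u))) •
        (adjChain p m x y t * K') := by
  have hK : ∀ t, K * adjChain p m x y t = (p⁻¹ ^ m * p ^ (2 * t)) • (adjChain p m x y t * K) := by
    intro t
    induction t with
    | zero => simpa [adjChain] using hKy
    | succ t ih =>
      simp only [adjChain, mul_sub, sub_mul, mul_smul_comm, smul_mul_assoc, mul_assoc, ih,
        smul_assoc_of_eq ih, hKx, smul_assoc_of_eq hKx]
      match_scalars <;> ring
  have hK' : ∀ t, K' * adjChain p m x y t =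
      (p ^ m * p⁻¹ ^ (2 * t)) • (adjChain p m x y t * K') := by
    intro t
    induction t with
    | zero => simpa [adjChain] using hKy'
    | succ t ih =>
      simp only [adjChain, mul_sub, sub_mul, mul_smul_comm, smul_mul_assoc, mul_assoc, ih,
        smul_assoc_of_eq ih, hKx', smul_assoc_of_eq hKx']
      match_scalars <;> ring
  have hgx' : ∀ u, g * (x * u) = x * (g * u) + b • (K * u - K' * u) := fun u => by
    have := congrArg (· * u) hgx
    simp only [sub_mul, smul_mul_assoc, mul_assoc] at this
    rw [← this]; abel
  have hgx2 : g * x = x * g + b • (K - K') := by rw [← hgx]; abel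
  -- In the contribution of `[g, x]` the twist `p^{2t-m}` is exactly the eigenvalue of `K`, so the
  -- `K` terms cancel and only `K'` remains.
  have step : ∀ t, g * adjChain p m x y (t + 1) - adjChain p m x y (t + 1) * g =
      (b * (p⁻¹ ^ m * p ^ (2 * t) - p ^ m * p⁻¹ ^ (2 * t))) • (adjChain p m x y t * K') +
      (x * (g * adjChain p m x y t - adjChain p m x y t * g) -
        (p⁻¹ ^ m * p ^ (2 * t)) • ((g * adjChain p m x y t - adjChain p m x y t * g) * x)) := by
    intro t
    have hz := hK t
    have hz' := hK' t
    simp only [adjChain]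
    set z := adjChain p m x y t
    simp only [mul_sub, sub_mul, mul_add, mul_smul_comm, smul_mul_assoc, mul_assoc, hgx', hgx2, hz,
      hz']
    module
  induction t with
  | zero =>
    rw [step, sum_range_one]
    simp [adjChain, hgy]
  | succ t ih =>
    rw [step, ih, sum_range_succ _ (t + 1)]
    have : adjChain p m x y (t + 1) * K' = x * (adjChain p m x y t * K') -
        (p⁻¹ ^ m * p ^ (2 * (t + 1))) • (adjChain p m x y t * K' * x) := by
      simp only [adjChain, sub_mul, smul_mul_assoc, mul_assoc, hKx', mul_smul_comm, smul_smul]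
      congr 2
      field_simp
      ring
    simp only [smul_mul_assoc, mul_smul_comm]
    rw [this]
    module

end

namespace PreRel

variable {X : AffineType} {q s : ℂ} {R : Type*} [Ring R] [Algebra ℂ R]
  {e f k kinv : X.Node → R}

theorem smul_comm_inv {a b b' : R} {t : ℂ} (ht : t ≠ 0) (hb : b * b' = 1) (hb' : b' * b = 1)
    (h : b * a = t • (a * b)) : b' * a = t⁻¹ • (a * b') := by
  have : a * b' = t • (b' * a) := by
    calc a * b' = b' * (b * a) * b' := by rw [← mul_assoc, hb', one_mul]
      _ = t • (b' * a) := by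
        rw [h, mul_smul_comm, smul_mul_assoc, mul_assoc, mul_assoc, hb, mul_one]
  rw [this, smul_smul, inv_mul_cancel₀ ht, one_smul]

/-- The Chevalley involution. -/
theorem swap (H : PreRel X q s e f k kinv) (hs0 : s ≠ 0) : PreRel X q s f e kinv k := by
  refine ⟨H.kinv_k, H.k_kinv, fun i j => ?_, fun i j => ?_, fun i j => ?_, fun i => ?_,
    fun i j hij => (H.ef_ne j i hij.symm).symm⟩
  · have h1 : kinv i * k j = k j * kinv i := by
      simpa using smul_comm_inv one_ne_zero (H.k_kinv i) (H.kinv_k i)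
        (by simpa using H.k_comm i j)
    simpa using (smul_comm_inv one_ne_zero (H.k_kinv j) (H.kinv_k j)
        (by simpa using h1.symm)).symm
  · rw [smul_comm_inv (zpow_ne_zero _ hs0) (H.k_kinv i) (H.kinv_k i) (H.k_f i j), zpow_neg, inv_inv]
  · rw [smul_comm_inv (zpow_ne_zero _ hs0) (H.k_kinv i) (H.kinv_k i) (H.k_e i j), zpow_neg]
  · rw [← neg_sub, H.ef_same, ← neg_sub (k i ^ 2), smul_neg]

theorem sq_comm {a b : R} {t : ℂ} (h : b * a = t • (a * b)) : b ^ 2 * a = (t * t) • (a * b ^ 2) := by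
  simp only [pow_two, mul_assoc, h, mul_smul_comm, smul_smul, smul_assoc_of_eq h]

/-- Only `l = i` and `l = j` are not immediate. Both rest on the exponents `2u - m` for `0 ≤ u ≤ m`
being symmetric about zero and including `±m`. Neither Serre relation is assumed, so this applies to
the word operators below. -/
theorem serre_commute (H : PreRel X q s e f k kinv) (hq : q ≠ 0)
    (hr : ∀ n : ℕ, 1 ≤ n → q ^ n ≠ 1) (hs : s ^ 2 = q) {i j : X.Node} (hij : i ≠ j) (l : X.Node) :
    f l * qSerre (X.qi q i) (X.mult i j) (e i) (e j) =
      qSerre (X.qi q i) (X.mult i j) (e i) (e j) * f l := by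
  have hs0 : s ≠ 0 := by rintro rfl; exact hq (by simp [← hs])
  obtain ⟨h1, h2, -, -⟩ := H.pair hij
  have h0 := H.k_e i i
  rw [(X.zpow_cartan_self hs i).1] at h0
  have hp := X.qi_ne_zero hq i
  have hν : X.nu s i j ≠ 0 := pow_ne_zero _ (inv_ne_zero hs0)
  have i0 := smul_comm_inv hp (H.k_kinv i) (H.kinv_k i) h0
  have i1 := smul_comm_inv hν (H.k_kinv i) (H.kinv_k i) h1
  have i2 := smul_comm_inv hν (H.k_kinv j) (H.kinv_k j) h2
  have n1 := X.nu_sq hs i j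
  have n2 : (X.nu s i j)⁻¹ * (X.nu s i j)⁻¹ = X.qi q i ^ X.mult i j := by
    rw [← mul_inv, n1, inv_pow, inv_inv]
  have hm := (X.cartan_data hij).2.2.2.1
  rw [← adjChain_last hp (X.qi_not_root hr i) hm, ← sub_eq_zero]
  by_cases hli : l = i
  · subst hli
    have b1 := sq_comm h0
    have b2 := sq_comm i0
    have b3 := sq_comm h1
    have b4 := sq_comm i1
    rw [n1] at b3
    rw [n2] at b4
    rw [← pow_two] at b1 b2
    have hgx : f l * e l - e l * f l =
        (-(X.qi q l - (X.qi q l)⁻¹)⁻¹) • (k l ^ 2 - kinv l ^ 2) := by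
      rw [neg_smul, ← H.ef_same]; abel
    rw [commutator_adjChain hp hgx (H.ef_ne j l hij.symm).symm b1 b2 b3 b4]
    -- The summand changes sign under `u ↦ m - u`.
    have : ∑ u ∈ range (X.mult l j + 1), ((X.qi q l)⁻¹ ^ X.mult l j * X.qi q l ^ (2 * u) -
        X.qi q l ^ X.mult l j * (X.qi q l)⁻¹ ^ (2 * u)) = 0 := by
      generalize X.mult l j = m at *
      generalize X.qi q l = p at *
      interval_cases m <;>
        simp only [sum_range_succ, sum_range_zero, Nat.reduceMul, pow_zero] <;> field_simp <;> ring
    rw [this, mul_zero, zero_smul]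
  · rw [adjChain_commutator (H.ef_ne i l (Ne.symm hli)).symm]
    by_cases hlj : l = j
    · subst hlj
      have hgx : f l * e l - e l * f l =
          (-(X.qi q l - (X.qi q l)⁻¹)⁻¹) • (k l ^ 2 - kinv l ^ 2) := by
        rw [neg_smul, ← H.ef_same]; abel
      have b1 := sq_comm h2
      have b2 := sq_comm i2
      rw [n1] at b1
      rw [n2] at b2
      rw [hgx, adjChain_smul, adjChain_sub, adjChain_of_smul_comm b1, adjChain_of_smul_comm b2,
        prod_range_succ, prod_range_succ', mul_comm 2, pow_mul]
      -- For `k_l²` the last factor of the product vanishes, for its inverse the first one; the two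
      -- products above are split accordingly.
      have z1 : 1 - (X.qi q i)⁻¹ ^ X.mult i l * (X.qi q i ^ X.mult i l) ^ 2 *
          (X.qi q i)⁻¹ ^ X.mult i l = 0 := by
        have hu := pow_ne_zero (X.mult i l) hp
        rw [inv_pow, pow_two, inv_mul_cancel_left₀ hu, mul_inv_cancel₀ hu, sub_self]
      have z2 : 1 - (X.qi q i)⁻¹ ^ X.mult i l * X.qi q i ^ (2 * 0) *
          (X.qi q i) ^ X.mult i l = 0 := by
        have hu := pow_ne_zero (X.mult i l) hp
        rw [inv_pow, mul_zero, pow_zero, mul_one, inv_mul_cancel₀ hu, sub_self]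
      rw [z1, z2]
      simp
    · rw [(H.ef_ne j l (Ne.symm hlj)), sub_self]
      have := adjChain_smul (p := X.qi q i) (X.mult i j) 0 (e i) 0 (X.mult i j + 1)
      simpa using this

end PreRel

/-! ### Verma modules built from words in the `f_i`. -/

namespace Verma

variable (X : AffineType) (q s κ : ℂ)

/-- The free module on words in the `f_i`. -/
abbrev Words : Type := List X.Node →₀ ℂ

variable {X} in
theorem hom_ext {M : Type*} [AddCommGroup M] [Module ℂ M] {S T : Words X →ₗ[ℂ] M}
    (h : ∀ l, S (Finsupp.single l 1) = T (Finsupp.single l 1)) : S = T :=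
  Finsupp.lhom_ext' fun l => LinearMap.ext_ring (h l)

/-- The eigenvalue of `q_i^{h_i/2}` on a word, the highest weight being `κ` for all `i`. -/
noncomputable def wt (i : X.Node) : List X.Node → ℂ
  | [] => κ
  | b :: l => s ^ (-((X.d i : ℤ) * X.cartan i b)) * wt i l

noncomputable def fOp (i : X.Node) : Module.End ℂ (Words X) := Finsupp.lmapDomain ℂ ℂ (List.cons i)

noncomputable def kOp (i : X.Node) : Module.End ℂ (Words X) :=
  Finsupp.linearCombination ℂ fun l => wt X s κ i l • Finsupp.single l 1

noncomputable def kinvOp (i : X.Node) : Module.End ℂ (Words X) :=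
  Finsupp.linearCombination ℂ fun l => (wt X s κ i l)⁻¹ • Finsupp.single l 1

/-- The scalar by which `[e_i, f_i]` acts on a word. -/
noncomputable def efScalar (i : X.Node) (l : List X.Node) : ℂ :=
  (X.qi q i - (X.qi q i)⁻¹)⁻¹ * (wt X s κ i l ^ 2 - (wt X s κ i l)⁻¹ ^ 2)

/-- The recursion is forced by `e_i f_b = f_b e_i + δ_{ib}[e_i, f_i]` and by `e_i` killing the
highest weight vector, the empty word. -/
noncomputable def eVec (i : X.Node) : List X.Node → Words X
  | [] => 0
  | b :: l => fOp X b (eVec i l) +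
      if i = b then efScalar X q s κ i l • Finsupp.single l 1 else 0

noncomputable def eOp (i : X.Node) : Module.End ℂ (Words X) :=
  Finsupp.linearCombination ℂ (eVec X q s κ i)

theorem fOp_single (i : X.Node) (l : List X.Node) :
    fOp X i (Finsupp.single l 1) = Finsupp.single (i :: l) 1 := by
  simp [fOp]

theorem kOp_single (i : X.Node) (l : List X.Node) :
    kOp X s κ i (Finsupp.single l 1) = wt X s κ i l • Finsupp.single l 1 := by
  rw [kOp, Finsupp.linearCombination_single, one_smul]

theorem kinvOp_single (i : X.Node) (l : List X.Node) :
    kinvOp X s κ i (Finsupp.single l 1) = (wt X s κ i l)⁻¹ • Finsupp.single l 1 := by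
  rw [kinvOp, Finsupp.linearCombination_single, one_smul]

theorem eOp_single (i : X.Node) (l : List X.Node) :
    eOp X q s κ i (Finsupp.single l 1) = eVec X q s κ i l := by
  rw [eOp, Finsupp.linearCombination_single, one_smul]

variable {X q s κ}

theorem wt_ne_zero (hs0 : s ≠ 0) (hκ : κ ≠ 0) (i : X.Node) (l : List X.Node) :
    wt X s κ i l ≠ 0 := by
  induction l with
  | nil => exact hκ
  | cons b l ih => exact mul_ne_zero (zpow_ne_zero _ hs0) ih

theorem kOp_mul_fOp (i b : X.Node) :
    kOp X s κ i * fOp X b = s ^ (-((X.d i : ℤ) * X.cartan i b)) • (fOp X b * kOp X s κ i) := by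
  refine hom_ext fun l => ?_
  simp only [Module.End.mul_apply, LinearMap.smul_apply, fOp_single, kOp_single, map_smul, wt,
    smul_smul]

theorem kOp_eVec (hs0 : s ≠ 0) (i j : X.Node) (l : List X.Node) :
    kOp X s κ i (eVec X q s κ j l) =
      (s ^ ((X.d i : ℤ) * X.cartan i j) * wt X s κ i l) • eVec X q s κ j l := by
  induction l with
  | nil => simp [eVec]
  | cons b l ih =>
    have hf : ∀ u, kOp X s κ i (fOp X b u) =
        s ^ (-((X.d i : ℤ) * X.cartan i b)) • fOp X b (kOp X s κ i u) := fun u =>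
      congrArg (fun T : Module.End ℂ (Words X) => T u) (kOp_mul_fOp i b)
    rw [eVec, map_add, hf, ih, map_smul, smul_smul, smul_add, wt]
    congr 1
    · congr 1; ring
    · split_ifs with h
      · subst h
        rw [map_smul, kOp_single, ← mul_assoc, ← zpow_add₀ hs0, add_neg_cancel, zpow_zero, one_mul,
          smul_comm]
      · simp

theorem preRel (hs0 : s ≠ 0) (hκ : κ ≠ 0) :
    PreRel X q s (R := Module.End ℂ (Words X)) (eOp X q s κ) (fOp X) (kOp X s κ)
      (kinvOp X s κ) := by
  refine ⟨fun i => ?_, fun i => ?_, fun i j => ?_, fun i j => ?_, kOp_mul_fOp, fun i => ?_,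
    fun i j hij => ?_⟩ <;> refine hom_ext fun l => ?_
  · have := wt_ne_zero hs0 hκ i l
    simp only [Module.End.mul_apply, kOp_single, kinvOp_single, map_smul, smul_smul,
      inv_mul_cancel₀ this, one_smul, Module.End.one_apply]
  · have := wt_ne_zero hs0 hκ i l
    simp only [Module.End.mul_apply, kOp_single, kinvOp_single, map_smul, smul_smul,
      mul_inv_cancel₀ this, one_smul, Module.End.one_apply]
  · simp only [Module.End.mul_apply, kOp_single, map_smul]
    rw [smul_comm]
  · simp only [Module.End.mul_apply, kOp_single, map_smul, LinearMap.smul_apply, eOp_single,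
      kOp_eVec hs0, smul_smul]
  · simp only [Module.End.mul_apply, LinearMap.sub_apply, LinearMap.smul_apply, fOp_single,
      eOp_single, eVec, pow_two, kOp_single, kinvOp_single, map_smul, if_pos, smul_smul, efScalar]
    module
  · simp only [Module.End.mul_apply, fOp_single, eOp_single, eVec, if_neg hij, add_zero]

/-- The Serre element kills the empty word and commutes with every `f_b`, and words arise from the
empty one by applying the `f_b`. Thus only the Serre relations among the `f_i` have to be imposed by
a quotient. -/
theorem serre_e_eq_zero (hq : q ≠ 0) (hr : ∀ n : ℕ, 1 ≤ n → q ^ n ≠ 1) (hs : s ^ 2 = q)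
    (hκ : κ ≠ 0) {i j : X.Node} (hij : i ≠ j) :
    qSerre (X.qi q i) (X.mult i j) (eOp X q s κ i) (eOp X q s κ j) = 0 := by
  have hs0 : s ≠ 0 := by rintro rfl; exact hq (by simp [← hs])
  refine hom_ext fun l => ?_
  induction l with
  | nil =>
    simp only [qSerre, LinearMap.sum_apply, LinearMap.smul_apply, Module.End.mul_apply,
      LinearMap.zero_apply]
    refine sum_eq_zero fun r _ => ?_
    have h0 : ∀ i, eOp X q s κ i (Finsupp.single [] 1) = 0 := fun i => by
      rw [eOp_single, eVec]
    cases r with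
    | zero => simp [h0]
    | succ r => simp [pow_succ, h0]
  | cons b l ih =>
    rw [← fOp_single, ← Module.End.mul_apply,
      ← (preRel hs0 hκ).serre_commute hq hr hs hij b, Module.End.mul_apply, ih]
    simp

variable (X q) in
/-- The smallest subspace which is stable under the `f_i` and contains the images of the Serre
elements. -/
noncomputable def serreSub : Submodule ℂ (Words X) :=
  sInf {P | (∀ l v, v ∈ P → fOp X l v ∈ P) ∧ ∀ i j, i ≠ j → ∀ v,
    qSerre (X.qi q i) (X.mult i j) (fOp X i) (fOp X j) v ∈ P}

theorem serreSub_le {P : Submodule ℂ (Words X)} (h1 : ∀ l v, v ∈ P → fOp X l v ∈ P)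
    (h2 : ∀ i j, i ≠ j → ∀ v, qSerre (X.qi q i) (X.mult i j) (fOp X i) (fOp X j) v ∈ P) :
    serreSub X q ≤ P := sInf_le ⟨h1, h2⟩

theorem fOp_mem {v : Words X} (l : X.Node) (hv : v ∈ serreSub X q) :
    fOp X l v ∈ serreSub X q := by
  simp only [serreSub, Submodule.mem_sInf] at hv ⊢
  exact fun P hP => hP.1 l v (hv P hP)

theorem serre_mem {i j : X.Node} (hij : i ≠ j) (v : Words X) :
    qSerre (X.qi q i) (X.mult i j) (fOp X i) (fOp X j) v ∈ serreSub X q := by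
  simp only [serreSub, Submodule.mem_sInf]
  exact fun P hP => hP.2 i j hij v

theorem qSerre_mul_of_smul_comm {R : Type*} [Ring R] [Algebra ℂ R] (Q : ℂ) (m : ℕ) {x y k : R}
    {a b : ℂ} (hx : k * x = a • (x * k)) (hy : k * y = b • (y * k)) :
    k * qSerre Q m x y = (a ^ (m + 1) * b) • (qSerre Q m x y * k) := by
  have hn : ∀ n : ℕ, k * x ^ n = a ^ n • (x ^ n * k) := by
    intro n
    induction n with
    | zero => simp
    | succ n ih =>
      rw [pow_succ, ← mul_assoc, ih, smul_mul_assoc, mul_assoc, hx, mul_smul_comm, smul_smul,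
        mul_assoc, pow_succ]
  simp only [qSerre, mul_sum, sum_mul, smul_sum]
  refine sum_congr rfl fun r hr => ?_
  have : a ^ (m + 1) = a ^ (m + 1 - r) * a ^ r := by
    rw [← pow_add, Nat.sub_add_cancel (Nat.lt_succ_iff.mp (mem_range.mp hr))]
  rw [mul_smul_comm, ← mul_assoc, ← mul_assoc, hn, smul_mul_assoc, mul_assoc _ k, hy,
    mul_smul_comm, smul_mul_assoc, smul_mul_assoc, mul_assoc _ _ (x ^ r), mul_assoc y k, hn]
  simp only [mul_smul_comm, smul_mul_assoc, smul_smul, mul_assoc]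
  congr 1
  rw [this]
  ring

theorem kOp_mem {v : Words X} (l : X.Node) (hv : v ∈ serreSub X q) :
    kOp X s κ l v ∈ serreSub X q := by
  have : serreSub X q ≤ (serreSub X q).comap (kOp X s κ l) := by
    refine serreSub_le (fun b u hu => ?_) fun i j hij u => ?_
    · rw [Submodule.mem_comap, ← Module.End.mul_apply, kOp_mul_fOp]
      exact Submodule.smul_mem _ _ (fOp_mem b hu)
    · rw [Submodule.mem_comap, ← Module.End.mul_apply,
        qSerre_mul_of_smul_comm _ _ (kOp_mul_fOp l i) (kOp_mul_fOp l j)]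
      exact Submodule.smul_mem _ _ (serre_mem hij _)
  exact this hv

theorem kinvOp_mem (hs0 : s ≠ 0) (hκ : κ ≠ 0) {v : Words X} (l : X.Node)
    (hv : v ∈ serreSub X q) : kinvOp X s κ l v ∈ serreSub X q := by
  have H := ((preRel (X := X) (q := q) hs0 hκ).swap hs0).k_e
  have : serreSub X q ≤ (serreSub X q).comap (kinvOp X s κ l) := by
    refine serreSub_le (fun b u hu => ?_) fun i j hij u => ?_
    · rw [Submodule.mem_comap, ← Module.End.mul_apply, H]
      exact Submodule.smul_mem _ _ (fOp_mem b hu)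
    · rw [Submodule.mem_comap, ← Module.End.mul_apply,
        qSerre_mul_of_smul_comm _ _ (H l i) (H l j)]
      exact Submodule.smul_mem _ _ (serre_mem hij _)
  exact this hv

/-- By `serre_commute` for the swapped generators, `e_l` maps the image of an `f`-Serre element into
itself; past an `f_b`, it produces only Cartan terms. -/
theorem eOp_mem (hq : q ≠ 0) (hr : ∀ n : ℕ, 1 ≤ n → q ^ n ≠ 1) (hs : s ^ 2 = q) (hκ : κ ≠ 0)
    {v : Words X} (l : X.Node) (hv : v ∈ serreSub X q) : eOp X q s κ l v ∈ serreSub X q := by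
  have hs0 : s ≠ 0 := by rintro rfl; exact hq (by simp [← hs])
  have H := preRel (X := X) (q := q) hs0 hκ
  -- The intersection keeps membership of `u` itself available, which the Cartan terms of `[e_l,
  -- f_l]` require.
  have : serreSub X q ≤ serreSub X q ⊓ (serreSub X q).comap (eOp X q s κ l) := by
    refine serreSub_le (fun b u hu => ⟨fOp_mem b hu.1, ?_⟩) fun i j hij u => ⟨serre_mem hij u, ?_⟩
    · rw [Submodule.comap_coe, Set.mem_preimage, ← Module.End.mul_apply]
      have hfe : (fOp X b * eOp X q s κ l) u ∈ serreSub X q := fOp_mem b hu.2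
      by_cases hlb : l = b
      · subst hlb
        have := congrArg (fun T : Module.End ℂ (Words X) => T u) (H.ef_same l)
        simp only [LinearMap.sub_apply, sub_eq_iff_eq_add] at this
        rw [SetLike.mem_coe, this]
        refine Submodule.add_mem _ (Submodule.smul_mem _ _ (Submodule.sub_mem _ ?_ ?_)) hfe
        · rw [pow_two]; exact kOp_mem l (kOp_mem l hu.1)
        · rw [pow_two]; exact kinvOp_mem hs0 hκ l (kinvOp_mem hs0 hκ l hu.1)
      · rw [H.ef_ne l b hlb]
        exact hfe
    · rw [Submodule.comap_coe, Set.mem_preimage, ← Module.End.mul_apply,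
        (H.swap hs0).serre_commute hq hr hs hij l]
      exact serre_mem hij _
  exact (this hv).2

end Verma

namespace Verma

variable {X : AffineType} {q s κ : ℂ}

variable (X q s κ) in
/-- The action of the free algebra on words. -/
noncomputable def wordRep : FreeAlgebra ℂ (UGen X.Node) →ₐ[ℂ] Module.End ℂ (Words X) :=
  FreeAlgebra.lift ℂ fun
    | .e i => eOp X q s κ i
    | .f i => fOp X i
    | .k i => kOp X s κ i
    | .kinv i => kinvOp X s κ i

theorem wordRep_mem (hq : q ≠ 0) (hr : ∀ n : ℕ, 1 ≤ n → q ^ n ≠ 1) (hs : s ^ 2 = q) (hκ : κ ≠ 0)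
    (x : FreeAlgebra ℂ (UGen X.Node)) :
    serreSub X q ≤ (serreSub X q).comap (wordRep X q s κ x) := by
  have hs0 : s ≠ 0 := by rintro rfl; exact hq (by simp [← hs])
  induction x using FreeAlgebra.induction with
  | grade0 r =>
    intro v hv
    rw [AlgHom.commutes, Submodule.mem_comap, Module.algebraMap_end_apply]
    exact Submodule.smul_mem _ _ hv
  | grade1 g =>
    intro v hv
    rw [wordRep, FreeAlgebra.lift_ι_apply, Submodule.mem_comap]
    cases g with
    | e i => exact eOp_mem hq hr hs hκ i hv
    | f i => exact fOp_mem i hv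
    | k i => exact kOp_mem i hv
    | kinv i => exact kinvOp_mem hs0 hκ i hv
  | mul a b ha hb =>
    intro v hv
    rw [map_mul, Submodule.mem_comap, Module.End.mul_apply]
    exact ha (hb hv)
  | add a b ha hb =>
    intro v hv
    rw [map_add, Submodule.mem_comap, LinearMap.add_apply]
    exact Submodule.add_mem _ (ha hv) (hb hv)

/-- The action of the free algebra on the quotient by the Serre elements. -/
noncomputable def quotRepFree (hq : q ≠ 0) (hr : ∀ n : ℕ, 1 ≤ n → q ^ n ≠ 1) (hs : s ^ 2 = q)
    (hκ : κ ≠ 0) :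
    FreeAlgebra ℂ (UGen X.Node) →ₐ[ℂ] Module.End ℂ (Words X ⧸ serreSub X q) :=
  AlgHom.ofLinearMap
    { toFun := fun x => (serreSub X q).mapQ (serreSub X q) (wordRep X q s κ x)
        (wordRep_mem hq hr hs hκ x)
      map_add' := fun x y => Submodule.linearMap_qext _ (LinearMap.ext fun v => by simp)
      map_smul' := fun a x => Submodule.linearMap_qext _ (LinearMap.ext fun v => by simp) }
    (Submodule.linearMap_qext _ (LinearMap.ext fun v => by simp))
    (fun x y => Submodule.linearMap_qext _ (LinearMap.ext fun v => by simp))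

theorem quotRepFree_rel (hq : q ≠ 0) (hr : ∀ n : ℕ, 1 ≤ n → q ^ n ≠ 1) (hs : s ^ 2 = q)
    (hκ : κ ≠ 0) {x y : FreeAlgebra ℂ (UGen X.Node)} (h : Uq.Rel X q s x y) :
    quotRepFree hq hr hs hκ x = quotRepFree hq hr hs hκ y := by
  have hs0 : s ≠ 0 := by rintro rfl; exact hq (by simp [← hs])
  have H := preRel (X := X) (q := q) hs0 hκ
  have he : ∀ i, wordRep X q s κ (Uq.gen X (.e i)) = eOp X q s κ i := fun i => by
    rw [wordRep, FreeAlgebra.lift_ι_apply]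
  have hf : ∀ i, wordRep X q s κ (Uq.gen X (.f i)) = fOp X i := fun i => by
    rw [wordRep, FreeAlgebra.lift_ι_apply]
  have hk : ∀ i, wordRep X q s κ (Uq.gen X (.k i)) = kOp X s κ i := fun i => by
    rw [wordRep, FreeAlgebra.lift_ι_apply]
  have hki : ∀ i, wordRep X q s κ (Uq.gen X (.kinv i)) = kinvOp X s κ i := fun i => by
    rw [wordRep, FreeAlgebra.lift_ι_apply]
  refine Submodule.linearMap_qext _ (LinearMap.ext fun v => ?_)
  change Submodule.Quotient.mk (wordRep X q s κ x v) = Submodule.Quotient.mk (wordRep X q s κ y v)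
  -- All relations except the Serre relations for `f` already hold on words, so beyond this point
  -- the other cases are contradictory.
  by_cases hxy : wordRep X q s κ x = wordRep X q s κ y
  · rw [hxy]
  have hS : ∀ Q m x y, wordRep X q s κ (qSerre Q m x y) =
      qSerre Q m (wordRep X q s κ x) (wordRep X q s κ y) := fun Q m x y => by
    simp only [qSerre, map_sum, map_smul, map_mul, map_pow]
  cases h with
  | serre_f i j hij =>
    rw [hS, hf, hf, map_zero, Submodule.Quotient.eq, LinearMap.zero_apply, sub_zero]
    exact serre_mem hij v
  | serre_e i j hij =>
    exact absurd (by rw [hS, he, he, map_zero, serre_e_eq_zero hq hr hs hκ hij]) hxy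
  | k_kinv i => exact absurd (by rw [map_mul, hk, hki, map_one, H.k_kinv]) hxy
  | kinv_k i => exact absurd (by rw [map_mul, hk, hki, map_one, H.kinv_k]) hxy
  | k_comm i j => exact absurd (by rw [map_mul, map_mul, hk, hk, H.k_comm]) hxy
  | k_e i j =>
    refine absurd ?_ hxy
    rw [map_mul, map_mul, map_smul, hk, hki, he, H.k_e, smul_mul_assoc, mul_assoc, H.k_kinv,
      mul_one]
  | k_f i j =>
    refine absurd ?_ hxy
    rw [map_mul, map_mul, map_smul, hk, hki, hf, H.k_f, smul_mul_assoc, mul_assoc, H.k_kinv,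
      mul_one]
  | e_f_same i =>
    refine absurd ?_ hxy
    rw [map_sub, map_mul, map_mul, map_smul, map_sub, map_pow, map_pow, hk, hki, he, hf, H.ef_same]
  | e_f_ne i j hij =>
    refine absurd ?_ hxy
    rw [map_sub, map_mul, map_mul, he, hf, H.ef_ne i j hij, sub_self, map_zero]

/-- The Verma module. -/
noncomputable def rep (hq : q ≠ 0) (hr : ∀ n : ℕ, 1 ≤ n → q ^ n ≠ 1) (hs : s ^ 2 = q)
    (hκ : κ ≠ 0) : Uq X q s →ₐ[ℂ] Module.End ℂ (Words X ⧸ serreSub X q) :=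
  RingQuot.liftAlgHom ℂ ⟨quotRepFree hq hr hs hκ, fun _ _ h => quotRepFree_rel hq hr hs hκ h⟩

theorem rep_proj (hq : q ≠ 0) (hr : ∀ n : ℕ, 1 ≤ n → q ^ n ≠ 1) (hs : s ^ 2 = q) (hκ : κ ≠ 0)
    (x : FreeAlgebra ℂ (UGen X.Node)) (v : Words X) :
    rep hq hr hs hκ (Uq.proj X q s x) (Submodule.Quotient.mk v) =
      Submodule.Quotient.mk (wordRep X q s κ x v) := by
  rw [rep, RingQuot.liftAlgHom_mkAlgHom_apply]
  rfl

/-! ### Matrix coefficients along the powers of one `f_a`. -/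

/-- The coefficient of the word `a ⋯ a` of length `n`. -/
noncomputable def coef (a : X.Node) (n : ℕ) : Words X →ₗ[ℂ] ℂ := Finsupp.lapply (List.replicate n a)

theorem coef_single (a : X.Node) (n : ℕ) (l : List X.Node) :
    coef a n (Finsupp.single l 1) = if l = List.replicate n a then 1 else 0 := by
  rw [coef, Finsupp.lapply_apply, Finsupp.single_apply]

theorem coef_zero_fOp (a b : X.Node) (v : Words X) : coef a 0 (fOp X b v) = 0 := by
  have : coef a 0 ∘ₗ fOp X b = 0 := hom_ext fun l => by
    simp [fOp_single, coef_single]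
  exact congrArg (fun T : Words X →ₗ[ℂ] ℂ => T v) this

theorem coef_succ_fOp (a b : X.Node) (n : ℕ) (v : Words X) :
    coef a (n + 1) (fOp X b v) = if b = a then coef a n v else 0 := by
  have : coef a (n + 1) ∘ₗ fOp X b = if b = a then coef a n else 0 := hom_ext fun l => by
    rw [LinearMap.comp_apply, fOp_single, coef_single, List.replicate_succ]
    split_ifs with h1 h2 h2
    · rw [coef_single, if_pos (List.cons_injective (h2 ▸ h1))]
    · exact absurd (List.cons.inj h1).1 h2
    · rw [coef_single, if_neg (fun h => h1 (by rw [h2, h]))]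
    · rfl
  have := congrArg (fun T : Words X →ₗ[ℂ] ℂ => T v) this
  simp only [LinearMap.comp_apply] at this
  rw [this]
  split_ifs <;> rfl

theorem coef_fOp_ne {a b : X.Node} (h : b ≠ a) (n : ℕ) (v : Words X) :
    coef a n (fOp X b v) = 0 := by
  cases n with
  | zero => exact coef_zero_fOp a b v
  | succ n => rw [coef_succ_fOp, if_neg h]

theorem coef_pow_fOp {a b : X.Node} {v : Words X} (h : ∀ n, coef a n v = 0) (r n : ℕ) :
    coef a n ((fOp X b ^ r) v) = 0 := by
  induction r generalizing n with
  | zero => exact h n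
  | succ r ih =>
    rw [pow_succ', Module.End.mul_apply]
    cases n with
    | zero => exact coef_zero_fOp _ _ _
    | succ n =>
      rw [coef_succ_fOp]
      split_ifs
      · exact ih n
      · rfl

/-- Each term of a Serre element contains both an `f_i` and an `f_j`, so it produces no word in the
single letter `a`. Applying further `f_l` cannot change that, and the coefficients descend to the
quotient. -/
theorem coef_serreSub (a : X.Node) (n : ℕ) : serreSub X q ≤ LinearMap.ker (coef a n) := by
  have : serreSub X q ≤ ⨅ n, LinearMap.ker (coef a n) := by
    refine serreSub_le (fun l v hv => ?_) fun i j hij v => ?_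
    · simp only [Submodule.mem_iInf, LinearMap.mem_ker] at hv ⊢
      intro n
      simpa using coef_pow_fOp (b := l) hv 1 n
    · simp only [Submodule.mem_iInf, LinearMap.mem_ker]
      intro n
      simp only [qSerre, LinearMap.sum_apply, LinearMap.smul_apply, Module.End.mul_apply, map_sum,
        map_smul]
      refine sum_eq_zero fun r hr => ?_
      suffices h : coef a n ((fOp X i ^ (X.mult i j + 1 - r)) (fOp X j ((fOp X i ^ r) v))) = 0 by
        rw [h, smul_zero]
      by_cases ha : j = a
      · subst ha
        have hi : ∀ r n u, 1 ≤ r → coef j n ((fOp X i ^ r) u) = 0 := by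
          intro r n u hr1
          obtain ⟨r, rfl⟩ := Nat.exists_eq_add_of_le' hr1
          rw [pow_succ', Module.End.mul_apply]
          exact coef_fOp_ne hij n _
        rcases Nat.eq_zero_or_pos (X.mult i j + 1 - r) with h | h
        · rw [h, pow_zero, Module.End.one_apply]
          have hr1 : 1 ≤ r := by omega
          cases n with
          | zero => exact coef_zero_fOp _ _ _
          | succ n => rw [coef_succ_fOp, if_pos rfl, hi r n v hr1]
        · exact hi _ n _ h
      · exact coef_pow_fOp (fun n => coef_fOp_ne ha n _) _ n
  exact this.trans (iInf_le _ n)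

/-- Among the words with one more letter, only the power of `a` can become a power of `a` after
`e_a` deletes a letter. Each of its positions contributes one scalar of the sum. -/
theorem coef_eOp (a : X.Node) (n : ℕ) (v : Words X) :
    coef a n (eOp X q s κ a v) =
      (∑ t ∈ range (n + 1), efScalar X q s κ a (List.replicate t a)) * coef a (n + 1) v := by
  have key : ∀ l n, coef a n (eVec X q s κ a l) =
      (∑ t ∈ range (n + 1), efScalar X q s κ a (List.replicate t a)) *
        coef a (n + 1) (Finsupp.single l 1) := by
    intro l
    induction l with
    | nil => intro n; simp [eVec, coef_single, List.replicate_succ]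
    | cons b l ih =>
      intro n
      rw [← fOp_single, coef_succ_fOp, eVec, map_add]
      by_cases hb : a = b
      · subst hb
        rw [if_pos rfl, if_pos rfl, map_smul, coef_single]
        cases n with
        | zero =>
          rw [coef_zero_fOp, sum_range_one]
          by_cases hl : l = List.replicate 0 a
          · subst hl; simp
          · simp only [hl, if_false, smul_zero, smul_eq_mul, mul_zero, zero_add]
        | succ n =>
          rw [coef_succ_fOp, if_pos rfl, ih, sum_range_succ _ (n + 1), coef_single]
          by_cases hl : l = List.replicate (n + 1) a
          · subst hl; simp
          · simp [hl]
      · rw [if_neg hb, if_neg (Ne.symm hb), map_zero, add_zero, coef_fOp_ne (Ne.symm hb), mul_zero]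
  have : coef a n ∘ₗ eOp X q s κ a =
      (∑ t ∈ range (n + 1), efScalar X q s κ a (List.replicate t a)) • coef a (n + 1) :=
    hom_ext fun l => by
      rw [LinearMap.comp_apply, eOp_single, key]; rfl
  exact congrArg (fun T : Words X →ₗ[ℂ] ℂ => T v) this

theorem coef_kOp (a i : X.Node) (n : ℕ) (v : Words X) :
    coef a n (kOp X s κ i v) =
      κ * (s ^ (-((X.d i : ℤ) * X.cartan i a))) ^ n * coef a n v := by
  have hw : ∀ n, wt X s κ i (List.replicate n a) =
      κ * (s ^ (-((X.d i : ℤ) * X.cartan i a))) ^ n := by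
    intro n
    induction n with
    | zero => simp [wt]
    | succ n ih => rw [List.replicate_succ, wt, ih, pow_succ]; ring
  have : coef a n ∘ₗ kOp X s κ i = (κ * (s ^ (-((X.d i : ℤ) * X.cartan i a))) ^ n) • coef a n :=
    hom_ext fun l => by
      rw [LinearMap.comp_apply, kOp_single, map_smul, LinearMap.smul_apply, coef_single]
      split_ifs with h
      · rw [h, hw]
      · simp
  exact congrArg (fun T : Words X →ₗ[ℂ] ℂ => T v) this

end Verma

/-- The matrix coefficients of the Verma module of highest weight `κ` between the highest weight
vector and the powers of `f_a` applied to it. -/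
structure VermaCoeff (X : AffineType) (q s κ : ℂ) (a : X.Node) (L : ℕ → Uq X q s →ₗ[ℂ] ℂ)
    (b : ℕ → ℂ) : Prop where
  zero_one : L 0 1 = 1
  succ_one (n) : L (n + 1) 1 = 0
  mul_e (n x i) : L n (x * Uq.e X q s i) = 0
  mul_k (n x i) : L n (x * Uq.k X q s i) = κ * L n x
  zero_f_mul (i x) : L 0 (Uq.f X q s i * x) = 0
  succ_f_mul (n i x) : L (n + 1) (Uq.f X q s i * x) = if i = a then L n x else 0
  e_mul (n x) : L n (Uq.e X q s a * x) = b n * L (n + 1) x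
  k_mul (n i x) : L n (Uq.k X q s i * x) =
    κ * (s ^ (-((X.d i : ℤ) * X.cartan i a))) ^ n * L n x
  b_zero : b 0 = (X.qi q a - (X.qi q a)⁻¹)⁻¹ * (κ ^ 2 - κ⁻¹ ^ 2)

theorem exists_vermaCoeff {X : AffineType} {q s κ : ℂ} (hq : q ≠ 0)
    (hr : ∀ n : ℕ, 1 ≤ n → q ^ n ≠ 1) (hs : s ^ 2 = q) (hκ : κ ≠ 0) (a : X.Node) :
    ∃ L b, VermaCoeff X q s κ a L b := by
  let vac : Verma.Words X := Finsupp.single [] 1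
  let L : ℕ → Uq X q s →ₗ[ℂ] ℂ := fun n =>
    ((Verma.serreSub X q).liftQ (Verma.coef a n) (Verma.coef_serreSub a n)) ∘ₗ
      LinearMap.applyₗ (Submodule.Quotient.mk vac) ∘ₗ (Verma.rep hq hr hs hκ).toLinearMap
  have hL : ∀ n x, L n (Uq.proj X q s x) = Verma.coef a n (Verma.wordRep X q s κ x vac) := by
    intro n x
    change (Verma.serreSub X q).liftQ (Verma.coef a n) (Verma.coef_serreSub a n)
      (Verma.rep hq hr hs hκ (Uq.proj X q s x) (Submodule.Quotient.mk vac)) = _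
    rw [Verma.rep_proj]
    rfl
  have he : ∀ i, Verma.wordRep X q s κ (Uq.gen X (.e i)) = Verma.eOp X q s κ i := fun i => by
    rw [Verma.wordRep, FreeAlgebra.lift_ι_apply]
  have hf : ∀ i, Verma.wordRep X q s κ (Uq.gen X (.f i)) = Verma.fOp X i := fun i => by
    rw [Verma.wordRep, FreeAlgebra.lift_ι_apply]
  have hk : ∀ i, Verma.wordRep X q s κ (Uq.gen X (.k i)) = Verma.kOp X s κ i := fun i => by
    rw [Verma.wordRep, FreeAlgebra.lift_ι_apply]
  have hsurj : ∀ x : Uq X q s, ∃ y, Uq.proj X q s y = x := RingQuot.mkAlgHom_surjective ℂ _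
  have h1 : ∀ n, L n 1 = Verma.coef a n vac := fun n => by
    have := hL n 1
    rwa [map_one (Uq.proj X q s), map_one (Verma.wordRep X q s κ), Module.End.one_apply] at this
  refine ⟨L, fun n => ∑ t ∈ range (n + 1), Verma.efScalar X q s κ a (List.replicate t a),
    ?_, ?_, ?_, ?_, ?_, ?_, ?_, ?_, ?_⟩
  · rw [h1, Verma.coef_single]
    rfl
  · intro n
    rw [h1, Verma.coef_single, if_neg (by simp [List.replicate_succ])]
  · intro n x i
    obtain ⟨y, rfl⟩ := hsurj x
    rw [Uq.e, ← map_mul, hL, map_mul, he, Module.End.mul_apply, Verma.eOp_single, Verma.eVec,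
      map_zero, map_zero]
  · intro n x i
    obtain ⟨y, rfl⟩ := hsurj x
    rw [Uq.k, ← map_mul, hL, hL, map_mul, hk, Module.End.mul_apply, Verma.kOp_single, Verma.wt,
      map_smul, map_smul, smul_eq_mul]
  · intro i x
    obtain ⟨y, rfl⟩ := hsurj x
    rw [Uq.f, ← map_mul, hL, map_mul, hf, Module.End.mul_apply, Verma.coef_zero_fOp]
  · intro n i x
    obtain ⟨y, rfl⟩ := hsurj x
    rw [Uq.f, ← map_mul, hL, hL, map_mul, hf, Module.End.mul_apply, Verma.coef_succ_fOp]
  · intro n x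
    obtain ⟨y, rfl⟩ := hsurj x
    rw [Uq.e, ← map_mul, hL, hL, map_mul, he, Module.End.mul_apply, Verma.coef_eOp]
  · intro n i x
    obtain ⟨y, rfl⟩ := hsurj x
    rw [Uq.k, ← map_mul, hL, hL, map_mul, hk, Module.End.mul_apply, Verma.coef_kOp]
  · simp [Verma.efScalar, Verma.wt]

/-! ### Rescaling the generators and separating degrees. -/

theorem qSerre_smul {R : Type*} [Ring R] [Algebra ℂ R] (Q : ℂ) (m : ℕ) (a b : ℂ) (x y : R) :
    qSerre Q m (a • x) (b • y) = (a ^ (m + 1) * b) • qSerre Q m x y := by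
  simp only [qSerre, smul_sum]
  refine sum_congr rfl fun r hr => ?_
  have : a ^ (m + 1) = a ^ (m + 1 - r) * a ^ r := by
    rw [← pow_add, Nat.sub_add_cancel (Nat.lt_succ_iff.mp (mem_range.mp hr))]
  simp only [smul_pow, smul_mul_assoc, mul_smul_comm, smul_smul]
  rw [this]
  congr 1
  ring

namespace Uq

variable {X : AffineType} {q s : ℂ}

variable (X q s) in
/-- The rescaling of the generators on the free algebra. -/
noncomputable def scaleFree (t : X.Node → ℂ) : FreeAlgebra ℂ (UGen X.Node) →ₐ[ℂ] Uq X q s :=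
  FreeAlgebra.lift ℂ fun
    | .e i => t i • e X q s i
    | .f i => (t i)⁻¹ • f X q s i
    | .k i => k X q s i
    | .kinv i => kinv X q s i

theorem scaleFree_rel {t : X.Node → ℂ} (ht : ∀ i, t i ≠ 0) {x y : FreeAlgebra ℂ (UGen X.Node)}
    (h : Rel X q s x y) : scaleFree X q s t x = scaleFree X q s t y := by
  have H := preRel X q s
  have he : ∀ i, scaleFree X q s t (gen X (.e i)) = t i • e X q s i := fun i => by
    rw [scaleFree, FreeAlgebra.lift_ι_apply]
  have hf : ∀ i, scaleFree X q s t (gen X (.f i)) = (t i)⁻¹ • f X q s i := fun i => by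
    rw [scaleFree, FreeAlgebra.lift_ι_apply]
  have hk : ∀ i, scaleFree X q s t (gen X (.k i)) = k X q s i := fun i => by
    rw [scaleFree, FreeAlgebra.lift_ι_apply]
  have hki : ∀ i, scaleFree X q s t (gen X (.kinv i)) = kinv X q s i := fun i => by
    rw [scaleFree, FreeAlgebra.lift_ι_apply]
  cases h with
  | serre_f i j hij => rw [map_qSerre, hf, hf, map_zero, qSerre_smul, serre_f X q s hij, smul_zero]
  | serre_e i j hij => rw [map_qSerre, he, he, map_zero, qSerre_smul, serre_e X q s hij, smul_zero]
  | k_kinv i => rw [map_mul, hk, hki, map_one, H.k_kinv]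
  | kinv_k i => rw [map_mul, hk, hki, map_one, H.kinv_k]
  | k_comm i j => rw [map_mul, map_mul, hk, hk, H.k_comm]
  | k_e i j =>
    rw [map_mul, map_mul, map_smul, hk, hki, he, mul_smul_comm, smul_mul_assoc, H.k_e,
      smul_mul_assoc, mul_assoc, H.k_kinv, mul_one, smul_comm]
  | k_f i j =>
    rw [map_mul, map_mul, map_smul, hk, hki, hf, mul_smul_comm, smul_mul_assoc, H.k_f,
      smul_mul_assoc, mul_assoc, H.k_kinv, mul_one, smul_comm]
  | e_f_same i =>
    rw [map_sub, map_mul, map_mul, map_smul, map_sub, map_pow, map_pow, hk, hki, he, hf,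
      ← H.ef_same]
    simp only [smul_mul_assoc, mul_smul_comm, smul_smul, mul_inv_cancel₀ (ht i),
      inv_mul_cancel₀ (ht i), one_smul]
  | e_f_ne i j hij =>
    rw [map_sub, map_mul, map_mul, he, hf, map_zero]
    simp only [smul_mul_assoc, mul_smul_comm, H.ef_ne i j hij]
    rw [smul_comm, sub_self]

/-- The endomorphism rescaling the generators, `e_i ↦ t_i e_i` and `f_i ↦ t_i⁻¹ f_i`. -/
noncomputable def scale {t : X.Node → ℂ} (ht : ∀ i, t i ≠ 0) : Uq X q s →ₐ[ℂ] Uq X q s :=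
  RingQuot.liftAlgHom ℂ ⟨scaleFree X q s t, fun _ _ h => scaleFree_rel ht h⟩

theorem scale_e {t : X.Node → ℂ} (ht : ∀ i, t i ≠ 0) (i : X.Node) :
    scale ht (e X q s i) = t i • e X q s i := by
  rw [e, scale, RingQuot.liftAlgHom_mkAlgHom_apply, scaleFree, FreeAlgebra.lift_ι_apply]; rfl

theorem scale_f {t : X.Node → ℂ} (ht : ∀ i, t i ≠ 0) (i : X.Node) :
    scale ht (f X q s i) = (t i)⁻¹ • f X q s i := by
  rw [f, scale, RingQuot.liftAlgHom_mkAlgHom_apply, scaleFree, FreeAlgebra.lift_ι_apply]; rfl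

theorem scale_k {t : X.Node → ℂ} (ht : ∀ i, t i ≠ 0) (i : X.Node) :
    scale ht (k X q s i) = k X q s i := by
  rw [k, scale, RingQuot.liftAlgHom_mkAlgHom_apply, scaleFree, FreeAlgebra.lift_ι_apply]; rfl

/-- A relation between `A_i` and `A_j` may be split according to the degree in `α_j`. -/
theorem onsagerDefect_split {i j : X.Node} (hij : i ≠ j) {c c' w : X.Node → ℂ} {Q : ℂ} {m : ℕ}
    {ρ : ℕ → ℂ} (h : onsagerDefect q Q m ρ (realization X q s c c' w i)
      (realization X q s c c' w j) = 0) :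
    c' j • onsagerDefect q Q m ρ (realization X q s c c' w i) (f X q s j * k X q s j) = 0 ∧
    w j • onsagerDefect q Q m ρ (realization X q s c c' w i) (k X q s j ^ 2) = 0 := by
  have key : ∀ u : ℂ, u ≠ 0 →
      u • (c j • onsagerDefect q Q m ρ (realization X q s c c' w i) (e X q s j * k X q s j)) +
      u⁻¹ • (c' j • onsagerDefect q Q m ρ (realization X q s c c' w i) (f X q s j * k X q s j)) +
      w j • onsagerDefect q Q m ρ (realization X q s c c' w i) (k X q s j ^ 2) = 0 := by
    intro u hu
    have ht : ∀ l, Function.update (fun _ : X.Node => (1 : ℂ)) j u l ≠ 0 := by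
      intro l
      by_cases hl : l = j
      · subst hl; simpa using hu
      · simp [hl]
    have := congrArg (scale ht) h
    rw [onsagerDefect_realization, map_zero] at this
    have hA : scale ht (realization X q s c c' w i) = realization X q s c c' w i := by
      simp [realization, scale_e, scale_f, scale_k, Function.update_of_ne hij]
    simp only [map_add, map_smul, map_onsagerDefect, hA, map_mul, map_pow, scale_e, scale_f,
      scale_k, Function.update_self, smul_mul_assoc, onsagerDefect_smul] at this
    rw [← this, smul_comm u, smul_comm u⁻¹]
  -- The expression is `u a + u⁻¹ b + d`, so three nonzero values of `u` determine its coefficients.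
  have k1 := key 1 one_ne_zero
  have k2 := key (-1) (by norm_num)
  have k3 := key 2 two_ne_zero
  generalize c j • onsagerDefect q Q m ρ (realization X q s c c' w i) (e X q s j * k X q s j) = a
    at *
  generalize c' j • onsagerDefect q Q m ρ (realization X q s c c' w i) (f X q s j * k X q s j) = b
    at *
  generalize w j • onsagerDefect q Q m ρ (realization X q s c c' w i) (k X q s j ^ 2) = d at *
  constructor
  · have e1 : b = (-(2 : ℂ) / 3) • ((2 : ℂ) • a + (2 : ℂ)⁻¹ • b + d) +
        (1 : ℂ) • ((1 : ℂ) • a + (1 : ℂ)⁻¹ • b + d) +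
        (-(1 / 3) : ℂ) • ((-1 : ℂ) • a + (-1 : ℂ)⁻¹ • b + d) := by
      match_scalars <;> norm_num
    rw [e1, k1, k2, k3]
    simp
  · have e1 : d = (1 / 2 : ℂ) • ((1 : ℂ) • a + (1 : ℂ)⁻¹ • b + d) +
        (1 / 2 : ℂ) • ((-1 : ℂ) • a + (-1 : ℂ)⁻¹ • b + d) := by
      match_scalars <;> norm_num
    rw [e1, k1, k2]
    simp

end Uq

/-! ### Dependence of the defect on the constants `ρ`. -/

section Difference

variable {R : Type*} [Ring R] [Algebra ℂ R] {q Q : ℂ}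

theorem onsagerDefect_one_sub (h0 : Q ≠ 0) (hr : ∀ n : ℕ, 1 ≤ n → Q ^ n ≠ 1) (ρ ρ' : ℕ → ℂ)
    (x y : R) :
    onsagerDefect q Q 1 ρ x y = onsagerDefect q Q 1 ρ' x y - (ρ 0 - ρ' 0) • y := by
  rw [onsagerDefect_one h0 hr, onsagerDefect_one h0 hr, quadDefect, quadDefect]
  module

theorem onsagerDefect_two_sub (h0 : Q ≠ 0) (hr : ∀ n : ℕ, 1 ≤ n → Q ^ n ≠ 1) (ρ ρ' : ℕ → ℂ)
    (x y : R) :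
    onsagerDefect q Q 2 ρ x y = onsagerDefect q Q 2 ρ' x y - (ρ 0 - ρ' 0) • (x * y - y * x) := by
  rw [onsagerDefect_two h0 hr, onsagerDefect_two h0 hr, quadDefect, quadDefect]
  simp only [mul_sub, sub_mul, mul_smul_comm, smul_mul_assoc]
  module

theorem onsagerDefect_three_sub (ρ ρ' : ℕ → ℂ) (x y : R) :
    onsagerDefect q q 3 ρ x y = onsagerDefect q q 3 ρ' x y -
      ((ρ 0 - ρ' 0) • quadDefect (onsagerGamma q 3 0 1) 0 x y + (ρ 1 - ρ' 1) • y) := by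
  rw [onsagerDefect_three, onsagerDefect_three]
  module

theorem onsagerDefect_four_sub (ρ ρ' : ℕ → ℂ) (x y : R) :
    onsagerDefect q q 4 ρ x y = onsagerDefect q q 4 ρ' x y -
      ((ρ 0 - ρ' 0) • quadDefect (onsagerGamma q 4 0 1 - 1) 0 x (x * y - y * x) +
        (ρ 1 - ρ' 1) • (x * y - y * x)) := by
  rw [onsagerDefect_four, onsagerDefect_four]
  module

theorem qInt_three_ne (h0 : q ≠ 0) (hr : ∀ n : ℕ, 1 ≤ n → q ^ n ≠ 1) : q ^ 2 + 1 + q⁻¹ ^ 2 ≠ 0 := by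
  rw [← qInt_three h0 (hr 2 (by norm_num))]
  exact qInt_ne_zero h0 hr (by norm_num)

/-- After multiplication by the denominator of `γ` and by `q⁻³` the expression becomes `[2](q -
q⁻¹)²[3]²`, which is nonzero as `q` is not a root of unity. It will appear as a leading coefficient.
-/
theorem gamma_three_ne (h0 : q ≠ 0) (hr : ∀ n : ℕ, 1 ≤ n → q ^ n ≠ 1)
    (hd : q ^ 4 + 2 * q ^ 2 + 4 + 2 * q⁻¹ ^ 2 + q⁻¹ ^ 4 ≠ 0) :
    1 - onsagerGamma q 3 0 1 * q ^ 3 + q ^ 6 ≠ 0 := by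
  intro h
  have h1 := sub_inv_ne h0 (hr 2 (by norm_num))
  have h2 : q + q⁻¹ ≠ 0 := by
    rw [← qInt_two h0 (hr 2 (by norm_num))]
    exact qInt_ne_zero h0 hr (by norm_num)
  have h3 := qInt_three_ne h0 hr
  have hg : onsagerGamma q 3 0 1 * (q ^ 4 + 2 * q ^ 2 + 4 + 2 * q⁻¹ ^ 2 + q⁻¹ ^ 4) =
      (q + q⁻¹) * (q ^ 2 + q⁻¹ ^ 2) * (q ^ 2 + 3 + q⁻¹ ^ 2) := by
    rw [onsagerGamma, div_mul_cancel₀ _ hd]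
  have : (q + q⁻¹) * ((q - q⁻¹) ^ 2 * (q ^ 2 + 1 + q⁻¹ ^ 2) ^ 2) = 0 := by
    have e : (q ^ 4 + 2 * q ^ 2 + 4 + 2 * q⁻¹ ^ 2 + q⁻¹ ^ 4) *
        ((q⁻¹) ^ 3 * (1 - onsagerGamma q 3 0 1 * q ^ 3 + q ^ 6)) =
        (q + q⁻¹) * ((q - q⁻¹) ^ 2 * (q ^ 2 + 1 + q⁻¹ ^ 2) ^ 2) := by
      have e2 : (q⁻¹) ^ 3 * (1 - onsagerGamma q 3 0 1 * q ^ 3 + q ^ 6) =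
          q⁻¹ ^ 3 + q ^ 3 - onsagerGamma q 3 0 1 := by field_simp; ring
      rw [e2, mul_sub, mul_comm _ (onsagerGamma q 3 0 1), hg]
      field_simp
      ring
    rw [← e, h, mul_zero, mul_zero]
  exact mul_ne_zero h2 (mul_ne_zero (pow_ne_zero _ h1) (pow_ne_zero _ h3)) this

/-- Here the product with the denominator of `γ` and `q⁻⁴` is `[3](q - q⁻¹)²(q² + q⁻²)²`. -/
theorem gamma_four_ne (h0 : q ≠ 0) (hr : ∀ n : ℕ, 1 ≤ n → q ^ n ≠ 1)
    (hd : q ^ 4 + q⁻¹ ^ 4 + 3 ≠ 0) :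
    1 - (onsagerGamma q 4 0 1 - 1) * q ^ 4 + q ^ 8 ≠ 0 := by
  intro h
  have h2' := hr 2 (by norm_num)
  have h1 := sub_inv_ne h0 h2'
  have h2 : q ^ 2 + q⁻¹ ^ 2 ≠ 0 := by
    intro h2
    apply qInt_ne_zero h0 hr (n := 4) (by norm_num)
    rw [qInt_four h0 h2', h2, mul_zero]
  have h3 := qInt_three_ne h0 hr
  have hg : onsagerGamma q 4 0 1 * (q ^ 4 + q⁻¹ ^ 4 + 3) =
      (q ^ 2 + 1 + q⁻¹ ^ 2) * (q ^ 4 + q ^ 2 + 1 + q⁻¹ ^ 2 + q⁻¹ ^ 4) := by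
    rw [onsagerGamma, div_mul_cancel₀ _ hd, qInt_three h0 h2', qInt_five h0 h2']
  have : (q ^ 2 + 1 + q⁻¹ ^ 2) * ((q - q⁻¹) ^ 2 * (q ^ 2 + q⁻¹ ^ 2) ^ 2) = 0 := by
    have e : (q ^ 4 + q⁻¹ ^ 4 + 3) *
        ((q⁻¹) ^ 4 * (1 - (onsagerGamma q 4 0 1 - 1) * q ^ 4 + q ^ 8)) =
        (q ^ 2 + 1 + q⁻¹ ^ 2) * ((q - q⁻¹) ^ 2 * (q ^ 2 + q⁻¹ ^ 2) ^ 2) := by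
      have e2 : (q⁻¹) ^ 4 * (1 - (onsagerGamma q 4 0 1 - 1) * q ^ 4 + q ^ 8) =
          q⁻¹ ^ 4 + q ^ 4 + 1 - onsagerGamma q 4 0 1 := by field_simp; ring
      rw [e2, mul_sub, mul_comm _ (onsagerGamma q 4 0 1), hg]
      field_simp
      ring
    rw [← e, h, mul_zero, mul_zero]
  exact mul_ne_zero h3 (mul_ne_zero (pow_ne_zero _ h1) (pow_ne_zero _ h2)) this

end Difference

/-! ### Matrix coefficients of products with `A_a`. -/

namespace VermaCoeff

variable {X : AffineType} {q s κ : ℂ} {a : X.Node} {L : ℕ → Uq X q s →ₗ[ℂ] ℂ} {b : ℕ → ℂ}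

theorem zero_realization_mul (V : VermaCoeff X q s κ a L b) (hs : s ^ 2 = q)
    (c c' w : X.Node → ℂ) (x : Uq X q s) :
    L 0 (Uq.realization X q s c c' w a * x) =
      c a * (b 0 * κ * (X.qi q a)⁻¹) * L 1 x + w a * κ ^ 2 * L 0 x := by
  have h := (X.zpow_cartan_self hs a).2
  simp only [Uq.realization, add_mul, smul_mul_assoc, mul_assoc, map_add, map_smul, pow_two,
    V.e_mul, V.k_mul, V.zero_f_mul, smul_eq_mul, h]
  ring

theorem succ_realization_mul (V : VermaCoeff X q s κ a L b) (hs : s ^ 2 = q)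
    (c c' w : X.Node → ℂ) (n : ℕ) (x : Uq X q s) :
    L (n + 1) (Uq.realization X q s c c' w a * x) =
      c a * (b (n + 1) * κ * (X.qi q a)⁻¹ ^ (n + 2)) * L (n + 2) x +
      c' a * (κ * (X.qi q a)⁻¹ ^ n) * L n x +
      w a * (κ * (X.qi q a)⁻¹ ^ (n + 1)) ^ 2 * L (n + 1) x := by
  have h := (X.zpow_cartan_self hs a).2
  simp only [Uq.realization, add_mul, smul_mul_assoc, mul_assoc, map_add, map_smul, pow_two,
    V.e_mul, V.k_mul, V.succ_f_mul, smul_eq_mul, h, if_true]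

theorem group_mul (V : VermaCoeff X q s κ a L b) (hs : s ^ 2 = q) {j : X.Node} (hj : a ≠ j) (n : ℕ)
    (x : Uq X q s) :
    L n (Uq.k X q s j ^ 2 * x) = κ ^ 2 * (X.qi q a ^ X.mult a j) ^ n * L n x := by
  have h := (X.zpow_cartan (s := s) hj).2.2.2
  have h2 : (X.nu s a j)⁻¹ * (X.nu s a j)⁻¹ = X.qi q a ^ X.mult a j := by
    rw [← mul_inv, X.nu_sq hs, inv_pow, inv_inv]
  rw [← h2]
  simp only [pow_two, mul_assoc, V.k_mul, h]
  rw [mul_pow]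
  ring

end VermaCoeff

namespace VermaCoeff

variable {X : AffineType} {q s κ : ℂ} {a : X.Node} {L : ℕ → Uq X q s →ₗ[ℂ] ℂ} {b : ℕ → ℂ}

/-- Acting first on the highest weight vector, `e_i` kills it and `k_i²` gives `κ²`. -/
theorem mul_upper (V : VermaCoeff X q s κ a L b) (i : X.Node) (c w : ℂ) (n : ℕ) (x : Uq X q s) :
    L n (x * (c • (Uq.e X q s i * Uq.k X q s i) + w • Uq.k X q s i ^ 2)) =
      w * κ ^ 2 * L n x := by
  rw [mul_add, mul_smul_comm, mul_smul_comm, pow_two, ← mul_assoc x, ← mul_assoc x, map_add,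
    map_smul, map_smul, V.mul_k, V.mul_k, V.mul_k, V.mul_e]
  simp only [smul_eq_mul]
  ring

theorem one_f_mul_k (V : VermaCoeff X q s κ a L b) :
    L 1 (Uq.f X q s a * Uq.k X q s a) = κ := by
  have h := V.mul_k 0 1 a
  rw [one_mul, V.zero_one, mul_one] at h
  rw [V.succ_f_mul 0, if_pos rfl, h]

/-- The element `x` sends the highest weight vector to a vector with leading coefficient `t`
in degree `N`. -/
def Leading (L : ℕ → Uq X q s →ₗ[ℂ] ℂ) (N : ℕ) (t : ℂ) (x : Uq X q s) : Prop :=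
  L N x = t ∧ ∀ n, N < n → L n x = 0

theorem leading_one (V : VermaCoeff X q s κ a L b) : Leading L 0 1 1 :=
  ⟨V.zero_one, fun n hn => by
    obtain ⟨n, rfl⟩ := Nat.exists_eq_add_of_le' hn
    exact V.succ_one n⟩

/-- Only the `f_a` part of `A_a` raises the degree, so the leading coefficient never sees `c a` or
`w a`. -/
theorem Leading.realization_mul (V : VermaCoeff X q s κ a L b) (hs : s ^ 2 = q)
    (c c' w : X.Node → ℂ) {N : ℕ} {t : ℂ} {x : Uq X q s} (h : Leading L N t x) :
    Leading L (N + 1) (c' a * (κ * (X.qi q a)⁻¹ ^ N) * t) (Uq.realization X q s c c' w a * x) := by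
  refine ⟨?_, fun n hn => ?_⟩
  · rw [V.succ_realization_mul hs, h.1, h.2 _ (by omega), h.2 _ (by omega)]
    ring
  · obtain ⟨n, rfl⟩ := Nat.exists_eq_add_of_le' (show 1 ≤ n by omega)
    rw [V.succ_realization_mul hs, h.2 _ (by omega), h.2 _ (by omega), h.2 _ (by omega)]
    ring

theorem Leading.group_mul (V : VermaCoeff X q s κ a L b) (hs : s ^ 2 = q) {j : X.Node}
    (hj : a ≠ j) {N : ℕ} {t : ℂ} {x : Uq X q s} (h : Leading L N t x) :
    Leading L N (κ ^ 2 * (X.qi q a ^ X.mult a j) ^ N * t) (Uq.k X q s j ^ 2 * x) := by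
  refine ⟨?_, fun n hn => ?_⟩
  · rw [V.group_mul hs hj, h.1]
  · rw [V.group_mul hs hj, h.2 n hn, mul_zero]

end VermaCoeff

/-! ### Constraints and structure constants forced by a relation. -/

section Necessity

variable {X : AffineType} {q s : ℂ} {i j : X.Node} {c c' w : X.Node → ℂ} {ρ ρ' : ℕ → ℂ}

/-- The highest weight coefficient of the relation is, up to `κ²`, affine in `κ⁴`; vanishing at `κ =
1, 2` kills both of its coefficients. -/
theorem necessity_one (hq : q ≠ 0) (hr : ∀ n : ℕ, 1 ≤ n → q ^ n ≠ 1) (hs : s ^ 2 = q)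
    (hij : i ≠ j) (hm : X.mult i j = 1) (hρ' : RhoSpec q (X.qi q i) (c i * c' i) (X.mult i j) ρ')
    (h : onsagerDefect q (X.qi q i) (X.mult i j) ρ (Uq.realization X q s c c' w i)
      (Uq.k X q s j ^ 2) = 0) :
    baseFactor X q c c' w i = 0 ∧ ρ 0 = ρ' 0 := by
  have hk := Uq.onsagerDefect_k hq hr hs hij c c' w hρ'
  simp only [hm, if_true] at hk h
  rw [onsagerDefect_one_sub (X.qi_ne_zero hq i) (X.qi_not_root hr i) ρ ρ', hk,
    mul_baseFactor hq hr] at h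
  have hb := qi_add_inv_sub_two_ne hq hr i
  set b := X.qi q i + (X.qi q i)⁻¹ - 2
  have key : ∀ κ : ℂ, κ ≠ 0 → b * baseFactor X q c c' w i * κ ^ 4 + (ρ 0 - ρ' 0) = 0 := by
    intro κ hκ
    obtain ⟨L, b', V⟩ := exists_vermaCoeff hq hr hs hκ i
    have h1 := congrArg (L 0) h
    have h2 := V.group_mul hs hij 0 1
    rw [mul_one] at h2
    have hk0 : L 0 (Uq.k X q s i) = κ := by
      have := V.mul_k 0 1 i
      rwa [one_mul, V.zero_one, mul_one] at this
    simp only [map_sub, map_smul, V.group_mul hs hij, pow_two (Uq.k X q s i), mul_assoc, V.k_mul,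
      V.mul_k, smul_eq_mul, h2, hk0, V.zero_one, map_zero, pow_zero, mul_one] at h1
    apply mul_left_cancel₀ (pow_ne_zero 2 hκ)
    linear_combination -h1
  have k1 := key 1 one_ne_zero
  have k2 := key 2 two_ne_zero
  constructor
  · apply mul_left_cancel₀ hb
    linear_combination (1 / 15) * (k2 - k1)
  · linear_combination (16 / 15) * k1 - (1 / 15) * k2

theorem realization_mul_f (hq : q ≠ 0) (hs : s ^ 2 = q) (hij : i ≠ j) :
    Uq.realization X q s c c' w i * (Uq.f X q s j * Uq.k X q s j) =
      X.qi q i ^ X.mult i j • (Uq.f X q s j * Uq.k X q s j *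
        (c i • (Uq.e X q s i * Uq.k X q s i) + w i • Uq.k X q s i ^ 2)) +
      c' i • (Uq.f X q s i * (Uq.k X q s i * (Uq.f X q s j * Uq.k X q s j))) := by
  have hs0 : s ≠ 0 := by rintro rfl; exact hq (by simp [← hs])
  obtain ⟨h1, h2⟩ := (Uq.preRel X q s).smul_mul_weight_f hs hs0 hij (c i)
  rw [inv_inv] at h1 h2
  rw [Uq.realization, add_mul, add_mul, h2, smul_mul_assoc, smul_mul_assoc, h1, mul_add,
    mul_smul_comm (w i), mul_assoc (Uq.f X q s i)]
  module

/-- In the module for node `j`, the coefficient of `f_j` in the commutator of `A_i` with `f_j k_j`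
is `w_i(p² - 1)`. It is independent of `c_i` and `c'_i`, so no case distinction is needed. -/
theorem necessity_two (hq : q ≠ 0) (hr : ∀ n : ℕ, 1 ≤ n → q ^ n ≠ 1) (hs : s ^ 2 = q)
    (hij : i ≠ j) (hm : X.mult i j = 2) (hρ' : RhoSpec q (X.qi q i) (c i * c' i) (X.mult i j) ρ')
    (hw : w i ≠ 0)
    (h : onsagerDefect q (X.qi q i) (X.mult i j) ρ (Uq.realization X q s c c' w i)
      (Uq.f X q s j * Uq.k X q s j) = 0) : ρ 0 = ρ' 0 := by
  have hf := Uq.onsagerDefect_f hq hr hs hij c c' w hρ'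
  have hA := realization_mul_f (c := c) (c' := c') (w := w) hq hs hij
  simp only [hm] at hf h hA
  rw [onsagerDefect_two_sub (X.qi_ne_zero hq i) (X.qi_not_root hr i) ρ ρ', hf, hA] at h
  obtain ⟨L, b, V⟩ := exists_vermaCoeff hq hr hs (one_ne_zero (α := ℂ)) j
  have h1 := congrArg (L 1) h
  have hf2 : ∀ x, L 1 (Uq.f X q s i * x) = 0 := fun x => by
    simpa [hij] using V.succ_f_mul 0 i x
  have h3 : L 1 (Uq.f X q s j * Uq.k X q s j * Uq.realization X q s c c' w i) = w i := by
    have h4 := V.mul_upper i (c i) (w i) 1 (Uq.f X q s j * Uq.k X q s j)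
    have h5 : L 1 (Uq.f X q s j * Uq.k X q s j * (Uq.f X q s i * Uq.k X q s i)) = 0 := by
      rw [mul_assoc, V.succ_f_mul 0, if_pos rfl, V.k_mul, V.zero_f_mul, mul_zero]
    rw [V.one_f_mul_k] at h4
    rw [Uq.realization, add_right_comm, mul_add, map_add, h4, mul_smul_comm, map_smul, h5,
      smul_zero]
    ring
  simp only [map_sub, map_add, map_smul, hf2, h3, V.mul_upper, V.one_f_mul_k, smul_eq_mul,
    map_zero] at h1
  have h2 := sq_sub_one_ne (X.qi_not_root hr i) 2 (by norm_num)
  have h6 : (ρ 0 - ρ' 0) * (w i * (X.qi q i ^ 2 - 1)) = 0 := by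
    linear_combination -h1
  exact sub_eq_zero.mp ((mul_eq_zero.mp h6).resolve_right (mul_ne_zero hw h2))

/-- The highest weight coefficient gives `P_i T_i = 0` by its dependence on `κ`. Top degree
coefficients then give the constants when `c'_i ≠ 0`. -/
theorem necessity_three (hq : q ≠ 0) (hr : ∀ n : ℕ, 1 ≤ n → q ^ n ≠ 1) (hs : s ^ 2 = q)
    (hij : i ≠ j) (hm : X.mult i j = 3) (hρ' : RhoSpec q (X.qi q i) (c i * c' i) (X.mult i j) ρ')
    (h : onsagerDefect q (X.qi q i) (X.mult i j) ρ (Uq.realization X q s c c' w i)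
      (Uq.k X q s j ^ 2) = 0) :
    baseFactor X q c c' w i * tripleFactor X q c c' w i = 0 ∧
      (c' i ≠ 0 → ρ 0 = ρ' 0 ∧ ρ 1 = ρ' 1) := by
  have hk := Uq.onsagerDefect_k hq hr hs hij c c' w hρ'
  obtain ⟨hp, hden, -, -⟩ := hρ'.three hm
  simp only [hm, hp, OfNat.ofNat_ne_one, if_false, if_true] at hk h
  have hB := mul_baseFactor hq hr c c' w i
  have hT := mul_tripleFactor hq hr c c' w i
  rw [hp] at hB hT
  rw [onsagerDefect_three_sub ρ ρ', hk, hB, hT] at h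
  set B := baseFactor X q c c' w i
  set T := tripleFactor X q c c' w i
  have hP : q + q⁻¹ - 2 ≠ 0 := by
    have := qi_add_inv_sub_two_ne hq hr i
    rwa [hp] at this
  have hC : q + q⁻¹ + 1 ≠ 0 := by
    intro h0
    apply sq_sub_one_ne hr 3 (by norm_num)
    have e : q ^ 3 - 1 = q * (q - 1) * (q + q⁻¹ + 1) := by field_simp; ring
    rw [e, h0, mul_zero]
  set D := (q + q⁻¹ + 1) ^ 2 * ((q + q⁻¹ - 2) * B) * ((q + q⁻¹ - 2) * T) with hD
  set γ := onsagerGamma q 3 0 1 with hγ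
  -- The unknown differences in `ρ` contribute only terms of degree at most one in `κ⁴`, while `D`
  -- is the coefficient of `(κ⁴)²`.
  have key : ∃ α β : ℂ, ∀ κ : ℂ, κ ≠ 0 →
      D * κ ^ 8 - ((ρ 0 - ρ' 0) * (α * κ ^ 4 + β) + (ρ 1 - ρ' 1)) = 0 := by
    refine ⟨(2 - γ * q ^ 3) * (c i * c' i * ((q - q⁻¹)⁻¹ * q⁻¹)) + (2 - γ) * w i ^ 2,
      -((2 - γ * q ^ 3) * (c i * c' i * ((q - q⁻¹)⁻¹ * q⁻¹))), fun κ hκ => ?_⟩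
    obtain ⟨L, b', V⟩ := exists_vermaCoeff hq hr hs hκ i
    have h1 := congrArg (L 0) h
    have hone := V.succ_one
    have r0 := V.zero_realization_mul hs c c' w
    have r1 := V.succ_realization_mul hs c c' w 0
    have k0 := V.group_mul hs hij 0
    have k1 := V.group_mul hs hij 1
    have z0 : ∀ x, L 0 (Uq.k X q s i * x) = κ * L 0 x := fun x => by
      simpa using V.k_mul 0 i x
    have y0 : L 0 (Uq.k X q s j ^ 2) = κ ^ 2 := by
      simpa [V.zero_one] using k0 1
    have y1 : L 1 (Uq.k X q s j ^ 2) = 0 := by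
      simpa [hone 0] using k1 1
    have a0 : L 0 (Uq.realization X q s c c' w i) = w i * κ ^ 2 := by
      simpa [V.zero_one, hone 0] using r0 1
    have a1 : L 1 (Uq.realization X q s c c' w i) = c' i * κ := by
      simpa [V.zero_one, hone 0, hone 1] using r1 1
    have g0 : L 0 (Uq.k X q s i) = κ := by
      simpa [V.zero_one] using z0 1
    have y2 : L 2 (Uq.k X q s j ^ 2) = 0 := by
      simpa [hone 1] using V.group_mul hs hij 2 1
    simp only [zero_add, pow_zero, pow_one, mul_one, hm, hp] at r0 r1 k0 k1
    simp only [quadDefect, map_sub, map_add, map_smul, smul_eq_mul, map_zero, r0, r1, k0, k1,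
      pow_two (Uq.k X q s i), mul_assoc, z0, g0, y0, y1, y2, a0, a1, zero_smul, V.b_zero, hp] at h1
    apply mul_left_cancel₀ (pow_ne_zero 2 hκ)
    have hκ2 : κ ^ 4 * κ⁻¹ ^ 2 = κ ^ 2 := by field_simp
    linear_combination h1 - (2 - γ * q ^ 3) * q⁻¹ * (c i * c' i) * (q - q⁻¹)⁻¹ *
      (ρ 0 - ρ' 0) * hκ2
  obtain ⟨α, β, key⟩ := key
  -- This is the second divided difference at `κ⁴ = 1, 16, 81`, which extracts the quadratic
  -- coefficient and removes the affine part.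
  have hD0 : D = 0 := by
    linear_combination (1 / 1200 : ℂ) * key 1 one_ne_zero - (1 / 975 : ℂ) * key 2 two_ne_zero +
      (1 / 5200 : ℂ) * key 3 three_ne_zero
  have hBT : B * T = 0 := by
    have e : (q + q⁻¹ + 1) ^ 2 * (q + q⁻¹ - 2) ^ 2 * (B * T) = 0 := by
      rw [← hD0, hD]; ring
    exact (mul_eq_zero.mp e).resolve_left (mul_ne_zero (pow_ne_zero _ hC) (pow_ne_zero _ hP))
  refine ⟨hBT, fun hc' => ?_⟩
  rw [hD0, zero_smul, zero_sub, neg_eq_zero] at h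
  obtain ⟨L, b', V⟩ := exists_vermaCoeff hq hr hs (one_ne_zero (α := ℂ)) i
  have lA := fun {N t x} => VermaCoeff.Leading.realization_mul (N := N) (t := t) (x := x) V hs c c' w
  have ly := fun {N t x} => VermaCoeff.Leading.group_mul (N := N) (t := t) (x := x) V hs hij
  have l0 := V.leading_one
  have hy := ly l0
  have e1 := (lA (lA hy)).1
  have e2 := (lA (ly (lA l0))).1
  have e3 := (ly (lA (lA l0))).1
  have e4 := hy.2 2 (by norm_num)
  -- The coefficient of `f_i²` involves only the difference of the `ρ 0`; the coefficient in degree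
  -- zero then yields `ρ 1`.
  have h1 := congrArg (L 2) h
  simp only [mul_one] at e1 e2 e3 e4
  norm_num only at e1 e2 e3
  simp only [quadDefect, map_sub, map_add, map_smul, smul_eq_mul, map_zero, e1, e2, e3, e4, hm, hp,
    mul_zero] at h1
  have hδ : ρ 0 - ρ' 0 = 0 := by
    have : (ρ 0 - ρ' 0) * (c' i ^ 2 * q⁻¹ * (1 - γ * q ^ 3 + q ^ 6)) = 0 := by
      linear_combination h1
    exact (mul_eq_zero.mp this).resolve_right (mul_ne_zero (mul_ne_zero (pow_ne_zero _ hc')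
      (inv_ne_zero hq)) (gamma_three_ne hq hr hden))
  have h2 := congrArg (L 0) h
  have e5 := hy.1
  simp only [mul_one] at e5
  simp only [hδ, zero_smul, zero_add, map_smul, e5, map_zero, smul_eq_mul] at h2
  exact ⟨sub_eq_zero.mp hδ, sub_eq_zero.mp (by linear_combination h2)⟩

/-- The defect with `ρ̄` vanishes on `k_j²`, so only the difference terms are left. The coefficients
of `f_i³` and `f_i` determine them successively. -/
theorem necessity_four (hq : q ≠ 0) (hr : ∀ n : ℕ, 1 ≤ n → q ^ n ≠ 1) (hs : s ^ 2 = q)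
    (hij : i ≠ j) (hm : X.mult i j = 4) (hρ' : RhoSpec q (X.qi q i) (c i * c' i) (X.mult i j) ρ')
    (hc' : c' i ≠ 0)
    (h : onsagerDefect q (X.qi q i) (X.mult i j) ρ (Uq.realization X q s c c' w i)
      (Uq.k X q s j ^ 2) = 0) : ρ 0 = ρ' 0 ∧ ρ 1 = ρ' 1 := by
  have hk := Uq.onsagerDefect_k hq hr hs hij c c' w hρ'
  obtain ⟨hp, hden, -, -⟩ := hρ'.four hm
  simp only [hm, hp, OfNat.ofNat_ne_one, OfNat.ofNat_eq_ofNat, Nat.reduceEqDiff, if_false] at hk h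
  rw [onsagerDefect_four_sub ρ ρ', hk, zero_sub, neg_eq_zero] at h
  obtain ⟨L, b', V⟩ := exists_vermaCoeff hq hr hs (one_ne_zero (α := ℂ)) i
  have lA := fun {N t x} => VermaCoeff.Leading.realization_mul (N := N) (t := t) (x := x) V hs c c' w
  have ly := fun {N t x} => VermaCoeff.Leading.group_mul (N := N) (t := t) (x := x) V hs hij
  have l0 := V.leading_one
  have e1 := (lA (lA (lA (ly l0)))).1
  have e2 := (lA (lA (ly (lA l0)))).1
  have e3 := (lA (ly (lA (lA l0)))).1
  have e4 := (ly (lA (lA (lA l0)))).1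
  have e5 := (lA (ly l0)).2 3 (by norm_num)
  have e6 := (ly (lA l0)).2 3 (by norm_num)
  have e7 := (lA (ly l0)).1
  have e8 := (ly (lA l0)).1
  simp only [mul_one, hm, hp] at e1 e2 e3 e4 e5 e6 e7 e8
  norm_num only at e1 e2 e3 e4 e7 e8
  have h1 := congrArg (L 3) h
  simp only [quadDefect, mul_sub, sub_mul, mul_assoc, map_sub, map_add, map_smul, smul_eq_mul,
    map_zero, e1, e2, e3, e4, e5, e6] at h1
  have h4 := sq_sub_one_ne hr 4 (by norm_num)
  have hδ : ρ 0 - ρ' 0 = 0 := by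
    have : (ρ 0 - ρ' 0) * (c' i ^ 3 * q⁻¹ ^ 3 * ((q ^ 4 - 1) *
        (1 - (onsagerGamma q 4 0 1 - 1) * q ^ 4 + q ^ 8))) = 0 := by
      linear_combination -h1
    exact (mul_eq_zero.mp this).resolve_right (mul_ne_zero (mul_ne_zero (pow_ne_zero _ hc')
      (pow_ne_zero _ (inv_ne_zero hq))) (mul_ne_zero h4 (gamma_four_ne hq hr hden)))
  have h2 := congrArg (L 1) h
  simp only [hδ, zero_smul, zero_add, map_smul, map_sub, e7, e8, map_zero, smul_eq_mul] at h2
  have h3 : (ρ 1 - ρ' 1) * (c' i * (q ^ 4 - 1)) = 0 := by linear_combination -h2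
  exact ⟨sub_eq_zero.mp hδ,
    sub_eq_zero.mp ((mul_eq_zero.mp h3).resolve_right (mul_ne_zero hc' h4))⟩

/-- Without an `f_i` part, `A_i` simply `q`-commutes with `f_j k_j`. The difference becomes a
combination of `y A³` and `y A`, separated by varying `κ` in the module for node `j`. -/
theorem necessity_four_of_eq_zero (hq : q ≠ 0) (hr : ∀ n : ℕ, 1 ≤ n → q ^ n ≠ 1) (hs : s ^ 2 = q)
    (hij : i ≠ j) (hm : X.mult i j = 4) (hρ' : RhoSpec q (X.qi q i) (c i * c' i) (X.mult i j) ρ')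
    (hc' : c' i = 0) (hw : w i ≠ 0)
    (h : onsagerDefect q (X.qi q i) (X.mult i j) ρ (Uq.realization X q s c c' w i)
      (Uq.f X q s j * Uq.k X q s j) = 0) : ρ 0 = ρ' 0 ∧ ρ 1 = ρ' 1 := by
  have hf := Uq.onsagerDefect_f hq hr hs hij c c' w hρ'
  have hA := realization_mul_f (c := c) (c' := c') (w := w) hq hs hij
  obtain ⟨hp, hden, -, -⟩ := hρ'.four hm
  have hR : Uq.realization X q s c c' w i =
      c i • (Uq.e X q s i * Uq.k X q s i) + w i • Uq.k X q s i ^ 2 := by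
    rw [Uq.realization, hc', zero_smul, add_zero]
  rw [hc', zero_smul, add_zero, ← hR, hm, hp] at hA
  rw [hm, hp] at hf h
  rw [onsagerDefect_four_sub ρ ρ', hf, zero_sub, neg_eq_zero] at h
  have hA' : ∀ x, Uq.realization X q s c c' w i * (Uq.f X q s j * Uq.k X q s j * x) =
      q ^ 4 • (Uq.f X q s j * Uq.k X q s j * (Uq.realization X q s c c' w i * x)) := fun x => by
    rw [← mul_assoc, hA, smul_mul_assoc, mul_assoc _ _ x]
  set A := Uq.realization X q s c c' w i
  set y := Uq.f X q s j * Uq.k X q s j with hy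
  have e1 : (ρ 0 - ρ' 0) • quadDefect (onsagerGamma q 4 0 1 - 1) 0 A (A * y - y * A) +
      (ρ 1 - ρ' 1) • (A * y - y * A) =
      ((ρ 0 - ρ' 0) * ((q ^ 4 - 1) * (1 - (onsagerGamma q 4 0 1 - 1) * q ^ 4 + q ^ 8))) •
        (y * A * A * A) + ((ρ 1 - ρ' 1) * (q ^ 4 - 1)) • (y * A) := by
    simp only [quadDefect, mul_sub, sub_mul, hA, hA', mul_smul_comm, smul_mul_assoc, smul_sub,
      smul_smul, mul_assoc y, zero_smul, sub_zero, mul_assoc A]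
    module
  rw [e1] at h
  have key : ∀ κ : ℂ, κ ≠ 0 →
      (ρ 0 - ρ' 0) * ((q ^ 4 - 1) * (1 - (onsagerGamma q 4 0 1 - 1) * q ^ 4 + q ^ 8)) *
        (w i ^ 3 * κ ^ 4) + (ρ 1 - ρ' 1) * (q ^ 4 - 1) * w i = 0 := by
    intro κ hκ
    obtain ⟨L, b, V⟩ := exists_vermaCoeff hq hr hs hκ j
    have hm : ∀ x, L 1 (x * A) = w i * κ ^ 2 * L 1 x := fun x => by
      rw [hR]; exact V.mul_upper i (c i) (w i) 1 x
    have h1 := congrArg (L 1) h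
    simp only [map_add, map_smul, hm, hy, V.one_f_mul_k, smul_eq_mul, map_zero] at h1
    apply mul_left_cancel₀ (pow_ne_zero 3 hκ)
    linear_combination h1
  have k1 := key 1 one_ne_zero
  have k2 := key 2 two_ne_zero
  have h4 := sq_sub_one_ne hr 4 (by norm_num)
  have hδ : (ρ 0 - ρ' 0) * (((q ^ 4 - 1) * (1 - (onsagerGamma q 4 0 1 - 1) * q ^ 4 + q ^ 8)) *
      w i ^ 3) = 0 := by
    linear_combination (1 / 15 : ℂ) * (k2 - k1)
  have hδ0 := (mul_eq_zero.mp hδ).resolve_right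
    (mul_ne_zero (mul_ne_zero h4 (gamma_four_ne hq hr hden)) (pow_ne_zero _ hw))
  rw [hδ0, zero_mul, zero_mul, zero_add, mul_assoc] at k1
  exact ⟨sub_eq_zero.mp hδ0,
    sub_eq_zero.mp ((mul_eq_zero.mp k1).resolve_right (mul_ne_zero h4 hw))⟩

end Necessity

/-! ### Assembly of the proposition. -/

theorem RhoSpec.congr {q p κ : ℂ} {m : ℕ} {ρ ρ' : ℕ → ℂ} (h : RhoSpec q p κ m ρ)
    (hρ : ∀ k < (m + 1) / 2, ρ' k = ρ k) : RhoSpec q p κ m ρ' := by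
  refine ⟨h.le, fun hm => ?_, fun hm => ?_, fun hm => ?_, fun hm => ?_⟩
  · rw [hρ 0 (by omega), h.one hm]
  · rw [hρ 0 (by omega), h.two hm]
  · rw [hρ 0 (by omega), hρ 1 (by omega)]
    exact h.three hm
  · rw [hρ 0 (by omega), hρ 1 (by omega)]
    exact h.four hm

theorem constraints_of_realizable {X : AffineType} {q s : ℂ} (hq : q ≠ 0)
    (hr : ∀ n : ℕ, 1 ≤ n → q ^ n ≠ 1) (hs : s ^ 2 = q) {c c' w : X.Node → ℂ}
    {ρ ρ' : X.Node → X.Node → ℕ → ℂ}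
    (hρ' : ∀ i j, i ≠ j → RhoSpec q (X.qi q i) (c i * c' i) (X.mult i j) (ρ' i j))
    (h : Realizable X q s c c' w ρ) : Constraints X q c c' w := by
  rw [realizable_iff] at h
  rw [constraints_iff]
  intro i j hij
  by_cases hw : w j = 0
  · simp [hw]
  have hk := (smul_eq_zero.mp (Uq.onsagerDefect_split hij (h i j hij)).2).resolve_left hw
  refine ⟨fun hm => ?_, fun hm => ?_⟩
  · rw [(necessity_one hq hr hs hij hm (hρ' i j hij) hk).1, mul_zero]
  · rw [mul_assoc, (necessity_three hq hr hs hij hm (hρ' i j hij) hk).1, mul_zero]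

theorem eq_of_realizable {X : AffineType} {q s : ℂ} (hq : q ≠ 0)
    (hr : ∀ n : ℕ, 1 ≤ n → q ^ n ≠ 1) (hs : s ^ 2 = q) {c c' w : X.Node → ℂ}
    {ρ ρ' : X.Node → X.Node → ℕ → ℂ}
    (hρ' : ∀ i j, i ≠ j → RhoSpec q (X.qi q i) (c i * c' i) (X.mult i j) (ρ' i j))
    (hw : ∀ i, w i ≠ 0) (h : Realizable X q s c c' w ρ) {i j : X.Node} (hij : i ≠ j) :
    ∀ k < Oq.numRho X i j, ρ i j k = ρ' i j k := by
  have hC := (constraints_iff X q c c' w).mp (constraints_of_realizable hq hr hs hρ' h)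
  have hsplit := Uq.onsagerDefect_split hij ((realizable_iff X q s c c' w ρ).mp h i j hij)
  have hk := (smul_eq_zero.mp hsplit.2).resolve_left (hw j)
  -- If `c'_l = 0`, both `P_l` and `T_l` reduce to `w_l²`, which is nonzero.
  have hne : ∀ l, c' l = 0 → baseFactor X q c c' w l * tripleFactor X q c c' w l ≠ 0 := by
    intro l hl
    rw [baseFactor, tripleFactor, hl, mul_zero, zero_div, zero_mul, zero_div, add_zero]
    exact mul_ne_zero (pow_ne_zero _ (hw l)) (pow_ne_zero _ (hw l))
  have hf : 2 ≤ X.mult i j → onsagerDefect q (X.qi q i) (X.mult i j) (ρ i j)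
      (Uq.realization X q s c c' w i) (Uq.f X q s j * Uq.k X q s j) = 0 := by
    intro hm
    -- To cancel `c'_j`: for `m ≥ 2` the reverse entry is `-1`, so the constraint for `(j, i)` gives
    -- `P_j = 0`, which excludes `c'_j = 0`.
    refine (smul_eq_zero.mp hsplit.1).resolve_left fun h0 => hne j h0 ?_
    have := (hC j i hij.symm).1 ((X.cartan_data hij).2.2.2.2.2.1 hm)
    rw [(mul_eq_zero.mp this).resolve_left (hw i), zero_mul]
  have hS := hρ' i j hij
  have two : ρ i j 0 = ρ' i j 0 ∧ ρ i j 1 = ρ' i j 1 →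
      ∀ k < 2, ρ i j k = ρ' i j k := fun h k hk => by
    interval_cases k
    exacts [h.1, h.2]
  have one : ρ i j 0 = ρ' i j 0 → ∀ k < 1, ρ i j k = ρ' i j k := fun h k hk => by
    interval_cases k
    exact h
  have hm : X.mult i j = 0 ∨ X.mult i j = 1 ∨ X.mult i j = 2 ∨ X.mult i j = 3 ∨
      X.mult i j = 4 := by
    have := hS.le
    omega
  rcases hm with hm | hm | hm | hm | hm <;> rw [Oq.numRho, hm]
  · intro k hk
    omega
  · exact one (necessity_one hq hr hs hij hm hS hk).2
  · exact one (necessity_two hq hr hs hij hm hS (hw i) (hf (by omega)))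
  · have := necessity_three hq hr hs hij hm hS hk
    exact two (this.2 fun h0 => hne i h0 this.1)
  · refine two ?_
    -- For `m = 4` no constraint makes `P_i` or `T_i` vanish, so `c'_i = 0` is possible here.
    by_cases h0 : c' i = 0
    · exact necessity_four_of_eq_zero hq hr hs hij hm hS h0 (hw i) (hf (by omega))
    · exact necessity_four hq hr hs hij hm hS h0 hk

theorem proposition2p1 (X : AffineType) (q s : ℂ) (hq : q ≠ 0)
    (hroot : ∀ n : ℕ, 1 ≤ n → q ^ n ≠ 1) (hs : s ^ 2 = q)
    (hden3 : ∀ i j : X.Node, X.cartan i j = -3 →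
      q ^ 4 + 2 * q ^ 2 + 4 + 2 * q⁻¹ ^ 2 + q⁻¹ ^ 4 ≠ 0)
    (hden4 : ∀ i j : X.Node, X.cartan i j = -4 → q ^ 4 + q⁻¹ ^ 4 + 3 ≠ 0)
    (c c' w : X.Node → ℂ) :
    ((∃ ρ : X.Node → X.Node → ℕ → ℂ, Realizable X q s c c' w ρ) ↔ Constraints X q c c' w) ∧
    (Realizable X q s c c' w (rhoValue X q c c') ↔ Constraints X q c c' w) ∧
    ((∀ i, w i ≠ 0) → ∀ ρ : X.Node → X.Node → ℕ → ℂ,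
      Realizable X q s c c' w ρ ↔
        Constraints X q c c' w ∧
          ∀ i j : X.Node, i ≠ j → ∀ k < Oq.numRho X i j, ρ i j k = rhoValue X q c c' i j k) := by
  have hS : ∀ i j, i ≠ j →
      RhoSpec q (X.qi q i) (c i * c' i) (X.mult i j) (rhoValue X q c c' i j) :=
    fun i j hij => rhoSpec_rhoValue hden3 hden4 c c' hij
  refine ⟨⟨fun ⟨ρ, h⟩ => constraints_of_realizable hq hroot hs hS h,
      fun h => ⟨_, realizable_of_constraints hq hroot hs hS h⟩⟩,
    ⟨constraints_of_realizable hq hroot hs hS, realizable_of_constraints hq hroot hs hS⟩,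
    fun hw ρ => ⟨fun h => ⟨constraints_of_realizable hq hroot hs hS h,
      fun i j hij => eq_of_realizable hq hroot hs hS hw h hij⟩,
      fun ⟨hC, h⟩ => realizable_of_constraints hq hroot hs
        (fun i j hij => (hS i j hij).congr (h i j hij)) hC⟩⟩
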